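/- **Setting.** Let $n\ge 1$ agents share a finite non-empty state space $\mathcal S$ and choose joint actions in $\mathcal A=\mathcal A_1\times\dots\times\mathcal A_n$ (finite, non-empty). Let $p_{s,s'}(a)$ be the transition probabilities, $P_a=(p_{s,s'}(a))_{s,s'}$, $r^i(s,a,s')\in[0,1]$ the local reward of agent $i$, $r^i_a(s)=\sum_{s'}p_{s,s'}(a)\,r^i(s,a,s')$ and $r_a=\frac1n\sum_i r_a^i$. For a stationary randomized joint policy $\pi$ let $P^\pi_{s,s'}=\sum_a\pi(a|s)p_{s,s'}(a)$. Assume * *$\tau$-stationarity:* $\tau>1$, and for every $\pi$ the chain $P^\pi$ is ergodic and its stationary distribution $\xi^\pi$ satisfies $\frac1{\sqrt\tau|\mathcal S|}\le\xi^\pi_s\le\frac{\sqrt\tau}{|\mathcal S|}$ for all $s$; * *mixing:* $t_{mix}\ge\max_\pi\min\{t\ge1:\|(P^\pi)^t(s,\cdot)-\xi^\pi\|_{TV}\le\frac14\ \forall s\}$; * *network:* at time $t$ the agents communicate over an undirected graph with edge set $E_t$; for some integer $B\ge1$ the graph with edge set $\bigcup_{l=0}^{B-1}E_{t+l}$ is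 connected for every $t\ge0$; the weight matrices $W^t=(w^t_{ij})$ are symmetric and doubly stochastic, and for some $\eta\in(0,1)$ one has $w^t_{ij}\ge\eta$ if $j=i$ or $\{i,j\}\in E_t$, and $w_{ij}^t=0$ otherwise. Let $\lambda^*$ be the optimal long-run average of $r$; let $\mu^*$ be an optimal solution of the linear program $\max\sum_a\mu(a)^Tr_a$ over $\mu\ge0$ with $\sum_a(I-P_a^T)\mu(a)=0$ and $\sum_{s,a}\mu(s,a)=1$; and let $v^*$ solve the Bellman equation $\lambda^*+v^*(s)=\max_a\{r_a(s)+(P_av^*)(s)\}$ for all $s$, normalized by $\sum_s\xi^*_sv^*(s)=0$, where $\xi^*_s=\sum_a\mu^*(s,a)$. **Algorithm (RMAPD).** Let $\mathcal V=\{v:\|v\|_\infty\le 2t_{mix}\}$, $\mathcal U=\{\mu\ge0:\sum_{s,a}\mu(s,a)=1,\ \sum_a\mu(s,a)\ge\frac1{\sqrt\tau|\mathcal S|}\ \forall s\}$ and $M=4t_{mix}+1$. All agents start from $v_i^0=0$ and from a common $\mu_i^0=\zeta\in\mathcal U$ with positive entries (for instance the uniform one). At time $t$ agent $i$ forms $\tilde\mu_i^t=\sum_jw_{ij}^t\mu_j^t$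 and $\tilde v_i^t=\sum_jw^t_{ij}v^t_j$ and draws a sample $(s,a,s')$ that, given the past, has probability $\tilde\mu_i^t(s,a)\,p_{s,s'}(a)$ (the joint law of the draws of different agents is arbitrary). With $$\Delta_i^{t+1}=\beta\,\frac{v_i^t(s')-v_i^t(s)+r^i(s,a,s')-M}{\tilde\mu_i^t(s,a)}\,\mathbf e_{s,a},\qquad d_i^{t+1}=\frac{\mu_i^t(s,a)}{\tilde\mu_i^t(s,a)}\,\alpha\,(e_s-e_{s'})$$ it sets $$\mu_i^{t+1/2}(x,b)=\frac{\tilde\mu^t_i(x,b)\,e^{\Delta_i^{t+1}(x,b)}}{\sum_{x',b'}\tilde\mu^t_i(x',b')\,e^{\Delta_i^{t+1}(x',b')}},\qquad\mu_i^{t+1}=\operatorname*{argmin}_{\mu\in\mathcal U}D_{KL}(\mu\,\|\,\mu_i^{t+1/2}),\qquad v_i^{t+1}=\Pi_{\mathcal V}[\tilde v_i^t+d_i^{t+1}],$$ where $\Pi_{\mathcal V}$ is the Euclidean projection. **Theorem.** Put $\tilde t_{mix}=1+4t_{mix}$, $\Gamma=(1-\frac{\eta}{4n^2})^{-2}$,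 $\rho=(1-\frac\eta{4n^2})^{1/B}$, $D(\Gamma,\rho)=\frac{1+\Gamma}{1-\rho}$ and $$\mathcal E_0=\frac1n\sum_{i=1}^nD_{KL}(\mu^*\|\mu_i^0)+\frac1{2|\mathcal S|t_{mix}^2}\Big\|\frac1n\sum_{i=1}^nv_i^0-v^*\Big\|_2^2 .$$ There is an absolute constant $C>0$ such that in every such setting, for every $T\ge1$ and every $\kappa>0$, if the algorithm is run with the step sizes $$\beta=\kappa\sqrt{\frac{\mathcal E_0}{\sqrt n\,|\mathcal S||\mathcal A|\,\tilde t_{mix}^{\,2}\,D(\Gamma,\rho)\,T}},\qquad\alpha=|\mathcal S|\,t_{mix}^2\,\beta,$$ then $\hat\mu=\frac1T\sum_{t=0}^{T-1}\frac1n\sum_{i=1}^n\mu_i^t$ satisfies $$\lambda^*+\mathbb E\Big[\sum_{a\in\mathcal A}\big[(I-P_a)v^*-r_a\big]^T\hat\mu(a)\Big]\ \le\ C\max\{\kappa,\kappa^{-1}\}\;\tilde t_{mix}\sqrt{\frac{\sqrt n\,\mathcal E_0\,|\mathcal S||\mathcal A|\,D(\Gamma,\rho)}{T}} .$$ In particular,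 when $\kappa$ and $\kappa^{-1}$ are at most polylogarithmic in the problem parameters, the right-hand side is $\widetilde{\mathcal O}\big(\tilde t_{mix}\sqrt{\sqrt n\,\mathcal E_0|\mathcal S||\mathcal A|D(\Gamma,\rho)/T}\big)$. -/

import Mathlib

open MeasureTheory Filter Topology

noncomputable section

namespace RMAPD

/-- A cooperative multi-agent Markov decision process with `n` agents, state space `S` and joint
action space `A`. `p s a s'` is the probability of moving from `s` to `s'` under the joint action
`a`; `r i s a s'` is the local reward that agent `i` observes on that transition. -/
structure MAMDP (n : ℕ) (S A : Type*) [Fintype S] where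
  p : S → A → S → ℝ
  p_nonneg : ∀ s a s', 0 ≤ p s a s'
  p_sum : ∀ s a, ∑ s', p s a s' = 1
  r : Fin n → S → A → S → ℝ
  r_nonneg : ∀ i s a s', 0 ≤ r i s a s'
  r_le_one : ∀ i s a s', r i s a s' ≤ 1

section MDP

variable {n : ℕ} {S A : Type*} [Fintype S] [Fintype A]

/-- Expected one-step local reward `r^i(s,a)`. -/
def MAMDP.localReward (M : MAMDP n S A) (i : Fin n) (s : S) (a : A) : ℝ :=
  ∑ s', M.p s a s' * M.r i s a s'

/-- System reward `r(s,a) = (1/n) ∑ᵢ rⁱ(s,a)`. -/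
def MAMDP.reward (M : MAMDP n S A) (s : S) (a : A) : ℝ :=
  (1 / (n : ℝ)) * ∑ i, M.localReward i s a

/-- `(P_a x)(s)`, the expectation of `x` after one transition. -/
def MAMDP.next (M : MAMDP n S A) (a : A) (x : S → ℝ) (s : S) : ℝ :=
  ∑ s', M.p s a s' * x s'

/-- A stationary randomized joint policy; `π s a` is the probability `π(a|s)`. -/
structure IsPolicy (π : S → A → ℝ) : Prop where
  nonneg : ∀ s a, 0 ≤ π s a
  sum_one : ∀ s, ∑ a, π s a = 1

/-- Transition matrix `P^π` of the state chain under the policy `π`. -/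
def MAMDP.policyMatrix (M : MAMDP n S A) (π : S → A → ℝ) : Matrix S S ℝ :=
  Matrix.of fun s s' => ∑ a, π s a * M.p s a s'

/-- Expected one-step system reward under the policy `π`. -/
def MAMDP.policyReward (M : MAMDP n S A) (π : S → A → ℝ) (s : S) : ℝ :=
  ∑ a, π s a * M.reward s a

/-- `ξ` is a stationary probability distribution of the chain with transition matrix `P`. -/
structure IsStationary (P : Matrix S S ℝ) (ξ : S → ℝ) : Prop where
  nonneg : ∀ s, 0 ≤ ξ s
  sum_one : ∑ s, ξ s = 1
  invariant : Matrix.vecMul ξ P = ξ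

/-- Total variation distance of two distributions on a finite set. -/
def tvDist (x y : S → ℝ) : ℝ := (1 / 2) * ∑ s, |x s - y s|

open Classical in
/-- The decision process is `τ`-stationary: under every stationary policy the chain is ergodic
(irreducible and aperiodic, i.e. some power of its transition matrix is entrywise positive), and
its stationary distribution lies between `1/(√τ|S|)` and `√τ/|S|`. -/
structure MAMDP.IsTauStationary (M : MAMDP n S A) (τ : ℝ) : Prop where
  one_lt : 1 < τ
  ergodic : ∀ π, IsPolicy π → ∃ k : ℕ, ∀ s s', 0 < (M.policyMatrix π ^ k) s s'
  lower : ∀ π ξ, IsPolicy π → IsStationary (M.policyMatrix π) ξ →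
    ∀ s, 1 / (√τ * (Fintype.card S : ℝ)) ≤ ξ s
  upper : ∀ π ξ, IsPolicy π → IsStationary (M.policyMatrix π) ξ →
    ∀ s, ξ s ≤ √τ / (Fintype.card S : ℝ)

open Classical in
/-- `tmix ≥ max_π min {t ≥ 1 | ‖(P^π)^t(s,·) - ξ^π‖_TV ≤ 1/4 for all s}`. -/
def MAMDP.IsMixing (M : MAMDP n S A) (tmix : ℝ) : Prop :=
  ∀ π ξ, IsPolicy π → IsStationary (M.policyMatrix π) ξ →
    ∃ t : ℕ, 1 ≤ t ∧ (t : ℝ) ≤ tmix ∧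
      ∀ s, tvDist (fun s' => (M.policyMatrix π ^ t) s s') ξ ≤ 1 / 4

open Classical in
/-- Expected system reward accumulated over the first `T` steps from the state `s` under `π`. -/
def MAMDP.cumReward (M : MAMDP n S A) (π : S → A → ℝ) (s : S) (T : ℕ) : ℝ :=
  ∑ t ∈ Finset.range T, Matrix.mulVec (M.policyMatrix π ^ t) (M.policyReward π) s

/-- `lam` is the optimal long-run average reward `max_π lim_T (1/T) E[∑_{t<T} r | s₀ = s]`,
for every initial state `s`. -/
def MAMDP.IsOptimalAverageReward (M : MAMDP n S A) (lam : ℝ) : Prop :=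
  ∀ s, IsGreatest {x : ℝ | ∃ π, IsPolicy π ∧
    Tendsto (fun T : ℕ => (1 / (T : ℝ)) * M.cumReward π s T) atTop (𝓝 x)} lam

/-- Average-reward Bellman equation
`lam + v(s) = max_a { r(s,a) + ∑_{s'} p(s,a,s') v(s') }`. -/
def MAMDP.IsBellman (M : MAMDP n S A) (lam : ℝ) (v : S → ℝ) : Prop :=
  ∀ s, IsGreatest (Set.range fun a => M.reward s a + M.next a v s) (lam + v s)

/-- Feasible points of the occupancy-measure linear program. -/
structure MAMDP.IsFeasible (M : MAMDP n S A) (m : S → A → ℝ) : Prop where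
  nonneg : ∀ s a, 0 ≤ m s a
  sum_one : ∑ s, ∑ a, m s a = 1
  balance : ∀ s', ∑ a, m s' a = ∑ s, ∑ a, M.p s a s' * m s a

/-- `m` solves the linear program `max ∑_{s,a} m(s,a) r(s,a)` over feasible occupancy measures. -/
structure MAMDP.IsOptimalOccupancy (M : MAMDP n S A) (m : S → A → ℝ) : Prop where
  feasible : M.IsFeasible m
  optimal : ∀ m', M.IsFeasible m' →
    ∑ s, ∑ a, m' s a * M.reward s a ≤ ∑ s, ∑ a, m s a * M.reward s a

/-- The optimal average reward `lam`, the differential reward function `vstar` and an optimal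
occupancy measure `mustar`; `vstar` is normalized to have mean zero under the stationary
distribution `ξ*(s) = ∑_a mustar(s,a)` of the optimal policy. -/
structure MAMDP.IsOptimal (M : MAMDP n S A) (lam : ℝ) (vstar : S → ℝ)
    (mustar : S → A → ℝ) : Prop where
  gain : M.IsOptimalAverageReward lam
  bellman : M.IsBellman lam vstar
  occupancy : M.IsOptimalOccupancy mustar
  normalized : ∑ s, (∑ a, mustar s a) * vstar s = 0

/-- `lam + ∑_a [(I - P_a) v - r_a]ᵀ m(a)`. -/
def MAMDP.gap (M : MAMDP n S A) (lam : ℝ) (v : S → ℝ) (m : S → A → ℝ) : ℝ :=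
  lam + ∑ a, ∑ s, (v s - M.next a v s - M.reward s a) * m s a

/-- Kullback-Leibler divergence `D_KL(x ‖ y)`; it is only used for `y` with positive entries. -/
def klDiv (x y : S → A → ℝ) : ℝ := ∑ s, ∑ a, x s a * Real.log (x s a / y s a)

/-- The set `𝒱` of value vectors. -/
def valueSet (S : Type*) (tmix : ℝ) : Set (S → ℝ) := {v | ∀ s, |v s| ≤ 2 * tmix}

/-- The set `𝒰` of occupancy measures. -/
def occupancySet (S A : Type*) [Fintype S] [Fintype A] (τ : ℝ) : Set (S → A → ℝ) :=
  {m | (∀ s a, 0 ≤ m s a) ∧ ∑ s, ∑ a, m s a = 1 ∧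
    ∀ s, 1 / (√τ * (Fintype.card S : ℝ)) ≤ ∑ a, m s a}

/-- The Lyapunov function
`(1/n) ∑ᵢ D_KL(μ* ‖ μᵢ) + ‖(1/n) ∑ᵢ vᵢ - v*‖² / (2 |S| tmix²)`. -/
def lyapunov (tmix : ℝ) (vstar : S → ℝ) (mustar : S → A → ℝ)
    (m : Fin n → S → A → ℝ) (v : Fin n → S → ℝ) : ℝ :=
  (1 / (n : ℝ)) * ∑ i, klDiv mustar (m i) +
    1 / (2 * (Fintype.card S : ℝ) * tmix ^ 2) *
      ∑ s, ((1 / (n : ℝ)) * ∑ i, v i s - vstar s) ^ 2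

/-! ### The communication network -/

/-- Standing conditions on the time-varying undirected graphs `G t` and symmetric doubly
stochastic weight matrices `W t`. The neighbourhood of an agent contains the agent itself. -/
structure IsMixingNetwork (G : ℕ → SimpleGraph (Fin n)) (W : ℕ → Matrix (Fin n) (Fin n) ℝ)
    (η : ℝ) (B : ℕ) : Prop where
  B_pos : 0 < B
  η_pos : 0 < η
  η_lt_one : η < 1
  connected : ∀ t, (⨆ l : Fin B, G (t + l)).Connected
  symm : ∀ t i j, W t i j = W t j i
  weight_ge : ∀ t i j, i = j ∨ (G t).Adj i j → η ≤ W t i j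
  weight_zero : ∀ t i j, i ≠ j → ¬ (G t).Adj i j → W t i j = 0
  row_sum : ∀ t i, ∑ j, W t i j = 1
  col_sum : ∀ t j, ∑ i, W t i j = 1

/-- `Γ = (1 - η/(4n²))⁻²`. -/
def netGamma (n : ℕ) (η : ℝ) : ℝ := ((1 - η / (4 * (n : ℝ) ^ 2)) ^ 2)⁻¹

/-- `ρ = (1 - η/(4n²))^{1/B}`. -/
def netRho (n : ℕ) (η : ℝ) (B : ℕ) : ℝ := (1 - η / (4 * (n : ℝ) ^ 2)) ^ (1 / (B : ℝ))

/-- `D(Γ,ρ) = (1 + Γ)/(1 - ρ)`. -/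
def netD (n : ℕ) (η : ℝ) (B : ℕ) : ℝ := (1 + netGamma n η) / (1 - netRho n η B)

/-! ### The algorithm -/

/-- Consensus averaging of the agents' occupancy measures. -/
def mixMu (w : Matrix (Fin n) (Fin n) ℝ) (m : Fin n → S → A → ℝ) (i : Fin n) (s : S) (a : A) : ℝ :=
  ∑ j, w i j * m j s a

/-- Consensus averaging of the agents' value vectors. -/
def mixV (w : Matrix (Fin n) (Fin n) ℝ) (v : Fin n → S → ℝ) (i : Fin n) (s : S) : ℝ :=
  ∑ j, w i j * v j s

open Classical in
/-- Stochastic dual gradient of agent `i` for the sample `x = (s, a, s')`: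
`β (v(s') - v(s) + rⁱ(s,a,s') - (4 tmix + 1)) / mt(s,a) · e_{s,a}`, with `mt` the mixed occupancy
measure and `v` the agent's value vector. -/
def MAMDP.dualGrad (M : MAMDP n S A) (tmix β : ℝ) (i : Fin n) (mt : S → A → ℝ) (v : S → ℝ)
    (x : S × A × S) (s : S) (a : A) : ℝ :=
  if s = x.1 ∧ a = x.2.1 then
    β * ((v x.2.2 - v x.1 + M.r i x.1 x.2.1 x.2.2 - (4 * tmix + 1)) / mt x.1 x.2.1)
  else 0

open Classical in
/-- Stochastic primal step for the sample `x = (s, a, s')`: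
`(m(s,a)/mt(s,a)) α (e_s - e_{s'})`. -/
def primalGrad (α : ℝ) (m mt : S → A → ℝ) (x : S × A × S) (s : S) : ℝ :=
  m x.1 x.2.1 / mt x.1 x.2.1 * α * ((if s = x.1 then 1 else 0) - (if s = x.2.2 then 1 else 0))

/-- Normalized exponential update `mt(s,a) exp(Δ(s,a)) / ∑_{s',a'} mt(s',a') exp(Δ(s',a'))`. -/
def expUpdate (mt Δ : S → A → ℝ) (s : S) (a : A) : ℝ :=
  mt s a * Real.exp (Δ s a) / ∑ s', ∑ a', mt s' a' * Real.exp (Δ s' a')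

/-- `m ∈ argmin_{m' ∈ U} D_KL(m' ‖ y)`. -/
def IsKLProj (U : Set (S → A → ℝ)) (y m : S → A → ℝ) : Prop :=
  m ∈ U ∧ ∀ m' ∈ U, klDiv m y ≤ klDiv m' y

/-- `w` is the Euclidean projection of `y` onto `V`. -/
def IsEuclideanProj (V : Set (S → ℝ)) (y w : S → ℝ) : Prop :=
  w ∈ V ∧ ∀ w' ∈ V, ∑ s, (w s - y s) ^ 2 ≤ ∑ s, (w' s - y s) ^ 2

/-- A run of the randomized multi-agent primal-dual algorithm with constant step sizes `α` (value
vectors) and `β` (occupancy measures), all agents starting from `ζ` and from `0`. At time `t` agent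
`i` holds `μ t i` and `v t i`, and draws `X t i = (s, a, s')`, which given the past `ℱ t` has the
law `μ̃ᵢᵗ(s,a) p(s,a,s')`. The joint law of the draws of different agents at the same time is left
arbitrary. -/
structure IsRun {Ω : Type*} [mΩ : MeasurableSpace Ω] (M : MAMDP n S A)
    (W : ℕ → Matrix (Fin n) (Fin n) ℝ) (τ tmix α β : ℝ) (ζ : S → A → ℝ)
    (ℙ : Measure Ω) (ℱ : Filtration ℕ mΩ)
    (μ : ℕ → Fin n → Ω → S → A → ℝ) (v : ℕ → Fin n → Ω → S → ℝ)
    (X : ℕ → Fin n → Ω → S × A × S) : Prop where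
  init_mu : ∀ i ω, μ 0 i ω = ζ
  init_v : ∀ i ω, v 0 i ω = 0
  adapted_mu : ∀ t i s a, Measurable[ℱ t] fun ω => μ t i ω s a
  adapted_v : ∀ t i s, Measurable[ℱ t] fun ω => v t i ω s
  adapted_sample : ∀ t i x, MeasurableSet[ℱ (t + 1)] {ω | X t i ω = x}
  sample_law : ∀ t i s a s',
    condExp (ℱ t) ℙ (Set.indicator {ω | X t i ω = (s, a, s')} fun _ => (1 : ℝ)) =ᵐ[ℙ]
      fun ω => mixMu (W t) (fun j => μ t j ω) i s a * M.p s a s'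
  mu_step : ∀ t i ω, IsKLProj (occupancySet S A τ)
    (expUpdate (mixMu (W t) (fun j => μ t j ω) i)
      (M.dualGrad tmix β i (mixMu (W t) (fun j => μ t j ω) i) (v t i ω) (X t i ω)))
    (μ (t + 1) i ω)
  v_step : ∀ t i ω, IsEuclideanProj (valueSet S tmix)
    (mixV (W t) (fun j => v t j ω) i +
      primalGrad α (μ t i ω) (mixMu (W t) (fun j => μ t j ω) i) (X t i ω))
    (v (t + 1) i ω)

/-- Time- and network-averaged occupancy measure `(1/T) ∑_{t<T} (1/n) ∑ᵢ μᵢᵗ`. -/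
def muHat {Ω : Type*} (T : ℕ) (μ : ℕ → Fin n → Ω → S → A → ℝ) (ω : Ω) (s : S) (a : A) : ℝ :=
  (1 / (T : ℝ)) * ∑ t ∈ Finset.range T, (1 / (n : ℝ)) * ∑ i, μ t i ω s a

end MDP

end RMAPD

end

noncomputable section

namespace RMAPD

/-! ### Relative entropy and its projections -/

/-! The algorithm is a stochastic saddle-point method for the linear program: mirror ascent in the
occupancy measures, projected gradient descent in the values. Its progress is measured by
`potential`, the average over agents of KL(μ*‖μᵢ) + ‖vᵢ − v*‖²/(2|S|tmix²). The core is
`expected_potential_le`: in conditional expectation, one step changes the potential by at most −β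
times the gap of the network average, plus a disagreement term, plus O(β²).

First-order terms. The ratio α/β gives the primal and dual increments the same coefficient β. The
dual step pairs the mixed measure with vᵢ and the primal step pairs μᵢ with the mixed values; since
W is symmetric these cancel over the network (`IsWeight.sum_drift_comm`). The drift against μ*
vanishes because μ* is feasible, and what is left is the gap with v*. Agents see local rewards only,
and replacing these by their average costs the disagreement (`IsWeight.sum_reward_le`).

Second-order terms. Subtracting 4tmix + 1 makes every exponent nonpositive, so a quadratic bound on
exp holds however large 1/μ̃ is, and sampling from μ̃ cancels one such factor
(`MAMDP.expect_dualBound_le`). In the primal step each agent keeps a share η of its own measure, so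
the second moment costs 1/η (`MAMDP.expect_primalBound_le`).

Disagreement. A KL-projected step moves by at most twice the largest exponent in ℓ¹ (`l1_step_le`),
which is O(β|S||A|(1 + 4tmix)) in expectation. Consensus contracts dispersion by 1 − η/(2n²) over
each window of B steps (`disp_window_le`), so the expected disagreement stays of order β times the
consensus time n²B/η, which D(Γ,ρ) dominates (`netD_ge`).

The comparison point (μ*, v*) must lie in 𝒰 × 𝒱: `MAMDP.IsTauStationary.mem_occupancySet` and
`MAMDP.IsOptimal.vstar_mem`. Telescoping (`IsRun.sum_integral_gap_le`) and the choice of β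
(`step_size_balance`) then give the rate. -/

lemma mixMu_pos {S A : Type*} {n : ℕ} {w : Matrix (Fin n) (Fin n) ℝ} {m : Fin n → S → A → ℝ}
    (hw : ∀ i j, 0 ≤ w i j) (hw1 : ∀ i, ∑ j, w i j = 1)
    (hm : ∀ i s a, 0 < m i s a)
    (i : Fin n) (s : S) (a : A) : 0 < mixMu w m i s a := by
  have h0 : 0 < ∑ j, w i j := by rw [hw1]; exact one_pos
  obtain ⟨j, -, hj⟩ := Finset.exists_lt_of_sum_lt (s := Finset.univ) (f := fun _ : Fin n => (0 : ℝ))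
    (g := fun j => w i j) (by simpa using h0)
  exact Finset.sum_pos' (fun j _ => mul_nonneg (hw i j) (hm j s a).le)
    ⟨j, Finset.mem_univ j, mul_pos hj (hm j s a)⟩

section KL

variable {S A : Type*} [Fintype S] [Fintype A]

lemma sub_le_mul_log_div {x y : ℝ} (hx : 0 ≤ x) (hy : 0 < y) : x - y ≤ x * Real.log (x / y) := by
  rcases hx.eq_or_lt with rfl | hx
  · simp [hy.le]
  · have h := Real.one_sub_inv_le_log_of_pos (div_pos hx hy)
    calc x - y = x * (1 - (x / y)⁻¹) := by field_simp
      _ ≤ _ := mul_le_mul_of_nonneg_left h hx.le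

lemma mul_log_div_le {x y : ℝ} (hx : 0 ≤ x) (hy : 0 < y) :
    x * Real.log (x / y) ≤ x - y + (x - y) ^ 2 / y := by
  rcases hx.eq_or_lt with rfl | hx
  · have := hy.ne'
    simp only [zero_mul, zero_sub, neg_sq]
    apply le_of_eq
    field_simp
    ring
  · calc x * Real.log (x / y) ≤ x * (x / y - 1) :=
          mul_le_mul_of_nonneg_left (Real.log_le_sub_one_of_pos (div_pos hx hy)) hx.le
      _ = _ := by field_simp; ring

lemma klDiv_nonneg {x y : S → A → ℝ} (hx : ∀ s a, 0 ≤ x s a) (hy : ∀ s a, 0 < y s a)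
    (hxy : ∑ s, ∑ a, x s a = ∑ s, ∑ a, y s a) : 0 ≤ klDiv x y := by
  have h : ∑ s, ∑ a, (x s a - y s a) ≤ klDiv x y :=
    Finset.sum_le_sum fun s _ => Finset.sum_le_sum fun a _ => sub_le_mul_log_div (hx s a) (hy s a)
  simp only [Finset.sum_sub_distrib, hxy, sub_self] at h
  exact h

lemma klDiv_self (x : S → A → ℝ) : klDiv x x = 0 := by
  refine Finset.sum_eq_zero fun s _ => Finset.sum_eq_zero fun a _ => ?_
  by_cases h : x s a = 0 <;> simp [h]

/-- The bound is of second order in x − y, so moving by ε along a segment costs only O(ε²) in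
`IsKLProj.variational`. -/
lemma klDiv_le_chi_sq {x y : S → A → ℝ} (hx : ∀ s a, 0 ≤ x s a) (hy : ∀ s a, 0 < y s a)
    (hxy : ∑ s, ∑ a, x s a = ∑ s, ∑ a, y s a) :
    klDiv x y ≤ ∑ s, ∑ a, (x s a - y s a) ^ 2 / y s a := by
  have h : klDiv x y ≤ ∑ s, ∑ a, (x s a - y s a + (x s a - y s a) ^ 2 / y s a) :=
    Finset.sum_le_sum fun s _ => Finset.sum_le_sum fun a _ => mul_log_div_le (hx s a) (hy s a)
  simpa only [Finset.sum_add_distrib, Finset.sum_sub_distrib, hxy, sub_self, zero_add] using h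

/-- Logarithms add; entries where x vanishes contribute nothing, so x needs no positivity. -/
lemma klDiv_eq_add {x y z : S → A → ℝ} (hy : ∀ s a, 0 < y s a) (hz : ∀ s a, 0 < z s a) :
    klDiv x z = klDiv x y + ∑ s, ∑ a, x s a * Real.log (y s a / z s a) := by
  simp only [klDiv, ← Finset.sum_add_distrib]
  refine Finset.sum_congr rfl fun s _ => Finset.sum_congr rfl fun a _ => ?_
  by_cases h : x s a = 0
  · simp [h]
  · rw [Real.log_div h (hz s a).ne', Real.log_div h (hy s a).ne',
      Real.log_div (hy s a).ne' (hz s a).ne']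
    ring

/-- A positive probability distribution is determined by its vanishing divergence. -/
lemma eq_of_klDiv_nonpos {x y : S → A → ℝ} (hx : ∀ s a, 0 ≤ x s a) (hy : ∀ s a, 0 < y s a)
    (hxy : ∑ s, ∑ a, x s a = ∑ s, ∑ a, y s a) (h : klDiv x y ≤ 0) : x = y := by
  have h0 : ∑ s, ∑ a, (x s a * Real.log (x s a / y s a) - (x s a - y s a)) = 0 := by
    simp only [Finset.sum_sub_distrib, hxy, sub_self, sub_zero]
    exact le_antisymm h (klDiv_nonneg hx hy hxy)
  have hnn : ∀ s a, 0 ≤ x s a * Real.log (x s a / y s a) - (x s a - y s a) := fun s a =>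
    sub_nonneg.2 (sub_le_mul_log_div (hx s a) (hy s a))
  funext s a
  rw [Finset.sum_eq_zero_iff_of_nonneg fun s _ => Finset.sum_nonneg fun a _ => hnn s a] at h0
  have h1 := h0 s (Finset.mem_univ s)
  rw [Finset.sum_eq_zero_iff_of_nonneg fun a _ => hnn s a] at h1
  have h2 := h1 a (Finset.mem_univ a)
  by_contra hne
  rcases (hx s a).eq_or_lt with h3 | h3
  · rw [← h3] at h2
    simp at h2
    exact (hy s a).ne' h2
  · have h4 : Real.log (y s a / x s a) < y s a / x s a - 1 :=
      Real.log_lt_sub_one_of_pos (div_pos (hy s a) h3) fun h5 => hne ((div_eq_one_iff_eq h3.ne').1 h5).symm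
    have h5 := mul_lt_mul_of_pos_left h4 h3
    rw [show Real.log (y s a / x s a) = -Real.log (x s a / y s a) by rw [← Real.log_inv, inv_div],
      mul_sub, mul_div_cancel₀ _ h3.ne'] at h5
    linarith

lemma occupancySet_combo {τ ε : ℝ} {m u : S → A → ℝ} (hm : m ∈ occupancySet S A τ)
    (hu : u ∈ occupancySet S A τ) (h0 : 0 ≤ ε) (h1 : ε ≤ 1) :
    (fun s a => (1 - ε) * m s a + ε * u s a) ∈ occupancySet S A τ := by
  have h1' : 0 ≤ 1 - ε := by linarith
  refine ⟨fun s a => ?_, ?_, fun s => ?_⟩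
  · have := hm.1 s a
    have := hu.1 s a
    positivity
  · simp only [Finset.sum_add_distrib, ← Finset.mul_sum, hm.2.1, hu.2.1]
    ring
  · simp only [Finset.sum_add_distrib, ← Finset.mul_sum]
    nlinarith [hm.2.2 s, hu.2.2 s]

/-- Convexity of t log t, sharpened where m vanishes: there the infinite slope at zero yields the
gain ε log ε · u. -/
lemma mul_log_div_combo_le {ε m u y : ℝ} (h0 : 0 < ε) (h1 : ε < 1) (hm : 0 ≤ m) (hu : 0 < u)
    (hy : 0 < y) :
    ((1 - ε) * m + ε * u) * Real.log (((1 - ε) * m + ε * u) / y) ≤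
      (1 - ε) * (m * Real.log (m / y)) + ε * (u * Real.log (u / y)) +
        (if m = 0 then ε * Real.log ε * u else 0) := by
  split_ifs with h
  · subst h
    rw [show ((1 - ε) * 0 + ε * u) / y = ε * (u / y) by ring,
      Real.log_mul h0.ne' (div_pos hu hy).ne']
    apply le_of_eq
    ring
  · have hc := Real.convexOn_mul_log.2 (x := m) hm (y := u) hu.le (sub_nonneg.2 h1.le) h0.le (by ring)
    simp only [smul_eq_mul] at hc
    have hm' : 0 < m := lt_of_le_of_ne hm (Ne.symm h)
    have hp : 0 < (1 - ε) * m + ε * u := by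
      have : 0 < 1 - ε := by linarith
      positivity
    rw [Real.log_div hp.ne' hy.ne', Real.log_div h hy.ne', Real.log_div hu.ne' hy.ne']
    linarith

/-- If m had a zero entry, moving by ε towards the positive point u would change the divergence by
at most ε(K + c log ε), where c > 0 is the mass of u on the zero set of m. This is negative for
small ε. -/
lemma IsKLProj.pos {τ : ℝ} {y m u : S → A → ℝ} (h : IsKLProj (occupancySet S A τ) y m)
    (hy : ∀ s a, 0 < y s a) (hu : u ∈ occupancySet S A τ) (hu0 : ∀ s a, 0 < u s a) (s : S) (a : A) :
    0 < m s a := by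
  classical
  refine lt_of_le_of_ne (h.1.1 s a) fun hz => ?_
  set c : ℝ := ∑ s, ∑ a, if m s a = 0 then u s a else 0 with hc
  have hcpos : 0 < c := by
    have hnn : ∀ s a, 0 ≤ if m s a = 0 then u s a else 0 := fun s a => by
      split_ifs
      exacts [(hu0 s a).le, le_rfl]
    refine lt_of_lt_of_le (hu0 s a) ?_
    calc u s a = if m s a = 0 then u s a else 0 := by rw [if_pos hz.symm]
      _ ≤ ∑ a, if m s a = 0 then u s a else 0 :=
        Finset.single_le_sum (fun a _ => hnn s a) (Finset.mem_univ a)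
      _ ≤ _ := Finset.single_le_sum (f := fun s => ∑ a, if m s a = 0 then u s a else 0)
        (fun s _ => Finset.sum_nonneg fun a _ => hnn s a) (Finset.mem_univ s)
  have key : ∀ ε : ℝ, 0 < ε → ε < 1 → 0 ≤ klDiv u y - klDiv m y + Real.log ε * c := by
    intro ε h0 h1
    have h2 := h.2 _ (occupancySet_combo h.1 hu h0.le h1.le)
    have h3 : klDiv (fun s a => (1 - ε) * m s a + ε * u s a) y ≤
        (1 - ε) * klDiv m y + ε * klDiv u y + ε * (Real.log ε * c) := by
      simp only [klDiv, hc, Finset.mul_sum, ← Finset.sum_add_distrib]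
      refine Finset.sum_le_sum fun s _ => Finset.sum_le_sum fun a _ => ?_
      refine (mul_log_div_combo_le h0 h1 (h.1.1 s a) (hu0 s a) (hy s a)).trans (le_of_eq ?_)
      split_ifs <;> ring
    have h4 : 0 ≤ ε * (klDiv u y - klDiv m y + Real.log ε * c) := by linarith
    exact nonneg_of_mul_nonneg_right h4 h0
  set K := klDiv u y - klDiv m y with hK
  -- With this ε, c log ε = −(|K| + 1), which outweighs K.
  have := key (Real.exp (-(|K| + 1) / c)) (Real.exp_pos _)
    ((Real.exp_lt_exp.2 (div_neg_of_neg_of_pos (by linarith [abs_nonneg K]) hcpos)).trans_eq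
      Real.exp_zero)
  rw [Real.log_exp, div_mul_cancel₀ _ hcpos.ne'] at this
  linarith [le_abs_self K]

/-- First-order optimality of the projection. -/
lemma IsKLProj.variational {τ : ℝ} {y m u : S → A → ℝ} (h : IsKLProj (occupancySet S A τ) y m)
    (hy : ∀ s a, 0 < y s a) (hm : ∀ s a, 0 < m s a) (hu : u ∈ occupancySet S A τ) :
    ∑ s, ∑ a, m s a * Real.log (m s a / y s a) ≤ ∑ s, ∑ a, u s a * Real.log (m s a / y s a) := by
  set K : ℝ := ∑ s, ∑ a, (u s a - m s a) ^ 2 / m s a with hK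
  have hK0 : 0 ≤ K := Finset.sum_nonneg fun s _ => Finset.sum_nonneg fun a _ =>
    div_nonneg (sq_nonneg _) (hm s a).le
  set P := ∑ s, ∑ a, m s a * Real.log (m s a / y s a) with hP
  set Q := ∑ s, ∑ a, u s a * Real.log (m s a / y s a) with hQ
  have key : ∀ ε : ℝ, 0 < ε → ε ≤ 1 → P ≤ Q + ε * K := by
    intro ε h0 h1
    have hw := occupancySet_combo h.1 hu h0.le h1
    have h2 := h.2 _ hw
    -- Expanding around m replaces differentiation: the remainder is the divergence from m, at most
    -- ε²K.
    rw [klDiv_eq_add (x := fun s a => (1 - ε) * m s a + ε * u s a) hm hy] at h2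
    have h3 := klDiv_le_chi_sq hw.1 hm (hw.2.1.trans h.1.2.1.symm)
    have h4 : ∑ s, ∑ a, ((1 - ε) * m s a + ε * u s a - m s a) ^ 2 / m s a = ε * (ε * K) := by
      simp only [hK, Finset.mul_sum]
      refine Finset.sum_congr rfl fun s _ => Finset.sum_congr rfl fun a _ => ?_
      ring
    have h5 : ∑ s, ∑ a, ((1 - ε) * m s a + ε * u s a) * Real.log (m s a / y s a) =
        P + ε * (Q - P) := by
      simp only [hP, hQ, mul_sub, Finset.mul_sum, ← Finset.sum_add_distrib, ← Finset.sum_sub_distrib]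
      refine Finset.sum_congr rfl fun s _ => Finset.sum_congr rfl fun a _ => ?_
      ring
    have h6 : klDiv m y = P := rfl
    rw [h4] at h3
    rw [h5, h6] at h2
    have : 0 ≤ ε * (Q + ε * K - P) := by linarith
    linarith [nonneg_of_mul_nonneg_right this h0]
  by_contra! hlt
  -- This ε makes εK at most half the supposed excess P − Q; K + 1 guards against K = 0.
  have h7 := key (min 1 ((P - Q) / (2 * (K + 1)))) (lt_min one_pos (by
    apply div_pos <;> linarith)) (min_le_left _ _)
  have h8 : min 1 ((P - Q) / (2 * (K + 1))) * K ≤ (P - Q) / (2 * (K + 1)) * (K + 1) := by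
    apply mul_le_mul (min_le_right _ _) (by linarith) hK0
    apply div_nonneg <;> linarith
  have h9 : (P - Q) / (2 * (K + 1)) * (K + 1) = (P - Q) / 2 := by
    field_simp
  linarith

/-- Generalized Pythagorean inequality for the projection. -/
lemma IsKLProj.pythagorean {τ : ℝ} {y m u : S → A → ℝ} (h : IsKLProj (occupancySet S A τ) y m)
    (hy : ∀ s a, 0 < y s a) (hm : ∀ s a, 0 < m s a) (hu : u ∈ occupancySet S A τ) :
    klDiv u m + klDiv m y ≤ klDiv u y := by
  rw [klDiv_eq_add (x := u) hm hy]
  have := h.variational hy hm hu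
  simp only [klDiv] at *
  linarith

/-- Makes the next iterate a function of the current state and sample, as `IsRun.finite_range`
requires. -/
lemma IsKLProj.unique {τ : ℝ} {y m m' : S → A → ℝ} (h : IsKLProj (occupancySet S A τ) y m)
    (h' : IsKLProj (occupancySet S A τ) y m') (hy : ∀ s a, 0 < y s a) (hm : ∀ s a, 0 < m s a) :
    m' = m := by
  refine eq_of_klDiv_nonpos h'.1.1 hm (h'.1.2.1.trans h.1.2.1.symm) ?_
  linarith [h.pythagorean hy hm h'.1, h'.2 _ h.1]

/-! ### The exponential update -/

lemma expUpdate_normalizer_pos [Nonempty S] [Nonempty A] {x : S → A → ℝ} (hx : ∀ s a, 0 < x s a)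
    (Δ : S → A → ℝ) : 0 < ∑ s, ∑ a, x s a * Real.exp (Δ s a) :=
  Finset.sum_pos (fun s _ => Finset.sum_pos (fun a _ => mul_pos (hx s a) (Real.exp_pos _))
    Finset.univ_nonempty) Finset.univ_nonempty

lemma expUpdate_pos [Nonempty S] [Nonempty A] {x : S → A → ℝ} (hx : ∀ s a, 0 < x s a)
    (Δ : S → A → ℝ) (s : S) (a : A) : 0 < expUpdate x Δ s a :=
  div_pos (mul_pos (hx s a) (Real.exp_pos _)) (expUpdate_normalizer_pos hx Δ)

lemma expUpdate_sum [Nonempty S] [Nonempty A] {x : S → A → ℝ} (hx : ∀ s a, 0 < x s a)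
    (Δ : S → A → ℝ) : ∑ s, ∑ a, expUpdate x Δ s a = 1 := by
  simp only [expUpdate, ← Finset.sum_div]
  exact div_self (expUpdate_normalizer_pos hx Δ).ne'

lemma log_div_expUpdate [Nonempty S] [Nonempty A] {x : S → A → ℝ} (hx : ∀ s a, 0 < x s a)
    (Δ : S → A → ℝ) (s : S) (a : A) :
    Real.log (x s a / expUpdate x Δ s a) =
      Real.log (∑ s, ∑ a, x s a * Real.exp (Δ s a)) - Δ s a := by
  have hZ := expUpdate_normalizer_pos hx Δ
  rw [Real.log_div (hx s a).ne' (expUpdate_pos hx Δ s a).ne', expUpdate,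
    Real.log_div (mul_pos (hx s a) (Real.exp_pos _)).ne' hZ.ne',
    Real.log_mul (hx s a).ne' (Real.exp_pos _).ne', Real.log_exp]
  ring

lemma klDiv_expUpdate [Nonempty S] [Nonempty A] {x u : S → A → ℝ} (hx : ∀ s a, 0 < x s a)
    (hu : ∑ s, ∑ a, u s a = 1) (Δ : S → A → ℝ) :
    klDiv u (expUpdate x Δ) = klDiv u x + Real.log (∑ s, ∑ a, x s a * Real.exp (Δ s a)) -
      ∑ s, ∑ a, u s a * Δ s a := by
  rw [klDiv_eq_add hx (expUpdate_pos hx Δ)]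
  simp only [log_div_expUpdate hx, mul_sub, Finset.sum_sub_distrib, ← Finset.sum_mul, hu]
  ring

/-- Take reciprocals in exp(−y) ≥ 1 − y + y²/2: the two quadratics multiply to 1 + y⁴/4. -/
lemma exp_le_of_nonpos {y : ℝ} (hy : y ≤ 0) : Real.exp y ≤ 1 + y + y ^ 2 / 2 := by
  have h := Real.quadratic_le_exp_of_nonneg (neg_nonneg.2 hy)
  have h1 : 0 < 1 + -y + (-y) ^ 2 / 2 := by nlinarith
  have h2 : Real.exp y = (Real.exp (-y))⁻¹ := by rw [Real.exp_neg, inv_inv]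
  rw [h2]
  refine (inv_anti₀ h1 h).trans ?_
  rw [inv_le_iff_one_le_mul₀ h1]
  nlinarith [sq_nonneg (y ^ 2)]

/-- The sign condition replaces any bound on the size of Δ, which matters because exponents carry
the factor 1/μ̃. -/
lemma log_normalizer_le [Nonempty S] [Nonempty A] {x Δ : S → A → ℝ} (hx : ∀ s a, 0 < x s a)
    (hx1 : ∑ s, ∑ a, x s a = 1) (hΔ : ∀ s a, Δ s a ≤ 0) :
    Real.log (∑ s, ∑ a, x s a * Real.exp (Δ s a)) ≤
      ∑ s, ∑ a, x s a * Δ s a + ∑ s, ∑ a, x s a * Δ s a ^ 2 / 2 := by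
  refine (Real.log_le_sub_one_of_pos (expUpdate_normalizer_pos hx Δ)).trans ?_
  have : ∑ s, ∑ a, x s a * Real.exp (Δ s a) ≤
      ∑ s, ∑ a, (x s a + x s a * Δ s a + x s a * Δ s a ^ 2 / 2) :=
    Finset.sum_le_sum fun s _ => Finset.sum_le_sum fun a _ => by
      have := mul_le_mul_of_nonneg_left (exp_le_of_nonpos (hΔ s a)) (hx s a).le
      linarith
  simp only [Finset.sum_add_distrib, hx1] at this
  linarith

/-- The basic mirror-descent inequality: Pythagoras for the projection, with the nonnegative
divergence from the unprojected point dropped and the normalizer expanded to second order. -/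
lemma klDiv_step [Nonempty S] [Nonempty A] {τ : ℝ} {x Δ m u : S → A → ℝ}
    (hx : ∀ s a, 0 < x s a) (hx1 : ∑ s, ∑ a, x s a = 1) (hΔ : ∀ s a, Δ s a ≤ 0)
    (h : IsKLProj (occupancySet S A τ) (expUpdate x Δ) m) (hm : ∀ s a, 0 < m s a)
    (hu : u ∈ occupancySet S A τ) :
    klDiv u m ≤ klDiv u x + ∑ s, ∑ a, (x s a - u s a) * Δ s a + ∑ s, ∑ a, x s a * Δ s a ^ 2 / 2 := by
  have h1 := h.pythagorean (expUpdate_pos hx Δ) hm hu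
  have h2 := klDiv_nonneg h.1.1 (expUpdate_pos hx Δ) (h.1.2.1.trans (expUpdate_sum hx Δ).symm)
  have h3 := log_normalizer_le hx hx1 hΔ
  rw [klDiv_expUpdate hx hu.2.1] at h1
  simp only [sub_mul, Finset.sum_sub_distrib]
  linarith

/-- A Pinsker inequality for the symmetrized divergence: Cauchy–Schwarz with weights a + b, then (a
− b)²/(a + b) ≤ (a − b) log(a/b) termwise. -/
lemma sq_sum_abs_le {ι : Type*} [Fintype ι] {a b : ι → ℝ} (ha : ∀ i, 0 < a i) (hb : ∀ i, 0 < b i) :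
    (∑ i, |a i - b i|) ^ 2 ≤
      (∑ i, (a i + b i)) * ∑ i, (a i - b i) * Real.log (a i / b i) := by
  have h1 := Finset.sum_sq_le_sum_mul_sum_of_sq_le_mul Finset.univ (r := fun i => |a i - b i|)
    (f := fun i => a i + b i) (g := fun i => (a i - b i) ^ 2 / (a i + b i))
    (fun i _ => (add_pos (ha i) (hb i)).le)
    (fun i _ => div_nonneg (sq_nonneg _) (add_pos (ha i) (hb i)).le)
    (fun i _ => by
      have := (add_pos (ha i) (hb i)).ne'
      rw [sq_abs]
      apply le_of_eq
      field_simp)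
  refine h1.trans (mul_le_mul_of_nonneg_left (Finset.sum_le_sum fun i _ => ?_)
    (Finset.sum_nonneg fun i _ => (add_pos (ha i) (hb i)).le))
  have ha := ha i
  have hb := hb i
  generalize a i = a at *
  generalize b i = b at *
  have hab : ∀ a b : ℝ, 0 < a → 0 < b → b ≤ a → (a - b) ^ 2 / (a + b) ≤ (a - b) * Real.log (a / b) := by
    intro a b ha hb h
    have h2 := Real.one_sub_inv_le_log_of_pos (div_pos ha hb)
    calc (a - b) ^ 2 / (a + b) ≤ (a - b) ^ 2 / a :=
          div_le_div_of_nonneg_left (sq_nonneg _) ha (by linarith)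
      _ = (a - b) * (1 - (a / b)⁻¹) := by field_simp
      _ ≤ _ := mul_le_mul_of_nonneg_left h2 (by linarith)
  rcases le_total b a with h | h
  · exact hab a b ha hb h
  · have := hab b a hb ha h
    rw [show Real.log (b / a) = -Real.log (a / b) by rw [← Real.log_inv, inv_div]] at this
    rw [add_comm, sub_sq_comm]
    linarith

/-- The projected exponential update moves its argument by at most twice the largest exponent. -/
lemma l1_step_le [Nonempty S] [Nonempty A] {τ c : ℝ} {x Δ m : S → A → ℝ}
    (hx : ∀ s a, 0 < x s a) (hxU : x ∈ occupancySet S A τ) (hΔ : ∀ s a, |Δ s a| ≤ c)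
    (h : IsKLProj (occupancySet S A τ) (expUpdate x Δ) m) (hm : ∀ s a, 0 < m s a) :
    ∑ s, ∑ a, |m s a - x s a| ≤ 2 * c := by
  -- The point x is itself a competitor. Both measures have mass one, so the log-normalizer drops
  -- out and the symmetrized divergence is at most ⟨m − x, Δ⟩ ≤ Lc; Pinsker bounds it below by L²/2.
  have h1 := h.variational (expUpdate_pos hx Δ) hm hxU
  set L := ∑ s, ∑ a, |m s a - x s a| with hL
  have hlog : ∀ s a, Real.log (m s a / expUpdate x Δ s a) = Real.log (m s a / x s a) +
      (Real.log (∑ s, ∑ a, x s a * Real.exp (Δ s a)) - Δ s a) := fun s a => by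
    rw [← log_div_expUpdate hx Δ s a, ← Real.log_mul (div_pos (hm s a) (hx s a)).ne'
      (div_pos (hx s a) (expUpdate_pos hx Δ s a)).ne', div_mul_div_cancel₀ (hx s a).ne']
  have h2 : ∑ s, ∑ a, (m s a - x s a) * Real.log (m s a / x s a) ≤
      ∑ s, ∑ a, (m s a - x s a) * Δ s a := by
    simp only [hlog, mul_add, mul_sub, Finset.sum_add_distrib, Finset.sum_sub_distrib,
      ← Finset.sum_mul, h.1.2.1, hxU.2.1] at h1
    simp only [sub_mul, Finset.sum_sub_distrib]
    linarith
  have h3 : ∑ s, ∑ a, (m s a - x s a) * Δ s a ≤ L * c := by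
    simp only [hL, Finset.sum_mul]
    refine Finset.sum_le_sum fun s _ => Finset.sum_le_sum fun a _ => ?_
    calc _ ≤ |(m s a - x s a) * Δ s a| := le_abs_self _
      _ = |m s a - x s a| * |Δ s a| := abs_mul _ _
      _ ≤ _ := mul_le_mul_of_nonneg_left (hΔ s a) (abs_nonneg _)
  have h4 := sq_sum_abs_le (ι := S × A) (a := fun z => m z.1 z.2) (b := fun z => x z.1 z.2)
    (fun z => hm _ _) (fun z => hx _ _)
  simp only [Finset.sum_add_distrib, Fintype.sum_prod_type, h.1.2.1, hxU.2.1, ← hL] at h4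
  have hc : 0 ≤ c := (abs_nonneg _).trans (hΔ (Classical.arbitrary S) (Classical.arbitrary A))
  have hL0 : 0 ≤ L := Finset.sum_nonneg fun s _ => Finset.sum_nonneg fun a _ => abs_nonneg _
  by_contra! hlt
  nlinarith

/-! ### Averaging -/

section Mix

variable {n : ℕ} {w : Matrix (Fin n) (Fin n) ℝ} {m : Fin n → S → A → ℝ}

lemma mixMu_mem {τ : ℝ} (hw : ∀ i j, 0 ≤ w i j) (hw1 : ∀ i, ∑ j, w i j = 1)
    (hm : ∀ i, m i ∈ occupancySet S A τ) (i : Fin n) : mixMu w m i ∈ occupancySet S A τ := by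
  refine ⟨fun s a => Finset.sum_nonneg fun j _ => mul_nonneg (hw i j) ((hm j).1 s a), ?_,
    fun s => ?_⟩
  · have : ∑ s, ∑ a, mixMu w m i s a = ∑ j, w i j * ∑ s, ∑ a, m j s a := by
      simp only [mixMu, Finset.mul_sum]
      rw [Finset.sum_comm (s := (Finset.univ : Finset (Fin n)))]
      exact Finset.sum_congr rfl fun s _ => Finset.sum_comm
    rw [this]
    simp [(hm _).2.1, hw1]
  · have : ∑ a, mixMu w m i s a = ∑ j, w i j * ∑ a, m j s a := by
      simp only [mixMu, Finset.mul_sum]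
      exact Finset.sum_comm
    rw [this]
    calc 1 / (√τ * (Fintype.card S : ℝ)) = ∑ j, w i j * (1 / (√τ * (Fintype.card S : ℝ))) := by
          rw [← Finset.sum_mul, hw1, one_mul]
      _ ≤ _ := Finset.sum_le_sum fun j _ => mul_le_mul_of_nonneg_left ((hm j).2.2 s) (hw i j)

/-- Concavity of log: communication does not increase the divergence on average. -/
lemma klDiv_mixMu_le {u : S → A → ℝ} (hw : ∀ i j, 0 ≤ w i j) (hw1 : ∀ i, ∑ j, w i j = 1)
    (hm : ∀ i s a, 0 < m i s a) (hu : ∀ s a, 0 ≤ u s a) (i : Fin n) :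
    klDiv u (mixMu w m i) ≤ ∑ j, w i j * klDiv u (m j) := by
  have : ∑ j, w i j * klDiv u (m j) =
      ∑ s, ∑ a, ∑ j, w i j * (u s a * Real.log (u s a / m j s a)) := by
    simp only [klDiv, Finset.mul_sum]
    rw [Finset.sum_comm]
    refine Finset.sum_congr rfl fun s _ => Finset.sum_comm
  rw [this]
  refine Finset.sum_le_sum fun s _ => Finset.sum_le_sum fun a _ => ?_
  rcases (hu s a).eq_or_lt with h | h
  · simp [← h]
  · have hc := strictConcaveOn_log_Ioi.concaveOn.le_map_sum (t := Finset.univ) (w := fun j => w i j)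
      (p := fun j => m j s a) (fun j _ => hw i j) (hw1 i) (fun j _ => hm j s a)
    simp only [smul_eq_mul] at hc
    have hp := mixMu_pos hw hw1 hm i s a
    calc u s a * Real.log (u s a / mixMu w m i s a)
        = u s a * Real.log (u s a) - u s a * Real.log (mixMu w m i s a) := by
          rw [Real.log_div h.ne' hp.ne']; ring
      _ ≤ u s a * Real.log (u s a) - u s a * ∑ j, w i j * Real.log (m j s a) := by
          have := mul_le_mul_of_nonneg_left hc h.le
          simp only [mixMu]
          linarith
      _ = (∑ j, w i j) * (u s a * Real.log (u s a)) - u s a * ∑ j, w i j * Real.log (m j s a) := by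
          rw [hw1, one_mul]
      _ = _ := by
          rw [Finset.sum_mul, Finset.mul_sum, ← Finset.sum_sub_distrib]
          refine Finset.sum_congr rfl fun j _ => ?_
          rw [Real.log_div h.ne' (hm j s a).ne']
          ring

end Mix

end KL

/-! ### Consensus over a time-varying network -/

section Network

lemma le_of_sq_le_sq_of_nonneg {a b : ℝ} (h : a ^ 2 ≤ b ^ 2) (hb : 0 ≤ b) : a ≤ b :=
  (abs_le_of_sq_le_sq' h hb).2

open Matrix

/-- Symmetric stochastic weights whose positive entries, the diagonal among them, are at least
`η`. -/
structure IsWeight {n : ℕ} (η : ℝ) (W : Matrix (Fin n) (Fin n) ℝ) : Prop where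
  symm : ∀ i j, W i j = W j i
  nonneg : ∀ i j, 0 ≤ W i j
  row_sum : ∀ i, ∑ j, W i j = 1
  diag : ∀ i, η ≤ W i i
  eq_zero_or_ge : ∀ i j, W i j = 0 ∨ η ≤ W i j

variable {n : ℕ} {η : ℝ}

lemma IsWeight.col_sum {W : Matrix (Fin n) (Fin n) ℝ} (h : IsWeight η W) (j : Fin n) :
    ∑ i, W i j = 1 := by
  simp_rw [h.symm _ j]
  exact h.row_sum j

/-- Allows the agents to be relabelled so that their values are sorted. -/
lemma IsWeight.submatrix {W : Matrix (Fin n) (Fin n) ℝ} (h : IsWeight η W)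
    (σ : Equiv.Perm (Fin n)) : IsWeight η (W.submatrix σ σ) where
  symm i j := h.symm _ _
  nonneg i j := h.nonneg _ _
  row_sum i := by
    simp only [submatrix_apply]
    rw [Equiv.sum_comp σ (fun j => W (σ i) j)]
    exact h.row_sum _
  diag i := h.diag _
  eq_zero_or_ge i j := h.eq_zero_or_ge _ _

lemma IsWeight.sum_mulVec {W : Matrix (Fin n) (Fin n) ℝ} (h : IsWeight η W) (x : Fin n → ℝ) :
    ∑ i, (W *ᵥ x) i = ∑ i, x i := by
  simp only [mulVec, dotProduct]
  rw [Finset.sum_comm]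
  simp [← Finset.sum_mul, h.col_sum]

/-- The variance under w, written with an independent copy. -/
lemma sq_weighted_sum {w x : Fin n → ℝ} (hw : ∑ j, w j = 1) :
    (∑ j, w j * x j) ^ 2 = ∑ j, w j * x j ^ 2 - (1 / 2) * ∑ i, ∑ j, w i * w j * (x i - x j) ^ 2 := by
  have h1 : ∑ i, ∑ j, w i * w j * (x i - x j) ^ 2 =
      ∑ i, ∑ j, (w i * x i ^ 2 * w j + w i * (w j * x j ^ 2) - 2 * (w i * x i) * (w j * x j)) :=
    Finset.sum_congr rfl fun i _ => Finset.sum_congr rfl fun j _ => by ring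
  rw [h1]
  simp only [Finset.sum_add_distrib, Finset.sum_sub_distrib, ← Finset.mul_sum, ← Finset.sum_mul, hw]
  ring

/-- The exact loss of energy in one averaging step, as a nonnegative sum over pairs; unit column
sums restore Σ xᵢ². -/
lemma IsWeight.sum_sq_sub {W : Matrix (Fin n) (Fin n) ℝ} (h : IsWeight η W) (x : Fin n → ℝ) :
    ∑ i, x i ^ 2 - ∑ i, (W *ᵥ x) i ^ 2 =
      (1 / 2) * ∑ k, ∑ i, ∑ j, W k i * W k j * (x i - x j) ^ 2 := by
  simp only [mulVec, dotProduct]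
  simp_rw [sq_weighted_sum (h.row_sum _)]
  rw [Finset.sum_sub_distrib, Finset.sum_comm]
  simp only [← Finset.sum_mul, h.col_sum, one_mul, ← Finset.mul_sum]
  ring

/-- Some entry of at least `η` links the first `d + 1` indices to the others. -/
def Crosses (η : ℝ) (W : Matrix (Fin n) (Fin n) ℝ) (d : ℕ) : Prop :=
  ∃ i j : Fin n, (i : ℕ) ≤ d ∧ d < (j : ℕ) ∧ η ≤ W i j

/-- The indicator of the lower side of a cut. -/
def below (d : ℕ) (i : Fin n) : ℝ := if (i : ℕ) ≤ d then 1 else 0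

lemma below_nonneg (d : ℕ) (i : Fin n) : 0 ≤ below d i := by
  unfold below
  split_ifs <;> norm_num

lemma below_le_one (d : ℕ) (i : Fin n) : below d i ≤ 1 := by
  unfold below
  split_ifs <;> norm_num

/-- A row with mass a below the cut contributes a(1 − a). At each endpoint of the crossing entry,
the diagonal puts η on one side and the crossing weight η on the other, so each contributes at least
η(1 − η) ≥ η/2. -/
lemma IsWeight.cut_ge {W : Matrix (Fin n) (Fin n) ℝ} (h : IsWeight η W) (hη : 0 < η) {d : ℕ}
    (hd : Crosses η W d) :
    η ≤ ∑ k, (∑ i, W k i * below d i) * (∑ j, W k j * (1 - below d j)) := by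
  obtain ⟨p, q, hp, hq, hpq⟩ := hd
  have hA : ∀ k i, W k i * below d i ≤ ∑ i, W k i * below d i := fun k i =>
    Finset.single_le_sum (f := fun i => W k i * below d i)
      (fun i _ => mul_nonneg (h.nonneg k i) (below_nonneg d i)) (Finset.mem_univ i)
  have hB : ∀ k i, W k i * (1 - below d i) ≤ ∑ i, W k i * (1 - below d i) := fun k i =>
    Finset.single_le_sum (f := fun i => W k i * (1 - below d i))
      (fun i _ => mul_nonneg (h.nonneg k i) (sub_nonneg.2 (below_le_one d i))) (Finset.mem_univ i)
  have hAB : ∀ k, ∑ i, W k i * below d i + ∑ i, W k i * (1 - below d i) = 1 := fun k => by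
    simp only [mul_sub, mul_one, Finset.sum_sub_distrib, h.row_sum]
    ring
  have hbp : below d p = 1 := if_pos hp
  have hbq : below d q = 0 := if_neg (not_le.2 hq)
  have hnn : ∀ k, 0 ≤ (∑ i, W k i * below d i) * (∑ j, W k j * (1 - below d j)) := fun k =>
    mul_nonneg (Finset.sum_nonneg fun i _ => mul_nonneg (h.nonneg k i) (below_nonneg d i))
      (Finset.sum_nonneg fun i _ => mul_nonneg (h.nonneg k i) (sub_nonneg.2 (below_le_one d i)))
  have hne : p ≠ q := fun e => by
    subst e
    omega
  have h2 : ∀ k, η ≤ ∑ i, W k i * below d i → η ≤ ∑ i, W k i * (1 - below d i) →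
      η / 2 ≤ (∑ i, W k i * below d i) * (∑ j, W k j * (1 - below d j)) := by
    intro k ha hb
    have hab := hAB k
    generalize ∑ i, W k i * below d i = a at *
    generalize ∑ i, W k i * (1 - below d i) = b at *
    obtain rfl : b = 1 - a := by linarith
    nlinarith
  have h3 := h2 p
    (by have := hA p p; rw [hbp] at this; linarith [h.diag p])
    (by have := hB p q; rw [hbq] at this; linarith)
  have h4 := h2 q
    (by have := hA q p; rw [hbp, h.symm] at this; linarith)
    (by have := hB q q; rw [hbq] at this; linarith [h.diag q])
  calc η = η / 2 + η / 2 := by ring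
    _ ≤ _ := add_le_add h3 h4
    _ = ∑ k ∈ {p, q}, (∑ i, W k i * below d i) * (∑ j, W k j * (1 - below d j)) :=
      (Finset.sum_pair (f := fun k =>
        (∑ i, W k i * below d i) * (∑ j, W k j * (1 - below d j))) hne).symm
    _ ≤ _ := Finset.sum_le_sum_of_subset_of_nonneg (Finset.subset_univ _) fun k _ _ => hnn k

/-- Nonnegative gaps: the sum of squares is at most the square of the sum, which is part of a
telescoping sum from the least to the greatest index of F. -/
lemma sum_sq_gaps_le {X : ℕ → ℝ} (hX : Monotone X) {F : Finset ℕ} {a b : ℝ}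
    (ha : ∀ d ∈ F, a ≤ X d) (hb : ∀ d ∈ F, X (d + 1) ≤ b) :
    ∑ d ∈ F, (X (d + 1) - X d) ^ 2 ≤ (b - a) ^ 2 := by
  rcases F.eq_empty_or_nonempty with rfl | hF
  · simpa using sq_nonneg _
  have hg : ∀ d, 0 ≤ X (d + 1) - X d := fun d => sub_nonneg.2 (hX d.le_succ)
  have h1 : ∑ d ∈ F, (X (d + 1) - X d) ≤ X (F.max' hF + 1) - X (F.min' hF) := by
    rw [← Finset.sum_Ico_sub X ((F.min'_le_max' hF).trans (Nat.le_succ _))]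
    refine Finset.sum_le_sum_of_subset_of_nonneg (fun d hd => ?_) fun d _ _ => hg d
    exact Finset.mem_Ico.2 ⟨F.min'_le d hd, Nat.lt_succ_of_le (F.le_max' d hd)⟩
  refine (Finset.sum_sq_le_sq_sum_of_nonneg fun d _ => hg d).trans ?_
  refine pow_le_pow_left₀ (Finset.sum_nonneg fun d _ => hg d) ?_ 2
  linarith [ha _ (F.min'_mem hF), hb _ (F.max'_mem hF)]

/-- Until a cut is crossed, its two sides stay separated. -/
lemma separated_of_not_crosses {W : ℕ → Matrix (Fin n) (Fin n) ℝ} (hW : ∀ l, IsWeight η (W l))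
    {z : ℕ → Fin n → ℝ} (hz : ∀ l, z (l + 1) = W l *ᵥ z l) {d : ℕ} {a b : ℝ}
    (ha : ∀ i : Fin n, (i : ℕ) ≤ d → z 0 i ≤ a) (hb : ∀ i : Fin n, d < (i : ℕ) → b ≤ z 0 i) (l : ℕ)
    (hl : ∀ l' < l, ¬ Crosses η (W l') d) :
    (∀ i : Fin n, (i : ℕ) ≤ d → z l i ≤ a) ∧ ∀ i : Fin n, d < (i : ℕ) → b ≤ z l i := by
  induction l with
  | zero => exact ⟨ha, hb⟩
  | succ l ih =>
    obtain ⟨iha, ihb⟩ := ih fun l' hl' => hl l' (Nat.lt_succ_of_lt hl')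
    have hc := hl l (Nat.lt_succ_self l)
    have h0 : ∀ i j : Fin n, (i : ℕ) ≤ d → d < (j : ℕ) → W l i j = 0 := fun i j hi hj =>
      ((hW l).eq_zero_or_ge i j).resolve_right fun h => hc ⟨i, j, hi, hj, h⟩
    rw [hz l]
    constructor
    · intro i hi
      calc (W l *ᵥ z l) i = ∑ j, W l i j * z l j := rfl
        _ ≤ ∑ j, W l i j * a := Finset.sum_le_sum fun (j : Fin n) _ => by
            change W l i j * z l j ≤ W l i j * a
            rcases le_or_gt (j : ℕ) d with hj | hj
            · exact mul_le_mul_of_nonneg_left (iha j hj) ((hW l).nonneg i j)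
            · rw [h0 i j hi hj, zero_mul, zero_mul]
        _ = a := by rw [← Finset.sum_mul, (hW l).row_sum, one_mul]
    · intro i hi
      calc b = ∑ j, W l i j * b := by rw [← Finset.sum_mul, (hW l).row_sum, one_mul]
        _ ≤ ∑ j, W l i j * z l j := Finset.sum_le_sum fun (j : Fin n) _ => by
            change W l i j * b ≤ W l i j * z l j
            rcases le_or_gt (j : ℕ) d with hj | hj
            · rw [(hW l).symm, h0 j i hj hi, zero_mul, zero_mul]
            · exact mul_le_mul_of_nonneg_left (ihb j hj) ((hW l).nonneg i j)
        _ = (W l *ᵥ z l) i := rfl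

/-- The square (zᵢ − zⱼ)² dominates the squared gaps of all cuts in D between i and j. Exchanging
the sums, each cut collects total weight at least η by `IsWeight.cut_ge`. -/
lemma IsWeight.sum_sq_step_ge {W : Matrix (Fin n) (Fin n) ℝ} (h : IsWeight η W) (hη : 0 < η)
    {X : ℕ → ℝ} (hX : Monotone X) {z : Fin n → ℝ} {D : Finset ℕ} (hD : ∀ d ∈ D, Crosses η W d)
    (hlow : ∀ d ∈ D, ∀ i : Fin n, (i : ℕ) ≤ d → z i ≤ X d)
    (hupp : ∀ d ∈ D, ∀ i : Fin n, d < (i : ℕ) → X (d + 1) ≤ z i) :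
    η * ∑ d ∈ D, (X (d + 1) - X d) ^ 2 ≤ ∑ i, z i ^ 2 - ∑ i, (W *ᵥ z) i ^ 2 := by
  have hlt : ∀ i j : Fin n, i ≤ j → ∑ d ∈ D, (X (d + 1) - X d) ^ 2 *
      (below d i * (1 - below d j) + below d j * (1 - below d i)) ≤ (z i - z j) ^ 2 := by
    intro i j hij
    have h1 : ∀ d, below d i * (1 - below d j) + below d j * (1 - below d i) =
        if (i : ℕ) ≤ d ∧ d < (j : ℕ) then 1 else 0 := by
      intro d
      have : (i : ℕ) ≤ j := hij
      unfold below
      split_ifs <;> first | omega | norm_num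
    simp only [h1, mul_ite, mul_one, mul_zero]
    rw [← Finset.sum_filter, sub_sq_comm]
    refine sum_sq_gaps_le hX (fun d hd => ?_) fun d hd => ?_
    · exact hlow d (Finset.mem_filter.1 hd).1 i (Finset.mem_filter.1 hd).2.1
    · exact hupp d (Finset.mem_filter.1 hd).1 j (Finset.mem_filter.1 hd).2.2
  have hall : ∀ i j : Fin n, ∑ d ∈ D, (X (d + 1) - X d) ^ 2 *
      (below d i * (1 - below d j) + below d j * (1 - below d i)) ≤ (z i - z j) ^ 2 := by
    intro i j
    rcases le_total i j with hij | hij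
    · exact hlt i j hij
    · have := hlt j i hij
      rw [sub_sq_comm]
      refine le_trans (le_of_eq (Finset.sum_congr rfl fun d _ => ?_)) this
      ring
  rw [h.sum_sq_sub]
  calc η * ∑ d ∈ D, (X (d + 1) - X d) ^ 2
      ≤ ∑ d ∈ D, (X (d + 1) - X d) ^ 2 *
          ∑ k, (∑ i, W k i * below d i) * (∑ j, W k j * (1 - below d j)) := by
        rw [Finset.mul_sum]
        refine Finset.sum_le_sum fun d hd => ?_
        rw [mul_comm]
        exact mul_le_mul_of_nonneg_left (h.cut_ge hη (hD d hd)) (sq_nonneg _)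
    _ = (1 / 2) * ∑ k, ∑ i, ∑ j, W k i * W k j * ∑ d ∈ D, (X (d + 1) - X d) ^ 2 *
          (below d i * (1 - below d j) + below d j * (1 - below d i)) := by
        have h1 : ∀ (d : ℕ) (k : Fin n),
            (∑ i, W k i * below d i) * (∑ j, W k j * (1 - below d j)) =
            (1 / 2) * ∑ i, ∑ j, W k i * W k j *
              (below d i * (1 - below d j) + below d j * (1 - below d i)) := by
          intro d k
          have h2 : (∑ i, W k i * below d i) * (∑ j, W k j * (1 - below d j)) =
              ∑ i, ∑ j, W k i * W k j * (below d i * (1 - below d j)) := by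
            rw [Finset.sum_mul_sum]
            exact Finset.sum_congr rfl fun i _ => Finset.sum_congr rfl fun j _ => by ring
          have h3 : ∑ i, ∑ j, W k i * W k j * (below d j * (1 - below d i)) =
              ∑ i, ∑ j, W k i * W k j * (below d i * (1 - below d j)) := by
            rw [Finset.sum_comm]
            exact Finset.sum_congr rfl fun i _ => Finset.sum_congr rfl fun j _ => by ring
          rw [h2]
          simp only [mul_add, Finset.sum_add_distrib, h3]
          ring
        simp only [h1, Finset.mul_sum]
        rw [Finset.sum_comm]
        refine Finset.sum_congr rfl fun k _ => ?_
        rw [Finset.sum_comm]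
        refine Finset.sum_congr rfl fun i _ => ?_
        rw [Finset.sum_comm]
        refine Finset.sum_congr rfl fun j _ => Finset.sum_congr rfl fun d _ => ?_
        ring
    _ ≤ _ := by
        gcongr with k _ i _ j _
        · exact mul_nonneg (h.nonneg k i) (h.nonneg k j)
        · exact hall i j

/-- Charge each cut to the first time it is crossed: until then averaging acts on each side
separately, so the initial gap is still open. The one-step losses telescope over the window. -/
lemma sum_sq_window_ge (hη : 0 < η) {W : ℕ → Matrix (Fin n) (Fin n) ℝ}
    (hW : ∀ l, IsWeight η (W l)) {X : ℕ → ℝ} (hX : Monotone X) {z : ℕ → Fin n → ℝ}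
    (hz0 : ∀ i, z 0 i = X i) (hz : ∀ l, z (l + 1) = W l *ᵥ z l) {B : ℕ}
    (hB : ∀ d ∈ Finset.range (n - 1), ∃ l < B, Crosses η (W l) d) :
    η * ∑ d ∈ Finset.range (n - 1), (X (d + 1) - X d) ^ 2 ≤ ∑ i, z 0 i ^ 2 - ∑ i, z B i ^ 2 := by
  classical
  have hfirst : ∀ d ∈ Finset.range (n - 1),
      ∃ l, l < B ∧ Crosses η (W l) d ∧ ∀ l' < l, ¬ Crosses η (W l') d := by
    intro d hd
    obtain ⟨l, hl, hc⟩ := hB d hd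
    have hex : ∃ l, Crosses η (W l) d := ⟨l, hc⟩
    exact ⟨Nat.find hex, (Nat.find_min' hex hc).trans_lt hl, Nat.find_spec hex,
      fun l' hl' => Nat.find_min hex hl'⟩
  choose! t htB htc htn using hfirst
  rw [← Finset.sum_range_sub' (fun l => ∑ i, z l i ^ 2) B,
    ← Finset.sum_fiberwise_of_maps_to (s := Finset.range (n - 1)) (t := Finset.range B) (g := t)
      (fun d hd => Finset.mem_range.2 (htB d hd)), Finset.mul_sum]
  refine Finset.sum_le_sum fun l _ => ?_
  rw [hz l]
  have hsep : ∀ d ∈ {d ∈ Finset.range (n - 1) | t d = l},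
      (∀ i : Fin n, (i : ℕ) ≤ d → z l i ≤ X d) ∧ ∀ i : Fin n, d < (i : ℕ) → X (d + 1) ≤ z l i := by
    intro d hd
    obtain ⟨hd', rfl⟩ := Finset.mem_filter.1 hd
    refine separated_of_not_crosses hW hz (fun i hi => ?_) (fun i hi => ?_) _ (htn d hd')
    · rw [hz0]
      exact hX hi
    · rw [hz0]
      exact hX hi
  refine (hW l).sum_sq_step_ge hη hX (fun d hd => ?_) (fun d hd => (hsep d hd).1)
    fun d hd => (hsep d hd).2
  obtain ⟨hd', rfl⟩ := Finset.mem_filter.1 hd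
  exact htc d hd'

/-! ### Dispersion around the average and its contraction -/

/-- The average of a vector. -/
def mean (x : Fin n → ℝ) : ℝ := (1 / (n : ℝ)) * ∑ i, x i

/-- The Euclidean distance to the consensus subspace. -/
def disp (x : Fin n → ℝ) : ℝ := ‖WithLp.toLp 2 (fun i => x i - mean x)‖

lemma disp_sq (x : Fin n → ℝ) : disp x ^ 2 = ∑ i, (x i - mean x) ^ 2 := by
  simp [disp, EuclideanSpace.norm_sq_eq]

lemma disp_nonneg (x : Fin n → ℝ) : 0 ≤ disp x := norm_nonneg _

lemma mean_add (x y : Fin n → ℝ) : mean (x + y) = mean x + mean y := by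
  simp [mean, Finset.sum_add_distrib, mul_add]

lemma disp_add_le (x y : Fin n → ℝ) : disp (x + y) ≤ disp x + disp y := by
  refine le_trans (le_of_eq ?_) (norm_add_le _ _)
  rw [disp, ← WithLp.toLp_add]
  congr 2
  funext i
  simp only [mean_add, Pi.add_apply]
  ring

lemma sum_sub_sq (x : Fin n → ℝ) (hn : 0 < n) (c : ℝ) :
    ∑ i, (x i - c) ^ 2 = disp x ^ 2 + n * (mean x - c) ^ 2 := by
  have hn' : (n : ℝ) ≠ 0 := by positivity
  have hs : ∑ i, x i = n * mean x := by
    rw [mean]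
    field_simp
  rw [disp_sq]
  have h : ∀ i, (x i - c) ^ 2 = (x i - mean x) ^ 2 + (2 * (mean x - c) * x i - (mean x ^ 2 - c ^ 2)) :=
    fun i => by ring
  simp only [h, Finset.sum_add_distrib, Finset.sum_sub_distrib, ← Finset.mul_sum, hs,
    Finset.sum_const, Finset.card_univ, Fintype.card_fin, nsmul_eq_mul]
  ring

lemma sum_sq_eq (x : Fin n → ℝ) (hn : 0 < n) : ∑ i, x i ^ 2 = disp x ^ 2 + n * mean x ^ 2 := by
  simpa using sum_sub_sq x hn 0

lemma IsWeight.mean_mulVec {W : Matrix (Fin n) (Fin n) ℝ} (h : IsWeight η W) (x : Fin n → ℝ) :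
    mean (W *ᵥ x) = mean x := by
  rw [mean, h.sum_mulVec, mean]

lemma IsWeight.disp_mulVec_le {W : Matrix (Fin n) (Fin n) ℝ} (h : IsWeight η W) (hn : 0 < n)
    (x : Fin n → ℝ) : disp (W *ᵥ x) ≤ disp x := by
  have h1 := h.sum_sq_sub x
  rw [sum_sq_eq _ hn, sum_sq_eq _ hn, h.mean_mulVec] at h1
  have h2 : 0 ≤ ∑ k, ∑ i, ∑ j, W k i * W k j * (x i - x j) ^ 2 :=
    Finset.sum_nonneg fun k _ => Finset.sum_nonneg fun i _ => Finset.sum_nonneg fun j _ =>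
      mul_nonneg (mul_nonneg (h.nonneg k i) (h.nonneg k j)) (sq_nonneg _)
  exact le_of_sq_le_sq_of_nonneg (by linarith) (disp_nonneg x)

lemma disp_le_sum_abs (hn : 0 < n) (x : Fin n → ℝ) : disp x ≤ ∑ i, |x i| := by
  refine le_of_sq_le_sq_of_nonneg ?_ (Finset.sum_nonneg fun i _ => abs_nonneg _)
  have h := sum_sq_eq x hn
  have h1 : ∑ i, |x i| ^ 2 ≤ (∑ i, |x i|) ^ 2 :=
    Finset.sum_sq_le_sq_sum_of_nonneg fun i _ => abs_nonneg _
  simp only [sq_abs] at h1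
  have : 0 ≤ (n : ℝ) * mean x ^ 2 := by positivity
  linarith

lemma sum_abs_sub_mean_le (x : Fin n → ℝ) : ∑ i, |x i - mean x| ≤ √(n : ℝ) * disp x := by
  refine le_of_sq_le_sq_of_nonneg ?_ (mul_nonneg (Real.sqrt_nonneg _) (disp_nonneg x))
  rw [mul_pow, Real.sq_sqrt (Nat.cast_nonneg n), disp_sq]
  have := sq_sum_le_card_mul_sum_sq (s := Finset.univ) (f := fun i => |x i - mean x|)
  simpa [sq_abs] using this

/-- Dispersion contracts over a window in which every cut is crossed. -/
lemma disp_window_le (hn : 0 < n) (hη : 0 < η) (hη1 : η ≤ 1) {W : ℕ → Matrix (Fin n) (Fin n) ℝ}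
    (hW : ∀ l, IsWeight η (W l)) {B : ℕ}
    (hB : ∀ Q : Set (Fin n), Q.Nonempty → Qᶜ.Nonempty → ∃ l < B, ∃ i ∈ Q, ∃ j ∉ Q, η ≤ W l i j)
    {z : ℕ → Fin n → ℝ} (hz : ∀ l, z (l + 1) = W l *ᵥ z l) :
    disp (z B) ≤ (1 - η / (2 * (n : ℝ) ^ 2)) * disp (z 0) := by
  set σ := Tuple.sort (z 0) with hσ
  have hmono : Monotone (z 0 ∘ σ) := Tuple.monotone_sort _
  -- The sorted values, continued as a constant past n − 1 so that X is monotone on all of ℕ.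
  set X : ℕ → ℝ := fun k => z 0 (σ ⟨min k (n - 1), by omega⟩) with hXdef
  have hX : Monotone X := fun a b hab => hmono (by
    simp only [Fin.mk_le_mk]
    omega)
  have hXi : ∀ i : Fin n, z 0 (σ i) = X i := fun i => by
    simp only [hXdef]
    congr 2
    ext
    simp only
    omega
  have hsum : ∀ l, ∑ i, z l (σ i) ^ 2 = ∑ i, z l i ^ 2 := fun l =>
    Equiv.sum_comp σ fun i => z l i ^ 2
  have hwin := sum_sq_window_ge hη (W := fun l => (W l).submatrix σ σ) (fun l => (hW l).submatrix σ)
    hX (z := fun l i => z l (σ i)) hXi (fun l => by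
      funext i
      rw [hz l]
      simp only [mulVec, dotProduct, submatrix_apply]
      exact (Equiv.sum_comp σ fun j => W l (σ i) j * z l j).symm) (B := B) (fun d hd => by
      have hd' := Finset.mem_range.1 hd
      obtain ⟨l, hl, i, hi, j, hj, hij⟩ := hB {i | (σ.symm i : ℕ) ≤ d}
        ⟨σ ⟨d, by omega⟩, by simp⟩ ⟨σ ⟨d + 1, by omega⟩, by simp⟩
      refine ⟨l, hl, σ.symm i, σ.symm j, hi, not_le.1 hj, ?_⟩
      simpa using hij)
  simp only [hsum] at hwin
  have hmean : ∀ l, mean (z l) = mean (z 0) := fun l => by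
    induction l with
    | zero => rfl
    | succ l ih => rw [hz l, (hW l).mean_mulVec, ih]
  rw [sum_sq_eq _ hn, sum_sq_eq _ hn, hmean B] at hwin
  have hn1 : (1 : ℝ) ≤ n := by exact_mod_cast hn
  -- One factor n counts the agents, each within the range of the values; the other comes from
  -- Cauchy–Schwarz over the n − 1 gaps.
  have hrange : disp (z 0) ^ 2 ≤
      (n : ℝ) ^ 2 * ∑ d ∈ Finset.range (n - 1), (X (d + 1) - X d) ^ 2 := by
    have h1 : disp (z 0) ^ 2 ≤ ∑ i, (z 0 i - X 0) ^ 2 := by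
      rw [sum_sub_sq _ hn]
      have : 0 ≤ (n : ℝ) * (mean (z 0) - X 0) ^ 2 := by positivity
      linarith
    have h2 : ∑ i, (z 0 i - X 0) ^ 2 ≤ ∑ i : Fin n, (X (n - 1) - X 0) ^ 2 := by
      rw [← Equiv.sum_comp σ fun i => (z 0 i - X 0) ^ 2]
      refine Finset.sum_le_sum fun i _ => ?_
      rw [hXi]
      have h3 := hX (Nat.zero_le (i : ℕ))
      have h4 := hX (show (i : ℕ) ≤ n - 1 by omega)
      exact pow_le_pow_left₀ (by linarith) (by linarith) 2
    have h3 : (X (n - 1) - X 0) ^ 2 ≤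
        (n : ℝ) * ∑ d ∈ Finset.range (n - 1), (X (d + 1) - X d) ^ 2 := by
      rw [← Finset.sum_range_sub X (n - 1)]
      refine sq_sum_le_card_mul_sum_sq.trans ?_
      gcongr
      rw [Finset.card_range]
      omega
    simp only [Finset.sum_const, Finset.card_univ, Fintype.card_fin, nsmul_eq_mul] at h2
    calc _ ≤ _ := h1.trans h2
      _ ≤ (n : ℝ) * ((n : ℝ) * ∑ d ∈ Finset.range (n - 1), (X (d + 1) - X d) ^ 2) := by gcongr
      _ = _ := by ring
  set y := η / (2 * (n : ℝ) ^ 2) with hy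
  have hn2 : (1 : ℝ) ≤ (n : ℝ) ^ 2 := one_le_pow₀ hn1
  have hy1 : y ≤ 1 / 2 := by
    rw [hy, div_le_div_iff₀ (by positivity) (by norm_num)]
    nlinarith
  have hG : 2 * y * disp (z 0) ^ 2 ≤ η * ∑ d ∈ Finset.range (n - 1), (X (d + 1) - X d) ^ 2 := by
    calc 2 * y * disp (z 0) ^ 2 ≤ 2 * y * ((n : ℝ) ^ 2 * ∑ d ∈ Finset.range (n - 1), (X (d + 1) - X d) ^ 2) := by
          gcongr
      _ = _ := by
          rw [hy]
          field_simp
  refine le_of_sq_le_sq_of_nonneg ?_ (mul_nonneg (by linarith) (disp_nonneg _))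
  rw [mul_pow]
  -- Squares contract by 1 − 2y ≤ (1 − y)².
  nlinarith [sq_nonneg (y * disp (z 0))]

/-- By linearity the deviation from the unperturbed evolution obeys the same recursion, and
averaging never increases dispersion. -/
lemma disp_perturbed_le (hn : 0 < n) {W : ℕ → Matrix (Fin n) (Fin n) ℝ}
    (hW : ∀ l, IsWeight η (W l)) {x e z : ℕ → Fin n → ℝ} (hx : ∀ t, x (t + 1) = W t *ᵥ x t + e t)
    (hz0 : z 0 = x 0) (hz : ∀ t, z (t + 1) = W t *ᵥ z t) (k : ℕ) :
    disp (x k - z k) ≤ ∑ l ∈ Finset.range k, disp (e l) := by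
  induction k with
  | zero => simp [hz0, disp, mean, EuclideanSpace.norm_eq]
  | succ k ih =>
    rw [Finset.sum_range_succ, hx, hz]
    calc disp (W k *ᵥ x k + e k - W k *ᵥ z k) = disp (W k *ᵥ (x k - z k) + e k) := by
          rw [mulVec_sub]
          congr 1
          abel
      _ ≤ _ := disp_add_le _ _
      _ ≤ _ := add_le_add_left (((hW k).disp_mulVec_le hn _).trans ih) _

lemma disp_perturbed_window_le (hn : 0 < n) (hη : 0 < η) (hη1 : η ≤ 1)
    {W : ℕ → Matrix (Fin n) (Fin n) ℝ} (hW : ∀ l, IsWeight η (W l)) {B : ℕ}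
    (hB : ∀ Q : Set (Fin n), Q.Nonempty → Qᶜ.Nonempty → ∃ l < B, ∃ i ∈ Q, ∃ j ∉ Q, η ≤ W l i j)
    {x e : ℕ → Fin n → ℝ} (hx : ∀ t, x (t + 1) = W t *ᵥ x t + e t) :
    disp (x B) ≤ (1 - η / (2 * (n : ℝ) ^ 2)) * disp (x 0) + ∑ l ∈ Finset.range B, disp (e l) := by
  let z : ℕ → Fin n → ℝ := fun k => Nat.rec (x 0) (fun l y => W l *ᵥ y) k
  have h1 := disp_perturbed_le hn hW hx (z := z) rfl (fun _ => rfl) B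
  have h2 := disp_window_le hn hη hη1 hW hB (z := z) (fun _ => rfl)
  have h3 := disp_add_le (z B) (x B - z B)
  rw [add_sub_cancel] at h3
  have h4 : z 0 = x 0 := rfl
  rw [h4] at h2
  linarith

end Network

/-! ### Weights, cuts and rate constants of the given network -/

section MixingNetwork

variable {n : ℕ} {η : ℝ} {B : ℕ} {G : ℕ → SimpleGraph (Fin n)}
  {W : ℕ → Matrix (Fin n) (Fin n) ℝ}

lemma IsMixingNetwork.isWeight (h : IsMixingNetwork G W η B) (t : ℕ) : IsWeight η (W t) where
  symm := h.symm t
  nonneg i j := by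
    by_cases hij : i = j ∨ (G t).Adj i j
    · exact h.η_pos.le.trans (h.weight_ge t i j hij)
    · push Not at hij
      exact (h.weight_zero t i j hij.1 hij.2).ge
  row_sum := h.row_sum t
  diag i := h.weight_ge t i i (Or.inl rfl)
  eq_zero_or_ge i j := by
    by_cases hij : i = j ∨ (G t).Adj i j
    · exact Or.inr (h.weight_ge t i j hij)
    · push Not at hij
      exact Or.inl (h.weight_zero t i j hij.1 hij.2)

/-- A walk in the connected union graph from Q to its complement has an edge on the boundary. -/
lemma IsMixingNetwork.exists_crossing (h : IsMixingNetwork G W η B) (t : ℕ) (Q : Set (Fin n))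
    (hQ : Q.Nonempty) (hQc : Qᶜ.Nonempty) :
    ∃ l < B, ∃ i ∈ Q, ∃ j ∉ Q, η ≤ W (t + l) i j := by
  obtain ⟨p, hp⟩ := hQ
  obtain ⟨q, hq⟩ := hQc
  obtain ⟨w⟩ := (h.connected t).preconnected p q
  obtain ⟨d, -, hd1, hd2⟩ := w.exists_boundary_dart Q hp hq
  have hadj := d.adj
  rw [SimpleGraph.iSup_adj] at hadj
  obtain ⟨l, hl⟩ := hadj
  exact ⟨l, l.2, d.fst, hd1, d.snd, hd2, h.weight_ge _ _ _ (Or.inr hl)⟩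

lemma netGamma_ge_one (hn : 0 < n) (hη : 0 < η) (hη1 : η < 1) : 1 ≤ netGamma n η := by
  have hn1 : (1 : ℝ) ≤ (n : ℝ) ^ 2 := one_le_pow₀ (by exact_mod_cast hn)
  have h0 : 0 ≤ η / (4 * (n : ℝ) ^ 2) := by positivity
  have h1 : η / (4 * (n : ℝ) ^ 2) < 1 := by
    rw [div_lt_one (by positivity)]
    linarith
  exact (one_le_inv₀ (pow_pos (by linarith) 2)).2 (pow_le_one₀ (by linarith) (by linarith))

/-- With y = η/(4n²) ≤ 1/4, log(1 − y) ≥ −2y gives 1 − ρ ≤ 2y/B, while 1 + Γ ≥ 2. -/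
lemma netD_ge (hn : 0 < n) (hη : 0 < η) (hη1 : η < 1) (hB : 0 < B) :
    4 * (n : ℝ) ^ 2 * B / η ≤ netD n η B := by
  have hn1 : (1 : ℝ) ≤ (n : ℝ) ^ 2 := one_le_pow₀ (by exact_mod_cast hn)
  have hB0 : (0 : ℝ) < B := by exact_mod_cast hB
  set y := η / (4 * (n : ℝ) ^ 2) with hy
  have h0 : 0 < y := by positivity
  have h1 : y ≤ 1 / 4 := by
    rw [hy, div_le_div_iff₀ (by positivity) (by norm_num)]
    linarith
  have hlt : netRho n η B < 1 := Real.rpow_lt_one (by linarith) (by linarith) (by positivity)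
  have hlog : -(2 * y) ≤ Real.log (1 - y) := by
    refine le_trans ?_ (Real.one_sub_inv_le_log_of_pos (by linarith))
    rw [le_sub_comm, inv_le_iff_one_le_mul₀ (by linarith)]
    nlinarith
  have hrho : 1 - netRho n η B ≤ 2 * y / B := by
    have h2 : netRho n η B = Real.exp (Real.log (1 - y) * (1 / (B : ℝ))) :=
      Real.rpow_def_of_pos (by linarith) _
    have h3 := Real.add_one_le_exp (Real.log (1 - y) * (1 / (B : ℝ)))
    have h4 : -(2 * y) * (1 / (B : ℝ)) ≤ Real.log (1 - y) * (1 / (B : ℝ)) :=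
      mul_le_mul_of_nonneg_right hlog (by positivity)
    rw [h2]
    have h5 : -(2 * y) * (1 / (B : ℝ)) = -(2 * y / B) := by ring
    linarith
  have hG := netGamma_ge_one hn hη hη1
  calc 4 * (n : ℝ) ^ 2 * B / η = 2 / (2 * y / B) := by
        rw [hy]
        field_simp
    _ ≤ (1 + netGamma n η) / (1 - netRho n η B) := by
        apply div_le_div₀ (by linarith) (by linarith) (by linarith) hrho

end MixingNetwork

/-! ### Occupancy measures and the Bellman equation -/

section Markov

variable {S : Type*} [Fintype S]

open Matrix in
-- Constants are a right null vector of P − 1, so a left null vector x exists. Then |x| ≤ |x|P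
-- entrywise with equal total mass, so |x| is invariant too.
lemma exists_isStationary [Nonempty S] {P : Matrix S S ℝ} (h0 : ∀ s s', 0 ≤ P s s')
    (h1 : ∀ s, ∑ s', P s s' = 1) : ∃ ξ, IsStationary P ξ := by
  classical
  have hdet : (P - 1).det = 0 := by
    refine Matrix.exists_mulVec_eq_zero_iff.1 ⟨fun _ => 1, ?_, ?_⟩
    · exact fun h => one_ne_zero (congrFun h (Classical.arbitrary S))
    · rw [sub_mulVec, one_mulVec]
      funext s
      simp [mulVec, dotProduct, h1]
  obtain ⟨x, hx, hxP⟩ := Matrix.exists_vecMul_eq_zero_iff.2 hdet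
  rw [vecMul_sub, vecMul_one, sub_eq_zero] at hxP
  have hxP' : ∀ s', ∑ s, x s * P s s' = x s' := fun s' => congrFun hxP s'
  have hle : ∀ s', |x s'| ≤ ∑ s, |x s| * P s s' := fun s' => by
    conv_lhs => rw [← hxP' s']
    refine (Finset.abs_sum_le_sum_abs _ _).trans (le_of_eq (Finset.sum_congr rfl fun s _ => ?_))
    rw [abs_mul, abs_of_nonneg (h0 s s')]
  have hsum : ∑ s', ∑ s, |x s| * P s s' = ∑ s', |x s'| := by
    rw [Finset.sum_comm]
    simp [← Finset.mul_sum, h1]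
  have heq : ∀ s', ∑ s, |x s| * P s s' = |x s'| := by
    have := (Finset.sum_eq_sum_iff_of_le fun s' (_ : s' ∈ Finset.univ) => hle s').1 hsum.symm
    exact fun s' => (this s' (Finset.mem_univ s')).symm
  have hpos : 0 < ∑ s, |x s| := by
    obtain ⟨s, hs⟩ := Function.ne_iff.1 hx
    exact Finset.sum_pos' (fun s _ => abs_nonneg _) ⟨s, Finset.mem_univ s, abs_pos.2 hs⟩
  refine ⟨fun s => |x s| / ∑ s, |x s|, fun s => by positivity, ?_, ?_⟩
  · rw [← Finset.sum_div, div_self hpos.ne']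
  · funext s'
    change ∑ s, |x s| / (∑ s, |x s|) * P s s' = |x s'| / ∑ s, |x s|
    rw [← heq s', Finset.sum_div]
    exact Finset.sum_congr rfl fun s _ => by rw [div_mul_eq_mul_div]

open Matrix in
/-- A function whose one-step drift is at most one drifts by at most `t` in `t` steps. -/
lemma abs_sub_pow_mulVec_le [DecidableEq S] {P : Matrix S S ℝ} (h0 : ∀ s s', 0 ≤ P s s')
    (h1 : ∀ s, ∑ s', P s s' = 1) {v : S → ℝ} (hv : ∀ s, |v s - (P *ᵥ v) s| ≤ 1) (t : ℕ) (s : S) :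
    |v s - (P ^ t *ᵥ v) s| ≤ t := by
  induction t generalizing s with
  | zero => simp
  | succ t ih =>
    have h2 : v s - (P ^ (t + 1) *ᵥ v) s =
        (v s - (P *ᵥ v) s) + ∑ s', P s s' * (v s' - (P ^ t *ᵥ v) s') := by
      rw [pow_succ', ← mulVec_mulVec]
      simp only [mulVec, dotProduct, mul_sub, Finset.sum_sub_distrib]
      ring
    rw [h2]
    have h3 : |∑ s', P s s' * (v s' - (P ^ t *ᵥ v) s')| ≤ t := by
      calc _ ≤ ∑ s', |P s s' * (v s' - (P ^ t *ᵥ v) s')| := Finset.abs_sum_le_sum_abs _ _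
        _ ≤ ∑ s', P s s' * t := Finset.sum_le_sum fun s' _ => by
            rw [abs_mul, abs_of_nonneg (h0 s s')]
            exact mul_le_mul_of_nonneg_left (ih s') (h0 s s')
        _ = t := by rw [← Finset.sum_mul, h1, one_mul]
    refine (abs_add_le _ _).trans ((add_le_add (hv s) h3).trans (le_of_eq ?_))
    push_cast
    ring

end Markov

/-! ### The linear program, duality and the size of v* -/

section MDP

variable {n : ℕ} {S A : Type*} [Fintype S] {M : MAMDP n S A} {lam : ℝ} {vstar : S → ℝ}
  {mustar : S → A → ℝ}

lemma MAMDP.localReward_nonneg (M : MAMDP n S A) (i : Fin n) (s : S) (a : A) :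
    0 ≤ M.localReward i s a :=
  Finset.sum_nonneg fun s' _ => mul_nonneg (M.p_nonneg s a s') (M.r_nonneg i s a s')

lemma MAMDP.localReward_le_one (M : MAMDP n S A) (i : Fin n) (s : S) (a : A) :
    M.localReward i s a ≤ 1 := by
  rw [← M.p_sum s a]
  exact Finset.sum_le_sum fun s' _ => mul_le_of_le_one_right (M.p_nonneg s a s') (M.r_le_one i s a s')

lemma MAMDP.reward_nonneg (M : MAMDP n S A) (s : S) (a : A) : 0 ≤ M.reward s a :=
  mul_nonneg (by positivity) (Finset.sum_nonneg fun i _ => M.localReward_nonneg i s a)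

lemma MAMDP.reward_le_one (M : MAMDP n S A) (s : S) (a : A) : M.reward s a ≤ 1 := by
  have h : ∑ i, M.localReward i s a ≤ n := by
    simpa using Finset.sum_le_sum fun (i : Fin n) (_ : i ∈ Finset.univ) => M.localReward_le_one i s a
  calc M.reward s a ≤ (1 / (n : ℝ)) * n := mul_le_mul_of_nonneg_left h (by positivity)
    _ ≤ 1 := by
      rw [one_div]
      exact inv_mul_le_one

lemma MAMDP.IsBellman.slack_nonneg (h : M.IsBellman lam vstar) (s : S) (a : A) :
    0 ≤ lam + vstar s - M.reward s a - M.next a vstar s := by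
  have := (h s).2 ⟨a, rfl⟩
  linarith

variable [Fintype A]

lemma MAMDP.policyMatrix_nonneg {π : S → A → ℝ} (hπ : IsPolicy π) (s s' : S) :
    0 ≤ M.policyMatrix π s s' :=
  Finset.sum_nonneg fun a _ => mul_nonneg (hπ.nonneg s a) (M.p_nonneg s a s')

lemma MAMDP.policyMatrix_sum {π : S → A → ℝ} (hπ : IsPolicy π) (s : S) :
    ∑ s', M.policyMatrix π s s' = 1 := by
  simp only [MAMDP.policyMatrix, Matrix.of_apply]
  rw [Finset.sum_comm]
  simp [← Finset.mul_sum, M.p_sum, hπ.sum_one]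

lemma MAMDP.policyMatrix_mulVec {π : S → A → ℝ} (x : S → ℝ) (s : S) :
    Matrix.mulVec (M.policyMatrix π) x s = ∑ a, π s a * M.next a x s := by
  simp only [Matrix.mulVec, dotProduct, MAMDP.policyMatrix, Matrix.of_apply, MAMDP.next,
    Finset.sum_mul, Finset.mul_sum]
  rw [Finset.sum_comm]
  exact Finset.sum_congr rfl fun a _ => Finset.sum_congr rfl fun s' _ => by ring

/-- A feasible occupancy measure is orthogonal to every drift. -/
lemma MAMDP.IsFeasible.sum_drift {m : S → A → ℝ} (h : M.IsFeasible m) (x : S → ℝ) :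
    ∑ s, ∑ a, m s a * (x s - M.next a x s) = 0 := by
  have h1 : ∑ s, ∑ a, m s a * M.next a x s = ∑ s', (∑ s, ∑ a, M.p s a s' * m s a) * x s' := by
    simp only [MAMDP.next, Finset.mul_sum, Finset.sum_mul]
    rw [Finset.sum_comm (s := Finset.univ (α := S)) (t := Finset.univ (α := S))
      (f := fun s' s => ∑ a, M.p s a s' * m s a * x s')]
    refine Finset.sum_congr rfl fun s _ => ?_
    rw [Finset.sum_comm]
    exact Finset.sum_congr rfl fun s' _ => Finset.sum_congr rfl fun a _ => by ring
  simp only [mul_sub, Finset.sum_sub_distrib, h1, ← Finset.sum_mul]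
  simp [← h.balance]

/-- Condition on the state, with a fixed action at states of mass zero. This carries the hypotheses
on policies over to occupancy measures. -/
lemma MAMDP.IsFeasible.exists_policy [Nonempty A] {m : S → A → ℝ} (h : M.IsFeasible m) :
    ∃ π, IsPolicy π ∧ IsStationary (M.policyMatrix π) (fun s => ∑ a, m s a) ∧
      ∀ s a, m s a = (∑ a, m s a) * π s a := by
  classical
  have hnn : ∀ s, 0 ≤ ∑ a, m s a := fun s => Finset.sum_nonneg fun a _ => h.nonneg s a
  let π : S → A → ℝ := fun s a =>
    if ∑ a, m s a = 0 then (if a = Classical.arbitrary A then 1 else 0) else m s a / ∑ a, m s a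
  have hmπ : ∀ s a, m s a = (∑ a, m s a) * π s a := by
    intro s a
    by_cases hs : ∑ a, m s a = 0
    · rw [hs, zero_mul]
      exact (Finset.sum_eq_zero_iff_of_nonneg fun a _ => h.nonneg s a).1 hs a (Finset.mem_univ a)
    · simp only [π, if_neg hs]
      field_simp
  refine ⟨π, ⟨fun s a => ?_, fun s => ?_⟩, ⟨hnn, h.sum_one, ?_⟩, hmπ⟩
  · simp only [π]
    split_ifs
    exacts [zero_le_one, le_rfl, div_nonneg (h.nonneg s a) (hnn s)]
  · by_cases hs : ∑ a, m s a = 0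
    · simp [π, if_pos hs]
    · simp only [π, if_neg hs, ← Finset.sum_div]
      exact div_self hs
  · funext s'
    rw [h.balance s']
    change ∑ s, (∑ a, m s a) * ∑ a, π s a * M.p s a s' = _
    refine Finset.sum_congr rfl fun s _ => ?_
    rw [Finset.mul_sum]
    refine Finset.sum_congr rfl fun a _ => ?_
    rw [← mul_assoc, ← hmπ, mul_comm]

lemma MAMDP.IsTauStationary.mem_occupancySet [Nonempty A] {τ : ℝ} (hτ : M.IsTauStationary τ)
    {m : S → A → ℝ} (h : M.IsFeasible m) : m ∈ occupancySet S A τ := by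
  obtain ⟨π, hπ, hst, -⟩ := h.exists_policy
  exact ⟨h.nonneg, h.sum_one, hτ.lower π _ hπ hst⟩

/-- Weight a greedy policy of the Bellman equation by a stationary distribution of its chain. -/
lemma MAMDP.IsBellman.exists_feasible [Nonempty S] {lam : ℝ} {v : S → ℝ} (h : M.IsBellman lam v) :
    ∃ m, M.IsFeasible m ∧ ∑ s, ∑ a, m s a * M.reward s a = lam := by
  classical
  choose f hf using fun s => (h s).1
  have hf : ∀ s, M.reward s (f s) + M.next (f s) v s = lam + v s := hf
  obtain ⟨ξ, hξ⟩ := exists_isStationary (P := Matrix.of fun s s' => M.p s (f s) s')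
    (fun s s' => M.p_nonneg _ _ _) (fun s => M.p_sum _ _)
  have hm : M.IsFeasible (fun s a => if a = f s then ξ s else 0) := by
    refine ⟨fun s a => ?_, ?_, fun s' => ?_⟩
    · split_ifs
      exacts [hξ.nonneg s, le_rfl]
    · simp [hξ.sum_one]
    · simp only [Finset.sum_ite_eq', Finset.mem_univ, if_true, mul_ite, mul_zero]
      conv_lhs => rw [← congrFun hξ.invariant s']
      exact Finset.sum_congr rfl fun s _ => mul_comm _ _
  refine ⟨_, hm, ?_⟩
  have h1 := hm.sum_drift v
  simp only [ite_mul, zero_mul, Finset.sum_ite_eq', Finset.mem_univ, if_true] at h1 ⊢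
  have h2 : ∀ s, ξ s * M.reward s (f s) = ξ s * lam + ξ s * (v s - M.next (f s) v s) := fun s => by
    rw [← mul_add]
    congr 1
    linarith [hf s]
  simp only [h2, Finset.sum_add_distrib, ← Finset.sum_mul, hξ.sum_one, h1]
  ring

/-- The duality gap of the linear program as a pairing with the dual slack; v drops out because
feasible measures see no drift. -/
lemma MAMDP.IsFeasible.sum_slack {m : S → A → ℝ} (h : M.IsFeasible m) (lam : ℝ) (v : S → ℝ) :
    ∑ s, ∑ a, m s a * (lam + v s - M.reward s a - M.next a v s) =
      lam - ∑ s, ∑ a, m s a * M.reward s a := by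
  have h1 : ∀ s a, m s a * (lam + v s - M.reward s a - M.next a v s) =
      m s a * lam - m s a * M.reward s a + m s a * (v s - M.next a v s) := fun s a => by ring
  simp only [h1, Finset.sum_add_distrib, h.sum_drift, Finset.sum_sub_distrib, ← Finset.sum_mul,
    h.sum_one]
  ring

/-- Weak duality gives ≤; the occupancy measure of a greedy policy gives ≥. -/
lemma MAMDP.IsOptimal.value_eq [Nonempty S] (h : M.IsOptimal lam vstar mustar) :
    ∑ s, ∑ a, mustar s a * M.reward s a = lam := by
  obtain ⟨m, hm, hmlam⟩ := h.bellman.exists_feasible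
  have h1 := h.occupancy.feasible.sum_slack lam vstar
  have h2 : 0 ≤ ∑ s, ∑ a, mustar s a * (lam + vstar s - M.reward s a - M.next a vstar s) :=
    Finset.sum_nonneg fun s _ => Finset.sum_nonneg fun a _ =>
      mul_nonneg (h.occupancy.feasible.nonneg s a) (h.bellman.slack_nonneg s a)
  linarith [h.occupancy.optimal m hm]

/-- Complementary slackness. -/
lemma MAMDP.IsOptimal.slack [Nonempty S] (h : M.IsOptimal lam vstar mustar) (s : S) (a : A) :
    mustar s a * (lam + vstar s - M.reward s a - M.next a vstar s) = 0 := by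
  have h1 := h.occupancy.feasible.sum_slack lam vstar
  rw [h.value_eq, sub_self] at h1
  have hnn : ∀ s a, 0 ≤ mustar s a * (lam + vstar s - M.reward s a - M.next a vstar s) := fun s a =>
    mul_nonneg (h.occupancy.feasible.nonneg s a) (h.bellman.slack_nonneg s a)
  have h2 := (Finset.sum_eq_zero_iff_of_nonneg fun s _ => Finset.sum_nonneg fun a _ => hnn s a).1 h1
    s (Finset.mem_univ s)
  exact (Finset.sum_eq_zero_iff_of_nonneg fun a _ => hnn s a).1 h2 a (Finset.mem_univ a)

lemma MAMDP.IsOptimal.lam_mem [Nonempty S] (h : M.IsOptimal lam vstar mustar) :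
    0 ≤ lam ∧ lam ≤ 1 := by
  have hf := h.occupancy.feasible
  constructor
  · rw [← h.value_eq]
    exact Finset.sum_nonneg fun s _ => Finset.sum_nonneg fun a _ =>
      mul_nonneg (hf.nonneg s a) (M.reward_nonneg s a)
  · rw [← h.value_eq, ← hf.sum_one]
    exact Finset.sum_le_sum fun s _ => Finset.sum_le_sum fun a _ =>
      mul_le_of_le_one_right (hf.nonneg s a) (M.reward_le_one s a)

/-- The differential reward of a mixing process is bounded by twice the mixing time. -/
lemma MAMDP.IsOptimal.vstar_mem [Nonempty S] [Nonempty A] {τ tmix : ℝ} (hτ : M.IsTauStationary τ)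
    (hmix : M.IsMixing tmix) (h : M.IsOptimal lam vstar mustar) :
    1 ≤ tmix ∧ vstar ∈ valueSet S tmix := by
  classical
  have hf := h.occupancy.feasible
  obtain ⟨π, hπ, hst, hmπ⟩ := hf.exists_policy
  have hξ : ∀ s, 0 < ∑ a, mustar s a := fun s => by
    refine lt_of_lt_of_le ?_ (hτ.lower π _ hπ hst s)
    have := hτ.one_lt
    have : 0 < √τ := Real.sqrt_pos.2 (by linarith)
    positivity
  -- Every state has positive mass under ξ*, so complementary slackness can be divided by it: π uses
  -- only greedy actions.
  have hdrift : ∀ s, vstar s - Matrix.mulVec (M.policyMatrix π) vstar s =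
      ∑ a, π s a * (M.reward s a - lam) := by
    intro s
    have h1 : ∀ a, π s a * (lam + vstar s - M.reward s a - M.next a vstar s) = 0 := fun a => by
      have := h.slack s a
      rw [hmπ, mul_assoc] at this
      exact (mul_eq_zero.1 this).resolve_left (hξ s).ne'
    have h2 : ∑ a, π s a * (lam + vstar s - M.reward s a - M.next a vstar s) = 0 :=
      Finset.sum_eq_zero fun a _ => h1 a
    rw [M.policyMatrix_mulVec]
    simp only [mul_sub, mul_add, Finset.sum_sub_distrib, Finset.sum_add_distrib, ← Finset.sum_mul,
      hπ.sum_one] at h2 ⊢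
    linarith
  have hlam := h.lam_mem
  have hdrift1 : ∀ s, |vstar s - Matrix.mulVec (M.policyMatrix π) vstar s| ≤ 1 := by
    intro s
    rw [hdrift, ← hπ.sum_one s]
    refine (Finset.abs_sum_le_sum_abs _ _).trans (Finset.sum_le_sum fun a _ => ?_)
    rw [abs_mul, abs_of_nonneg (hπ.nonneg s a)]
    refine mul_le_of_le_one_right (hπ.nonneg s a) (abs_le.2 ⟨?_, ?_⟩) <;>
      linarith [M.reward_nonneg s a, M.reward_le_one s a]
  obtain ⟨t, ht1, httmix, htv⟩ := hmix π _ hπ hst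
  have ht1' : (1 : ℝ) ≤ t := by exact_mod_cast ht1
  refine ⟨ht1'.trans httmix, ?_⟩
  obtain ⟨s₀, -, hs₀⟩ := Finset.exists_max_image Finset.univ (fun s => |vstar s|) Finset.univ_nonempty
  -- Since v* has mean zero under ξ*, subtracting ξ* from the law changes nothing, and total
  -- variation 1/4 is ℓ¹ distance 1/2. With the drift bound, |v*(s₀)| ≤ t + |v*(s₀)|/2 at the
  -- maximizing state.
  have hbound : |Matrix.mulVec (M.policyMatrix π ^ t) vstar s₀| ≤ 1 / 2 * |vstar s₀| := by
    have h1 : Matrix.mulVec (M.policyMatrix π ^ t) vstar s₀ =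
        ∑ s, ((M.policyMatrix π ^ t) s₀ s - ∑ a, mustar s a) * vstar s := by
      simp only [sub_mul, Finset.sum_sub_distrib, h.normalized, sub_zero]
      rfl
    have h2 := htv s₀
    unfold tvDist at h2
    rw [h1]
    calc _ ≤ ∑ s, |((M.policyMatrix π ^ t) s₀ s - ∑ a, mustar s a) * vstar s| :=
          Finset.abs_sum_le_sum_abs _ _
      _ ≤ ∑ s, |(M.policyMatrix π ^ t) s₀ s - ∑ a, mustar s a| * |vstar s₀| :=
          Finset.sum_le_sum fun s _ => by
            rw [abs_mul]
            exact mul_le_mul_of_nonneg_left (hs₀ s (Finset.mem_univ s)) (abs_nonneg _)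
      _ ≤ _ := by
          rw [← Finset.sum_mul]
          refine mul_le_mul_of_nonneg_right ?_ (abs_nonneg _)
          convert (show ∑ s, |(M.policyMatrix π ^ t) s₀ s - ∑ a, mustar s a| ≤ 1 / 2 by linarith)
  have hdr := abs_sub_pow_mulVec_le (fun s s' => M.policyMatrix_nonneg hπ s s')
    (fun s => M.policyMatrix_sum hπ s) hdrift1 t s₀
  intro s
  refine (hs₀ s (Finset.mem_univ s)).trans ?_
  have h3 := abs_sub_abs_le_abs_sub (vstar s₀) (Matrix.mulVec (M.policyMatrix π ^ t) vstar s₀)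
  linarith

end MDP

/-! ### Euclidean projection onto the box of value vectors -/

section Box

variable {S : Type*} [Fintype S] {tmix : ℝ} {y w u : S → ℝ}

lemma valueSet_combo {S : Type*} {tmix : ℝ} {w u : S → ℝ} {ε : ℝ} (hw : w ∈ valueSet S tmix)
    (hu : u ∈ valueSet S tmix) (h0 : 0 ≤ ε) (h1 : ε ≤ 1) :
    (fun s => w s + ε * (u s - w s)) ∈ valueSet S tmix := by
  intro s
  have h2 := abs_le.1 (hw s)
  have h3 := abs_le.1 (hu s)
  have h4 : 0 ≤ 1 - ε := by linarith
  rw [abs_le]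
  constructor <;> nlinarith

/-- Obtuse-angle criterion, from convexity of the box alone: the squared distance to y cannot
decrease from w towards u, so I ≥ 0. -/
lemma IsEuclideanProj.pythagorean (h : IsEuclideanProj (valueSet S tmix) y w)
    (hu : u ∈ valueSet S tmix) :
    ∑ s, (w s - y s) ^ 2 + ∑ s, (w s - u s) ^ 2 ≤ ∑ s, (u s - y s) ^ 2 := by
  set K := ∑ s, (u s - w s) ^ 2 with hK
  set I := ∑ s, (w s - y s) * (u s - w s) with hI
  have hK0 : 0 ≤ K := Finset.sum_nonneg fun s _ => sq_nonneg _
  have key : ∀ ε : ℝ, 0 < ε → ε ≤ 1 → 0 ≤ 2 * I + ε * K := by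
    intro ε h0 h1
    have h2 := h.2 _ (valueSet_combo h.1 hu h0.le h1)
    have h3 : ∑ s, (w s + ε * (u s - w s) - y s) ^ 2 =
        ∑ s, (w s - y s) ^ 2 + ε * (2 * I + ε * K) := by
      simp only [hI, hK, Finset.mul_sum, ← Finset.sum_add_distrib]
      exact Finset.sum_congr rfl fun s _ => by ring
    rw [h3] at h2
    exact nonneg_of_mul_nonneg_right (by linarith) h0
  have hI0 : 0 ≤ I := by
    by_contra! hlt
    have h7 := key (min 1 (-I / (K + 1))) (lt_min one_pos (by apply div_pos <;> linarith))
      (min_le_left _ _)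
    have h8 : min 1 (-I / (K + 1)) * K ≤ -I / (K + 1) * (K + 1) := by
      apply mul_le_mul (min_le_right _ _) (by linarith) hK0
      apply div_nonneg <;> linarith
    rw [div_mul_cancel₀ _ (by positivity)] at h8
    linarith
  have h4 : ∑ s, (u s - y s) ^ 2 = ∑ s, (w s - y s) ^ 2 + ∑ s, (w s - u s) ^ 2 + 2 * I := by
    simp only [hI, Finset.mul_sum, ← Finset.sum_add_distrib]
    exact Finset.sum_congr rfl fun s _ => by ring
  linarith

lemma IsEuclideanProj.unique {w' : S → ℝ} (h : IsEuclideanProj (valueSet S tmix) y w)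
    (h' : IsEuclideanProj (valueSet S tmix) y w') : w' = w := by
  have h1 := h.pythagorean h'.1
  have h2 := h'.2 _ h.1
  have h3 : ∑ s, (w s - w' s) ^ 2 = 0 :=
    le_antisymm (by linarith) (Finset.sum_nonneg fun s _ => sq_nonneg _)
  funext s
  have := (Finset.sum_eq_zero_iff_of_nonneg fun s _ => sq_nonneg (w s - w' s)).1 h3 s
    (Finset.mem_univ s)
  exact (sub_eq_zero.1 (pow_eq_zero_iff two_ne_zero |>.1 this)).symm

lemma IsEuclideanProj.sum_sq_le (h : IsEuclideanProj (valueSet S tmix) y w)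
    (hu : u ∈ valueSet S tmix) : ∑ s, (w s - u s) ^ 2 ≤ ∑ s, (y s - u s) ^ 2 := by
  have h1 := h.pythagorean hu
  have h2 : 0 ≤ ∑ s, (w s - y s) ^ 2 := Finset.sum_nonneg fun s _ => sq_nonneg _
  have h3 : ∑ s, (u s - y s) ^ 2 = ∑ s, (y s - u s) ^ 2 :=
    Finset.sum_congr rfl fun s _ => sub_sq_comm _ _
  linarith

end Box

/-! ### One step of the algorithm -/

section Step

variable {n : ℕ} {S A : Type*} [Fintype S] {M : MAMDP n S A} {tmix α β η τ : ℝ}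

/-- The shifted temporal difference that drives the dual update. -/
def MAMDP.tdError (M : MAMDP n S A) (tmix : ℝ) (i : Fin n) (v : S → ℝ) (x : S × A × S) : ℝ :=
  v x.2.2 - v x.1 + M.r i x.1 x.2.1 x.2.2 - (4 * tmix + 1)

/-- The shift 4tmix + 1 is exactly the largest value the unshifted difference can take over 𝒱. -/
lemma MAMDP.tdError_mem {v : S → ℝ} (hv : v ∈ valueSet S tmix) (i : Fin n) (x : S × A × S) :
    -(2 * (4 * tmix + 1)) ≤ M.tdError tmix i v x ∧ M.tdError tmix i v x ≤ 0 := by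
  have h1 := abs_le.1 (hv x.2.2)
  have h2 := abs_le.1 (hv x.1)
  have h3 := M.r_nonneg i x.1 x.2.1 x.2.2
  have h4 := M.r_le_one i x.1 x.2.1 x.2.2
  unfold MAMDP.tdError
  constructor <;> linarith

lemma MAMDP.tdError_sq_le {v : S → ℝ} (hv : v ∈ valueSet S tmix) (i : Fin n) (x : S × A × S) :
    M.tdError tmix i v x ^ 2 ≤ 4 * (4 * tmix + 1) ^ 2 := by
  have := M.tdError_mem hv i x
  nlinarith

lemma MAMDP.dualGrad_nonpos (hβ : 0 ≤ β) {mt : S → A → ℝ} (hmt : ∀ s a, 0 < mt s a) {v : S → ℝ}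
    (hv : v ∈ valueSet S tmix) (i : Fin n) (x : S × A × S) (s : S) (a : A) :
    M.dualGrad tmix β i mt v x s a ≤ 0 := by
  unfold MAMDP.dualGrad
  split_ifs
  · exact mul_nonpos_of_nonneg_of_nonpos hβ
      (div_nonpos_of_nonpos_of_nonneg (M.tdError_mem hv i x).2 (hmt _ _).le)
  · exact le_rfl

lemma MAMDP.abs_dualGrad_le (hβ : 0 ≤ β) {mt : S → A → ℝ} (hmt : ∀ s a, 0 < mt s a) {v : S → ℝ}
    (hv : v ∈ valueSet S tmix) (i : Fin n) (x : S × A × S) (s : S) (a : A) :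
    |M.dualGrad tmix β i mt v x s a| ≤ β * (2 * (4 * tmix + 1) / mt x.1 x.2.1) := by
  have h1 := M.tdError_mem hv i x
  have h0 : 0 ≤ β * (2 * (4 * tmix + 1) / mt x.1 x.2.1) :=
    mul_nonneg hβ (div_nonneg (by linarith) (hmt _ _).le)
  unfold MAMDP.dualGrad
  split_ifs
  · rw [abs_mul, abs_of_nonneg hβ, abs_div, abs_of_pos (hmt _ _)]
    refine mul_le_mul_of_nonneg_left (div_le_div_of_nonneg_right ?_ (hmt _ _).le) hβ
    exact abs_le.2 ⟨h1.1, h1.2.trans (by linarith)⟩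
  · simpa using h0

lemma MAMDP.next_sub (M : MAMDP n S A) (a : A) (x y : S → ℝ) (s : S) :
    M.next a (fun s => x s - y s) s = M.next a x s - M.next a y s := by
  simp [MAMDP.next, mul_sub, Finset.sum_sub_distrib]

/-- Upper bound for the distance to `u` after a primal update with the sample `x`. -/
def primalBound (α : ℝ) (m mt : S → A → ℝ) (vt u : S → ℝ) (x : S × A × S) : ℝ :=
  ∑ s, (vt s + primalGrad α m mt x s - u s) ^ 2

lemma primalBound_le (m mt : S → A → ℝ) (vt u : S → ℝ) (x : S × A × S) :
    primalBound α m mt vt u x ≤ ∑ s, (vt s - u s) ^ 2 +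
      2 * α * (m x.1 x.2.1 / mt x.1 x.2.1) * ((vt x.1 - u x.1) - (vt x.2.2 - u x.2.2)) +
      2 * α ^ 2 * (m x.1 x.2.1 / mt x.1 x.2.1) ^ 2 := by
  classical
  set c := m x.1 x.2.1 / mt x.1 x.2.1 with hc
  have h1 : ∀ s, (vt s + primalGrad α m mt x s - u s) ^ 2 ≤ (vt s - u s) ^ 2 +
      2 * α * c * ((if s = x.1 then vt s - u s else 0) - (if s = x.2.2 then vt s - u s else 0)) +
      α ^ 2 * c ^ 2 * ((if s = x.1 then 1 else 0) + (if s = x.2.2 then 1 else 0)) := by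
    intro s
    -- Needed for a sampled self-transition, where the step vanishes but the bound keeps its
    -- quadratic term.
    have hsq : 0 ≤ α ^ 2 * c ^ 2 := by positivity
    simp only [primalGrad, ← hc]
    split_ifs <;> nlinarith
  refine (Finset.sum_le_sum fun s _ => h1 s).trans (le_of_eq ?_)
  simp only [Finset.sum_add_distrib, ← Finset.mul_sum, Finset.sum_sub_distrib, Finset.sum_ite_eq',
    Finset.mem_univ, if_true]
  ring

variable [Fintype A]

lemma sum_sum_mul_single (f : S → A → ℝ) (s₀ : S) (a₀ : A) (g : S → A → ℝ)
    (hg : ∀ s a, ¬(s = s₀ ∧ a = a₀) → g s a = 0) :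
    ∑ s, ∑ a, f s a * g s a = f s₀ a₀ * g s₀ a₀ := by
  rw [Finset.sum_eq_single s₀, Finset.sum_eq_single a₀]
  · intro a _ ha
    rw [hg _ _ fun h => ha h.2, mul_zero]
  · simp
  · intro s _ hs
    exact Finset.sum_eq_zero fun a _ => by rw [hg _ _ fun h => hs h.1, mul_zero]
  · simp

/-- Upper bound for the divergence after a dual update with the sample `x`. -/
def MAMDP.dualBound (M : MAMDP n S A) (tmix β : ℝ) (i : Fin n) (u mt : S → A → ℝ) (v : S → ℝ)
    (x : S × A × S) : ℝ :=
  klDiv u mt + (mt x.1 x.2.1 - u x.1 x.2.1) * (β * (M.tdError tmix i v x / mt x.1 x.2.1)) +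
    mt x.1 x.2.1 * (β * (M.tdError tmix i v x / mt x.1 x.2.1)) ^ 2 / 2

lemma klDiv_dual_step [Nonempty S] [Nonempty A] (hβ : 0 ≤ β) {mt m u : S → A → ℝ} {v : S → ℝ}
    (hmt : ∀ s a, 0 < mt s a) (hmt1 : ∑ s, ∑ a, mt s a = 1) (hv : v ∈ valueSet S tmix) {i : Fin n}
    {x : S × A × S}
    (h : IsKLProj (occupancySet S A τ) (expUpdate mt (M.dualGrad tmix β i mt v x)) m)
    (hm : ∀ s a, 0 < m s a) (hu : u ∈ occupancySet S A τ) :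
    klDiv u m ≤ M.dualBound tmix β i u mt v x := by
  have h1 := klDiv_step hmt hmt1 (M.dualGrad_nonpos hβ hmt hv i x) h hm hu
  have hz : ∀ s a, ¬(s = x.1 ∧ a = x.2.1) → M.dualGrad tmix β i mt v x s a = 0 :=
    fun s a h => if_neg h
  have hx : M.dualGrad tmix β i mt v x x.1 x.2.1 = β * (M.tdError tmix i v x / mt x.1 x.2.1) :=
    if_pos ⟨rfl, rfl⟩
  simp only [mul_div_assoc] at h1
  rw [sum_sum_mul_single _ x.1 x.2.1 _ hz,
    sum_sum_mul_single _ x.1 x.2.1 (fun s a => M.dualGrad tmix β i mt v x s a ^ 2 / 2)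
      (fun s a h => by rw [hz s a h]; simp), hx] at h1
  simp only [MAMDP.dualBound, mul_div_assoc]
  exact h1

/-- The pairing of an occupancy measure with the drift of a value vector. -/
def MAMDP.drift (M : MAMDP n S A) (m : S → A → ℝ) (x : S → ℝ) : ℝ :=
  ∑ s, ∑ a, m s a * (x s - M.next a x s)

lemma MAMDP.drift_sub (M : MAMDP n S A) (m : S → A → ℝ) (x y : S → ℝ) :
    M.drift m (fun s => x s - y s) = M.drift m x - M.drift m y := by
  simp only [MAMDP.drift, M.next_sub, ← Finset.sum_sub_distrib]
  exact Finset.sum_congr rfl fun s _ => Finset.sum_congr rfl fun a _ => by ring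

lemma MAMDP.drift_mixMu (M : MAMDP n S A) (w : Matrix (Fin n) (Fin n) ℝ) (m : Fin n → S → A → ℝ)
    (x : S → ℝ) (i : Fin n) : M.drift (mixMu w m i) x = ∑ j, w i j * M.drift (m j) x := by
  simp only [MAMDP.drift, mixMu, Finset.sum_mul, Finset.mul_sum]
  rw [Finset.sum_comm (s := Finset.univ (α := Fin n))]
  refine Finset.sum_congr rfl fun s _ => ?_
  rw [Finset.sum_comm]
  exact Finset.sum_congr rfl fun j _ => Finset.sum_congr rfl fun a _ => by ring

lemma MAMDP.drift_mixV (M : MAMDP n S A) (w : Matrix (Fin n) (Fin n) ℝ) (v : Fin n → S → ℝ)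
    (m : S → A → ℝ) (i : Fin n) : M.drift m (mixV w v i) = ∑ j, w i j * M.drift m (v j) := by
  have h : ∀ s a, M.next a (mixV w v i) s = ∑ j, w i j * M.next a (v j) s := fun s a => by
    simp only [MAMDP.next, mixV, Finset.mul_sum]
    rw [Finset.sum_comm]
    exact Finset.sum_congr rfl fun j _ => Finset.sum_congr rfl fun a _ => by ring
  simp only [MAMDP.drift, h, Finset.mul_sum]
  rw [Finset.sum_comm (s := Finset.univ (α := Fin n))]
  refine Finset.sum_congr rfl fun s _ => ?_
  rw [Finset.sum_comm]
  refine Finset.sum_congr rfl fun a _ => ?_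
  rw [mixV, ← Finset.sum_sub_distrib, Finset.mul_sum]
  exact Finset.sum_congr rfl fun j _ => by ring

/-- Mean of `g` when `(s, a)` has the law `m` and `s'` the law `p s a`. -/
def MAMDP.expect (M : MAMDP n S A) (m : S → A → ℝ) (g : S × A × S → ℝ) : ℝ :=
  ∑ s, ∑ a, ∑ s', m s a * M.p s a s' * g (s, a, s')

lemma MAMDP.expect_mono {m : S → A → ℝ} (hm : ∀ s a, 0 ≤ m s a) {g g' : S × A × S → ℝ}
    (h : ∀ x, g x ≤ g' x) : M.expect m g ≤ M.expect m g' :=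
  Finset.sum_le_sum fun s _ => Finset.sum_le_sum fun a _ => Finset.sum_le_sum fun s' _ =>
    mul_le_mul_of_nonneg_left (h _) (mul_nonneg (hm s a) (M.p_nonneg s a s'))

/-- The factor 1/μ̃ may be huge pointwise, but its mean only counts state–action pairs. -/
lemma MAMDP.expect_inv {mt : S → A → ℝ} (hmt : ∀ s a, 0 < mt s a) (c : ℝ) :
    M.expect mt (fun x => c / mt x.1 x.2.1) = c * (Fintype.card S * Fintype.card A) := by
  have h : ∀ s a s', mt s a * M.p s a s' * (c / mt s a) = c * M.p s a s' := fun s a s' => by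
    have := (hmt s a).ne'
    field_simp
  simp only [MAMDP.expect, h, ← Finset.mul_sum, M.p_sum]
  simp

/-- Sampling from μ̃ cancels 1/μ̃ in the linear term, leaving an unbiased gradient, and the one
uncancelled factor in the quadratic term, leaving a sum over |S||A| pairs. The shift disappears from
the linear term because both measures have mass one. -/
lemma MAMDP.expect_dualBound_le {mt u : S → A → ℝ} {v : S → ℝ}
    (hmt : ∀ s a, 0 < mt s a) (hmt1 : ∑ s, ∑ a, mt s a = 1) (hu1 : ∑ s, ∑ a, u s a = 1)
    (hv : v ∈ valueSet S tmix) (i : Fin n) :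
    M.expect mt (M.dualBound tmix β i u mt v) ≤
      klDiv u mt + β * (∑ s, ∑ a, (mt s a - u s a) * M.localReward i s a - M.drift mt v +
        M.drift u v) + β ^ 2 * (2 * (Fintype.card S * Fintype.card A) * (4 * tmix + 1) ^ 2) := by
  have h1 : ∀ s a s', mt s a * M.p s a s' * M.dualBound tmix β i u mt v (s, a, s') =
      klDiv u mt * (mt s a * M.p s a s') +
      β * ((mt s a - u s a) * (M.p s a s' * M.tdError tmix i v (s, a, s'))) +
      β ^ 2 / 2 * (M.p s a s' * M.tdError tmix i v (s, a, s') ^ 2) := fun s a s' => by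
    have := (hmt s a).ne'
    simp only [MAMDP.dualBound]
    field_simp
  have h2 : ∀ s a, ∑ s', M.p s a s' * M.tdError tmix i v (s, a, s') =
      M.next a v s - v s + M.localReward i s a - (4 * tmix + 1) := fun s a => by
    simp only [MAMDP.tdError, mul_sub, mul_add, Finset.sum_sub_distrib, Finset.sum_add_distrib,
      ← Finset.sum_mul, M.p_sum, MAMDP.next, MAMDP.localReward]
    ring
  have h3 : ∑ s, ∑ a, ∑ s', M.p s a s' * M.tdError tmix i v (s, a, s') ^ 2 ≤
      ∑ s : S, ∑ a : A, 4 * (4 * tmix + 1) ^ 2 :=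
    Finset.sum_le_sum fun s _ => Finset.sum_le_sum fun a _ => by
      calc _ ≤ ∑ s', M.p s a s' * (4 * (4 * tmix + 1) ^ 2) := Finset.sum_le_sum fun s' _ =>
            mul_le_mul_of_nonneg_left (M.tdError_sq_le hv i _) (M.p_nonneg s a s')
        _ = _ := by rw [← Finset.sum_mul, M.p_sum, one_mul]
  have h4 : ∑ s, ∑ a, (mt s a - u s a) * (M.next a v s - v s + M.localReward i s a - (4 * tmix + 1))
      = ∑ s, ∑ a, (mt s a - u s a) * M.localReward i s a - M.drift mt v + M.drift u v := by
    have h5 : ∀ s a, (mt s a - u s a) *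
        (M.next a v s - v s + M.localReward i s a - (4 * tmix + 1)) =
        (mt s a - u s a) * M.localReward i s a - mt s a * (v s - M.next a v s) +
        u s a * (v s - M.next a v s) - (mt s a * (4 * tmix + 1) - u s a * (4 * tmix + 1)) :=
      fun s a => by ring
    simp only [h5, Finset.sum_sub_distrib, Finset.sum_add_distrib, ← Finset.sum_mul, hmt1, hu1,
      MAMDP.drift]
    ring
  simp only [Finset.sum_const, Finset.card_univ, nsmul_eq_mul] at h3
  unfold MAMDP.expect
  simp only [h1, Finset.sum_add_distrib, ← Finset.mul_sum, M.p_sum, mul_one, hmt1, h2, h4]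
  nlinarith [mul_le_mul_of_nonneg_left h3 (sq_nonneg β)]

/-- The ratio m/μ̃ reweights the sample to the law m; its second moment Σ m²/μ̃ is at most 1/η since
μ̃ ≥ ηm. -/
lemma MAMDP.expect_primalBound_le (hη : 0 < η) {m mt : S → A → ℝ} (hm : ∀ s a, 0 ≤ m s a)
    (hm1 : ∑ s, ∑ a, m s a = 1) (hmt : ∀ s a, 0 < mt s a) (hmt1 : ∑ s, ∑ a, mt s a = 1)
    (hmmt : ∀ s a, η * m s a ≤ mt s a) (vt u : S → ℝ) :
    M.expect mt (primalBound α m mt vt u) ≤ ∑ s, (vt s - u s) ^ 2 +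
      2 * α * (M.drift m vt - M.drift m u) + 2 * α ^ 2 / η := by
  refine (M.expect_mono (fun s a => (hmt s a).le) (primalBound_le m mt vt u)).trans ?_
  rw [← M.drift_sub]
  have h1 : ∀ s a s', mt s a * M.p s a s' * (∑ s, (vt s - u s) ^ 2 +
      2 * α * (m s a / mt s a) * ((vt s - u s) - (vt s' - u s')) +
      2 * α ^ 2 * (m s a / mt s a) ^ 2) = (∑ s, (vt s - u s) ^ 2) * (mt s a * M.p s a s') +
      2 * α * (m s a * ((vt s - u s) * M.p s a s' - M.p s a s' * (vt s' - u s'))) +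
      2 * α ^ 2 * (m s a * (m s a / mt s a) * M.p s a s') := fun s a s' => by
    have := (hmt s a).ne'
    field_simp
  have h2 : ∑ s, ∑ a, m s a * (m s a / mt s a) ≤ 1 / η := by
    rw [← hm1, Finset.sum_div]
    refine Finset.sum_le_sum fun s _ => ?_
    rw [Finset.sum_div]
    refine Finset.sum_le_sum fun a _ => ?_
    rw [div_eq_mul_one_div (m s a) η]
    refine mul_le_mul_of_nonneg_left ?_ (hm s a)
    rw [div_le_div_iff₀ (hmt s a) hη]
    linarith [hmmt s a]
  unfold MAMDP.expect
  simp only [h1, Finset.sum_add_distrib, Finset.sum_sub_distrib, ← Finset.mul_sum, M.p_sum, mul_one,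
    hmt1]
  have h3 : ∑ s, ∑ a, m s a * ((vt s - u s) - ∑ s', M.p s a s' * (vt s' - u s')) =
      M.drift m fun s => vt s - u s := rfl
  rw [h3]
  have := mul_le_mul_of_nonneg_left h2 (show 0 ≤ 2 * α ^ 2 by positivity)
  rw [mul_one_div] at this
  linarith

end Step

/-! ### Expected decrease of the potential -/

section Potential

variable {n : ℕ} {S A : Type*} [Fintype S] {M : MAMDP n S A} {η τ tmix α β lam : ℝ}
  {w : Matrix (Fin n) (Fin n) ℝ}

lemma sum_localReward (hn : 0 < n) (s : S) (a : A) :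
    ∑ i, M.localReward i s a = n * M.reward s a := by
  have : (n : ℝ) ≠ 0 := by positivity
  rw [MAMDP.reward]
  field_simp

variable [Fintype A]

/-- The network average of the occupancy measures. -/
def meanMu (m : Fin n → S → A → ℝ) (s : S) (a : A) : ℝ := mean fun i => m i s a

/-- Total disagreement of the occupancy measures. -/
def disagreement (m : Fin n → S → A → ℝ) : ℝ := ∑ s, ∑ a, disp fun i => m i s a

/-- The Lyapunov function with the value vectors measured agent by agent. -/
def potential (tmix : ℝ) (vstar : S → ℝ) (mustar : S → A → ℝ) (m : Fin n → S → A → ℝ)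
    (v : Fin n → S → ℝ) : ℝ :=
  (1 / (n : ℝ)) * ∑ i, (klDiv mustar (m i) +
    1 / (2 * (Fintype.card S : ℝ) * tmix ^ 2) * ∑ s, (v i s - vstar s) ^ 2)

lemma IsWeight.sum_klDiv_mixMu_le (hw : IsWeight η w) {m : Fin n → S → A → ℝ} {u : S → A → ℝ}
    (hm : ∀ i s a, 0 < m i s a) (hu : ∀ s a, 0 ≤ u s a) :
    ∑ i, klDiv u (mixMu w m i) ≤ ∑ i, klDiv u (m i) := by
  calc _ ≤ ∑ i, ∑ j, w i j * klDiv u (m j) :=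
        Finset.sum_le_sum fun i _ => klDiv_mixMu_le hw.nonneg hw.row_sum hm hu i
    _ = _ := by
        rw [Finset.sum_comm]
        simp [← Finset.sum_mul, hw.col_sum]

lemma IsWeight.sum_sq_mixV_le {S : Type*} [Fintype S] (hw : IsWeight η w) (v : Fin n → S → ℝ)
    (u : S → ℝ) :
    ∑ i, ∑ s, (mixV w v i s - u s) ^ 2 ≤ ∑ i, ∑ s, (v i s - u s) ^ 2 := by
  have h : ∀ i s, (mixV w v i s - u s) ^ 2 ≤ ∑ j, w i j * (v j s - u s) ^ 2 := fun i s => by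
    have h1 : mixV w v i s - u s = ∑ j, w i j * (v j s - u s) := by
      simp only [mixV, mul_sub, Finset.sum_sub_distrib, ← Finset.sum_mul, hw.row_sum]
      ring
    rw [h1, sq_weighted_sum (hw.row_sum i)]
    have h2 : 0 ≤ ∑ k, ∑ j, w i k * w i j * (v k s - u s - (v j s - u s)) ^ 2 :=
      Finset.sum_nonneg fun k _ => Finset.sum_nonneg fun j _ =>
        mul_nonneg (mul_nonneg (hw.nonneg i k) (hw.nonneg i j)) (sq_nonneg _)
    linarith
  calc _ ≤ ∑ i, ∑ s, ∑ j, w i j * (v j s - u s) ^ 2 :=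
        Finset.sum_le_sum fun i _ => Finset.sum_le_sum fun s _ => h i s
    _ = ∑ j, ∑ s, (∑ i, w i j) * (v j s - u s) ^ 2 := by
        simp only [Finset.sum_mul]
        rw [Finset.sum_comm, Finset.sum_comm (s := Finset.univ (α := Fin n))
          (t := Finset.univ (α := S))]
        exact Finset.sum_congr rfl fun s _ => Finset.sum_comm
    _ = _ := by simp [hw.col_sum]

/-- The drift is bilinear and W is symmetric, so mixing can move from one argument to the other.
This cancels the coupling terms of the primal and dual steps. -/
lemma IsWeight.sum_drift_comm (hw : IsWeight η w) (m : Fin n → S → A → ℝ) (v : Fin n → S → ℝ) :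
    ∑ i, M.drift (mixMu w m i) (v i) = ∑ i, M.drift (m i) (mixV w v i) := by
  simp only [M.drift_mixMu, M.drift_mixV]
  rw [Finset.sum_comm]
  exact Finset.sum_congr rfl fun i _ => Finset.sum_congr rfl fun j _ => by rw [hw.symm]

/-- Rewards lie in [0,1], so replacing each mixed measure by the average costs its ℓ¹ deviation, at
most √n times the dispersion. Mixing keeps the mean and does not raise the dispersion. -/
lemma IsWeight.sum_reward_le (hw : IsWeight η w) (hn : 0 < n) (m : Fin n → S → A → ℝ) :
    ∑ i, ∑ s, ∑ a, mixMu w m i s a * M.localReward i s a ≤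
      n * ∑ s, ∑ a, meanMu m s a * M.reward s a + √(n : ℝ) * disagreement m := by
  have hpt : ∀ s a, ∑ i, mixMu w m i s a * M.localReward i s a ≤
      n * (meanMu m s a * M.reward s a) + √(n : ℝ) * disp fun i => m i s a := by
    intro s a
    set x : Fin n → ℝ := fun i => m i s a with hx
    have h1 : ∀ i, mixMu w m i s a = w.mulVec x i := fun i => rfl
    have h2 : ∑ i, mixMu w m i s a * M.localReward i s a =
        n * (meanMu m s a * M.reward s a) +
          ∑ i, (w.mulVec x i - mean (w.mulVec x)) * M.localReward i s a := by
      rw [hw.mean_mulVec, show meanMu m s a = mean x from rfl]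
      simp only [h1, sub_mul, Finset.sum_sub_distrib, ← Finset.mul_sum, sum_localReward hn]
      ring
    have h3 : ∑ i, (w.mulVec x i - mean (w.mulVec x)) * M.localReward i s a ≤
        ∑ i, |w.mulVec x i - mean (w.mulVec x)| := Finset.sum_le_sum fun i _ => by
      calc _ ≤ |(w.mulVec x i - mean (w.mulVec x)) * M.localReward i s a| := le_abs_self _
        _ = |w.mulVec x i - mean (w.mulVec x)| * M.localReward i s a := by
          rw [abs_mul, abs_of_nonneg (M.localReward_nonneg i s a)]
        _ ≤ _ := mul_le_of_le_one_right (abs_nonneg _) (M.localReward_le_one i s a)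
    have h4 := sum_abs_sub_mean_le (w.mulVec x)
    have h5 := mul_le_mul_of_nonneg_left (hw.disp_mulVec_le hn x) (Real.sqrt_nonneg (n : ℝ))
    linarith
  have h6 : ∑ i, ∑ s, ∑ a, mixMu w m i s a * M.localReward i s a =
      ∑ s, ∑ a, ∑ i, mixMu w m i s a * M.localReward i s a := by
    rw [Finset.sum_comm]
    exact Finset.sum_congr rfl fun s _ => Finset.sum_comm
  rw [h6]
  refine (Finset.sum_le_sum fun s _ => Finset.sum_le_sum fun a _ => hpt s a).trans (le_of_eq ?_)
  simp only [disagreement, Finset.sum_add_distrib, Finset.mul_sum]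

lemma MAMDP.gap_eq (M : MAMDP n S A) (lam : ℝ) (v : S → ℝ) (m : S → A → ℝ) :
    M.gap lam v m = lam + M.drift m v - ∑ s, ∑ a, m s a * M.reward s a := by
  rw [MAMDP.gap, Finset.sum_comm, MAMDP.drift, add_sub_assoc, ← Finset.sum_sub_distrib]
  congr 1
  refine Finset.sum_congr rfl fun s _ => ?_
  rw [← Finset.sum_sub_distrib]
  exact Finset.sum_congr rfl fun a _ => by ring

lemma MAMDP.sum_drift_eq (M : MAMDP n S A) (hn : 0 < n) (m : Fin n → S → A → ℝ) (x : S → ℝ) :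
    ∑ i, M.drift (m i) x = n * M.drift (meanMu m) x := by
  have hn' : (n : ℝ) ≠ 0 := by positivity
  simp only [MAMDP.drift, Finset.mul_sum]
  rw [Finset.sum_comm]
  refine Finset.sum_congr rfl fun s _ => ?_
  rw [Finset.sum_comm]
  refine Finset.sum_congr rfl fun a _ => ?_
  rw [← Finset.sum_mul, meanMu, mean]
  field_simp

/-- One-step expected decrease of the potential. -/
lemma expected_potential_le [Nonempty S] (hw : IsWeight η w) (hη : 0 < η)
    (hn : 0 < n) (ht : 1 ≤ tmix) (hβ : 0 ≤ β) (hα : α = (Fintype.card S : ℝ) * tmix ^ 2 * β)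
    {vstar : S → ℝ} {mustar : S → A → ℝ} (hopt : M.IsOptimal lam vstar mustar)
    {m : Fin n → S → A → ℝ} {v : Fin n → S → ℝ} (hm : ∀ i s a, 0 < m i s a)
    (hmU : ∀ i, m i ∈ occupancySet S A τ) (hv : ∀ i, v i ∈ valueSet S tmix) :
    (1 / (n : ℝ)) * ∑ i, (M.expect (mixMu w m i) (M.dualBound tmix β i mustar (mixMu w m i) (v i)) +
      1 / (2 * (Fintype.card S : ℝ) * tmix ^ 2) *
        M.expect (mixMu w m i) (primalBound α (m i) (mixMu w m i) (mixV w v i) vstar)) ≤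
    potential tmix vstar mustar m v - β * M.gap lam vstar (meanMu m) +
      β * (√(n : ℝ) / n * disagreement m) +
      β ^ 2 * (2 * (Fintype.card S * Fintype.card A) * (4 * tmix + 1) ^ 2 +
        Fintype.card S * tmix ^ 2 / η) := by
  have hn' : (0 : ℝ) < n := by positivity
  have hS : (0 : ℝ) < Fintype.card S := by exact_mod_cast Fintype.card_pos
  have hf := hopt.occupancy.feasible
  set c := 1 / (2 * (Fintype.card S : ℝ) * tmix ^ 2) with hc
  have hc0 : 0 ≤ c := by positivity
  -- The reason for α = |S|tmix²β: the primal coupling now has the coefficient of the dual one.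
  have hcα : c * (2 * α) = β := by
    rw [hc, hα]
    field_simp
  have hmt := fun i => mixMu_pos hw.nonneg hw.row_sum hm i
  have hmtU := fun i => mixMu_mem hw.nonneg hw.row_sum hmU i
  have hmmt : ∀ i s a, η * m i s a ≤ mixMu w m i s a := fun i s a =>
    (mul_le_mul_of_nonneg_right (hw.diag i) (hm i s a).le).trans
      (Finset.single_le_sum (f := fun j => w i j * m j s a)
        (fun j _ => mul_nonneg (hw.nonneg i j) (hm j s a).le) (Finset.mem_univ i))
  set K := β ^ 2 * (2 * (Fintype.card S * Fintype.card A) * (4 * tmix + 1) ^ 2 +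
        Fintype.card S * tmix ^ 2 / η) with hK
  have hone : ∀ i, M.expect (mixMu w m i) (M.dualBound tmix β i mustar (mixMu w m i) (v i)) +
      c * M.expect (mixMu w m i) (primalBound α (m i) (mixMu w m i) (mixV w v i) vstar) ≤
      klDiv mustar (mixMu w m i) + c * ∑ s, (mixV w v i s - vstar s) ^ 2 +
      β * (∑ s, ∑ a, mixMu w m i s a * M.localReward i s a -
        ∑ s, ∑ a, mustar s a * M.localReward i s a - M.drift (mixMu w m i) (v i) +
        M.drift (m i) (mixV w v i) - M.drift (m i) vstar) + K := by
    intro i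
    have h1 := M.expect_dualBound_le (β := β) (u := mustar) (hmt i) (hmtU i).2.1 hf.sum_one (hv i) i
    have h2 := mul_le_mul_of_nonneg_left (M.expect_primalBound_le (α := α) hη
      (fun s a => (hm i s a).le) (hmU i).2.1 (hmt i) (hmtU i).2.1 (hmmt i) (mixV w v i) vstar) hc0
    have h3 : c * (2 * α * (M.drift (m i) (mixV w v i) - M.drift (m i) vstar)) =
        β * (M.drift (m i) (mixV w v i) - M.drift (m i) vstar) := by
      rw [← mul_assoc, hcα]
    have h4 : c * (2 * α ^ 2 / η) = β ^ 2 * (Fintype.card S * tmix ^ 2 / η) := by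
      rw [show c * (2 * α ^ 2 / η) = c * (2 * α) * α / η by ring, hcα, hα]
      ring
    have h5 : M.drift mustar (v i) = 0 := hf.sum_drift (v i)
    simp only [sub_mul, Finset.sum_sub_distrib, h5, mul_add, h3, h4] at h1 h2
    rw [hK]
    linarith
  have hkl := hw.sum_klDiv_mixMu_le hm hf.nonneg
  have hsq := mul_le_mul_of_nonneg_left (hw.sum_sq_mixV_le v vstar) hc0
  have hcomm := hw.sum_drift_comm (M := M) m v
  have hrew := hw.sum_reward_le (M := M) hn m
  have hval : ∑ i, ∑ s, ∑ a, mustar s a * M.localReward i s a = n * lam := by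
    rw [← hopt.value_eq, Finset.sum_comm, Finset.mul_sum]
    refine Finset.sum_congr rfl fun s _ => ?_
    rw [Finset.sum_comm, Finset.mul_sum]
    refine Finset.sum_congr rfl fun a _ => ?_
    rw [← Finset.mul_sum, sum_localReward hn]
    ring
  have hsum := Finset.sum_le_sum fun i (_ : i ∈ Finset.univ) => hone i
  simp only [Finset.sum_add_distrib, ← Finset.mul_sum, Finset.sum_sub_distrib, hcomm, hval,
    M.sum_drift_eq hn, Finset.sum_const, Finset.card_univ, Fintype.card_fin, nsmul_eq_mul] at hsum
  rw [M.gap_eq, potential]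
  simp only [Finset.sum_add_distrib, ← Finset.mul_sum]
  have hrew' := mul_le_mul_of_nonneg_left hrew hβ
  have htot : ∑ i, M.expect (mixMu w m i) (M.dualBound tmix β i mustar (mixMu w m i) (v i)) +
      c * ∑ i, M.expect (mixMu w m i) (primalBound α (m i) (mixMu w m i) (mixV w v i) vstar) ≤
      ∑ i, klDiv mustar (m i) + c * ∑ i, ∑ s, (v i s - vstar s) ^ 2 -
      n * (β * (lam + M.drift (meanMu m) vstar - ∑ s, ∑ a, meanMu m s a * M.reward s a)) +
      β * (√(n : ℝ) * disagreement m) + n * K := by linarith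
  calc _ ≤ (1 / (n : ℝ)) * (∑ i, klDiv mustar (m i) + c * ∑ i, ∑ s, (v i s - vstar s) ^ 2 -
      n * (β * (lam + M.drift (meanMu m) vstar - ∑ s, ∑ a, meanMu m s a * M.reward s a)) +
      β * (√(n : ℝ) * disagreement m) + n * K) :=
        mul_le_mul_of_nonneg_left htot (by positivity)
    _ = _ := by
        rw [← hc]
        clear_value c K
        field_simp

end Potential

/-! ### Random variables with finitely many values -/

section FiniteRange

variable {Ω E : Type*}

lemma finite_range_of_factor {F : Type*} {f : Ω → E} {g : Ω → F} (hg : (Set.range g).Finite)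
    (h : ∀ ω ω', g ω = g ω' → f ω = f ω') : (Set.range f).Finite := by
  classical
  rcases isEmpty_or_nonempty Ω with hΩ | hΩ
  · simp [Set.range_eq_empty]
  choose! k hk using fun y (hy : y ∈ Set.range g) => hy
  refine (hg.image fun y => f (k y)).subset ?_
  rintro _ ⟨ω, rfl⟩
  exact ⟨g ω, ⟨ω, rfl⟩, h _ _ (hk (g ω) ⟨ω, rfl⟩)⟩

/-- Preimages reduce to finite sets of values, so g is arbitrary and no measurability of divergences
or logarithms has to be checked. -/
lemma measurable_comp_of_finite_range {F : Type*} {m : MeasurableSpace Ω} [MeasurableSpace E]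
    [MeasurableSingletonClass E] [MeasurableSpace F] {f : Ω → E} (hf : Measurable f)
    (hfin : (Set.range f).Finite) (g : E → F) : Measurable fun ω => g (f ω) := by
  intro s _
  have : (fun ω => g (f ω)) ⁻¹' s = f ⁻¹' (Set.range f ∩ g ⁻¹' s) := by
    ext ω
    simp
  rw [this]
  exact hf (hfin.subset Set.inter_subset_left).measurableSet

lemma exists_bound_of_finite_range {f : Ω → E} (hfin : (Set.range f).Finite) (g : E → ℝ) :
    ∃ C, ∀ ω, ‖g (f ω)‖ ≤ C := by
  obtain ⟨C, hC⟩ := (hfin.image fun y => ‖g y‖).bddAbove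
  exact ⟨C, fun ω => hC ⟨f ω, ⟨ω, rfl⟩, rfl⟩⟩

lemma integrable_comp_of_finite_range {m mΩ : MeasurableSpace Ω} {P : Measure Ω}
    [IsProbabilityMeasure P] (hm : m ≤ mΩ) [MeasurableSpace E]
    [MeasurableSingletonClass E] {f : Ω → E} (hf : Measurable[m] f)
    (hfin : (Set.range f).Finite) (g : E → ℝ) : Integrable (fun ω => g (f ω)) P := by
  obtain ⟨C, hC⟩ := exists_bound_of_finite_range hfin g
  exact Integrable.of_bound
    ((measurable_comp_of_finite_range (m := m) hf hfin g).mono hm le_rfl).aestronglyMeasurable C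
    (Eventually.of_forall hC)

end FiniteRange

/-! ### Runs of the algorithm -/

section Run

variable {n : ℕ} {S A : Type*} [Fintype S] [Fintype A] {M : MAMDP n S A} {η τ tmix α β lam : ℝ}
  {W : ℕ → Matrix (Fin n) (Fin n) ℝ} {ζ : S → A → ℝ} {Ω : Type*} [mΩ : MeasurableSpace Ω]
  {P : Measure Ω} {ℱ : Filtration ℕ mΩ} {μ : ℕ → Fin n → Ω → S → A → ℝ}
  {v : ℕ → Fin n → Ω → S → ℝ} {X : ℕ → Fin n → Ω → S × A × S}

/-- The joint state of all agents. -/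
def jointState (μ : ℕ → Fin n → Ω → S → A → ℝ) (v : ℕ → Fin n → Ω → S → ℝ) (t : ℕ) (ω : Ω) :
    (Fin n → S → A → ℝ) × (Fin n → S → ℝ) := (fun i => μ t i ω, fun i => v t i ω)

lemma IsRun.mu_mem (h : IsRun M W τ tmix α β ζ P ℱ μ v X) (hζ : ζ ∈ occupancySet S A τ) (t : ℕ)
    (i : Fin n) (ω : Ω) : μ t i ω ∈ occupancySet S A τ := by
  cases t with
  | zero => rwa [h.init_mu]
  | succ t => exact (h.mu_step t i ω).1

/-- The initial point ζ serves at every step as the positive competitor required by `IsKLProj.pos`.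
-/
lemma IsRun.mu_pos [Nonempty S] [Nonempty A] (h : IsRun M W τ tmix α β ζ P ℱ μ v X)
    (hW : ∀ t, IsWeight η (W t)) (hζ : ζ ∈ occupancySet S A τ) (hζ0 : ∀ s a, 0 < ζ s a) (t : ℕ)
    (ω : Ω) (i : Fin n) (s : S) (a : A) : 0 < μ t i ω s a := by
  induction t generalizing i s a with
  | zero =>
    rw [h.init_mu]
    exact hζ0 s a
  | succ t ih =>
    exact (h.mu_step t i ω).pos
      (expUpdate_pos (mixMu_pos (hW t).nonneg (hW t).row_sum ih i) _) hζ hζ0 s a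

lemma IsRun.v_mem (h : IsRun M W τ tmix α β ζ P ℱ μ v X) (ht : 0 ≤ tmix) (t : ℕ) (i : Fin n)
    (ω : Ω) : v t i ω ∈ valueSet S tmix := by
  cases t with
  | zero =>
    rw [h.init_v]
    intro s
    simpa using ht
  | succ t => exact (h.v_step t i ω).1

/-- Both projections are unique, so the next state is a function of the present one and of finitely
many possible samples. -/
lemma IsRun.finite_range [Nonempty S] [Nonempty A] (h : IsRun M W τ tmix α β ζ P ℱ μ v X)
    (hW : ∀ t, IsWeight η (W t)) (hζ : ζ ∈ occupancySet S A τ) (hζ0 : ∀ s a, 0 < ζ s a) (t : ℕ) :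
    (Set.range (jointState μ v t)).Finite := by
  induction t with
  | zero =>
    refine (Set.finite_singleton ((fun _ => ζ, fun _ => 0) :
      (Fin n → S → A → ℝ) × (Fin n → S → ℝ))).subset ?_
    rintro _ ⟨ω, rfl⟩
    simp [jointState, h.init_mu, h.init_v]
  | succ t ih =>
    refine finite_range_of_factor (g := fun ω => (jointState μ v t ω, fun i => X t i ω))
      ((ih.prod (Set.finite_univ (α := Fin n → S × A × S))).subset ?_) ?_
    · rintro _ ⟨ω, rfl⟩
      exact ⟨⟨ω, rfl⟩, Set.mem_univ _⟩
    · intro ω ω' hω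
      simp only [Prod.mk.injEq, jointState] at hω
      obtain ⟨⟨hμ, hv⟩, hX⟩ := hω
      have hX' : ∀ i, X t i ω = X t i ω' := fun i => congrFun hX i
      have hv' : ∀ i, v t i ω = v t i ω' := fun i => congrFun hv i
      have hμ' : ∀ i, μ t i ω = μ t i ω' := fun i => congrFun hμ i
      simp only [jointState, Prod.mk.injEq]
      constructor
      · funext i
        have h1 := h.mu_step t i ω
        have h2 := h.mu_step t i ω'
        rw [← hX', ← hv', ← hμ] at h2
        refine IsKLProj.unique h2 h1 (expUpdate_pos (mixMu_pos (hW t).nonneg (hW t).row_sum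
          (h.mu_pos hW hζ hζ0 t ω) i) _) (h.mu_pos hW hζ hζ0 (t + 1) ω' i)
      · funext i
        have h1 := h.v_step t i ω
        have h2 := h.v_step t i ω'
        rw [← hX', ← hv, ← hμ', ← hμ] at h2
        exact IsEuclideanProj.unique h2 h1

lemma IsRun.measurable_jointState (h : IsRun M W τ tmix α β ζ P ℱ μ v X) (t : ℕ) :
    Measurable[ℱ t] (jointState μ v t) := by
  have h1 : Measurable[ℱ t] fun ω i => μ t i ω :=
    @measurable_pi_lambda _ _ _ (ℱ t) _ _ fun i => @measurable_pi_lambda _ _ _ (ℱ t) _ _ fun s =>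
      @measurable_pi_lambda _ _ _ (ℱ t) _ _ fun a => h.adapted_mu t i s a
  have h2 : Measurable[ℱ t] fun ω i => v t i ω :=
    @measurable_pi_lambda _ _ _ (ℱ t) _ _ fun i => @measurable_pi_lambda _ _ _ (ℱ t) _ _ fun s =>
      h.adapted_v t i s
  exact h1.prodMk h2

variable [IsProbabilityMeasure P]

lemma IsRun.integrable_state [Nonempty S] [Nonempty A] (h : IsRun M W τ tmix α β ζ P ℱ μ v X)
    (hW : ∀ t, IsWeight η (W t)) (hζ : ζ ∈ occupancySet S A τ) (hζ0 : ∀ s a, 0 < ζ s a) (t : ℕ)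
    (F : (Fin n → S → A → ℝ) × (Fin n → S → ℝ) → ℝ) :
    Integrable (fun ω => F (jointState μ v t ω)) P :=
  integrable_comp_of_finite_range (ℱ.le t) (h.measurable_jointState t)
    (h.finite_range hW hζ hζ0 t) F

lemma integral_sub_add_add {f g d : Ω → ℝ} (hf : Integrable f P) (hg : Integrable g P)
    (hd : Integrable d P) (b c k : ℝ) :
    ∫ ω, (f ω - b * g ω + b * (c * d ω) + k) ∂P =
      ∫ ω, f ω ∂P - b * ∫ ω, g ω ∂P + b * (c * ∫ ω, d ω ∂P) + k := by
  have h1 : Integrable (fun ω => f ω - b * g ω) P := hf.sub (hg.const_mul b)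
  have h2 : Integrable (fun ω => b * (c * d ω)) P := (hd.const_mul c).const_mul b
  have h3 : Integrable (fun ω => f ω - b * g ω + b * (c * d ω)) P := h1.add h2
  rw [integral_add h3 (integrable_const k), integral_add h1 h2, integral_sub hf (hg.const_mul b),
    integral_const_mul, integral_const_mul, integral_const_mul]
  simp

lemma integral_indicator_mul {m : MeasurableSpace Ω} (hm : m ≤ mΩ) {s : Set Ω}
    (hs : MeasurableSet[mΩ] s) {g q : Ω → ℝ} (hg : StronglyMeasurable[m] g) {C : ℝ}
    (hC : ∀ ω, ‖g ω‖ ≤ C) (hq : P[s.indicator fun _ => (1 : ℝ) | m] =ᵐ[P] q) :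
    Integrable (fun ω => g ω * s.indicator (fun _ => (1 : ℝ)) ω) P ∧
      ∫ ω, g ω * s.indicator (fun _ => (1 : ℝ)) ω ∂P = ∫ ω, g ω * q ω ∂P := by
  have hi : Integrable (s.indicator fun _ => (1 : ℝ)) P := (integrable_const 1).indicator hs
  refine ⟨hi.bdd_mul (hg.mono hm).aestronglyMeasurable (Eventually.of_forall hC), ?_⟩
  have h1 := condExp_stronglyMeasurable_mul_of_bound hm hg hi C (Eventually.of_forall hC)
  calc ∫ ω, g ω * s.indicator (fun _ => (1 : ℝ)) ω ∂P
      = ∫ ω, (P[g * s.indicator fun _ => (1 : ℝ) | m]) ω ∂P := (integral_condExp hm).symm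
    _ = ∫ ω, g ω * q ω ∂P := integral_congr_ae (by
        filter_upwards [h1, hq] with ω h2 h3
        rw [h2, Pi.mul_apply, h3])

/-- Averaging over the current sample. -/
lemma IsRun.integral_sample [Nonempty S] [Nonempty A] (h : IsRun M W τ tmix α β ζ P ℱ μ v X)
    (hW : ∀ t, IsWeight η (W t)) (hζ : ζ ∈ occupancySet S A τ) (hζ0 : ∀ s a, 0 < ζ s a) (t : ℕ)
    (i : Fin n) (F : (Fin n → S → A → ℝ) × (Fin n → S → ℝ) → S × A × S → ℝ) :
    Integrable (fun ω => F (jointState μ v t ω) (X t i ω)) P ∧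
      ∫ ω, F (jointState μ v t ω) (X t i ω) ∂P =
        ∫ ω, M.expect (mixMu (W t) (jointState μ v t ω).1 i) (F (jointState μ v t ω)) ∂P := by
  classical
  have hx : ∀ s a s', Integrable (fun ω => F (jointState μ v t ω) (s, a, s') *
        Set.indicator {ω | X t i ω = (s, a, s')} (fun _ => (1 : ℝ)) ω) P ∧
      ∫ ω, F (jointState μ v t ω) (s, a, s') *
        Set.indicator {ω | X t i ω = (s, a, s')} (fun _ => (1 : ℝ)) ω ∂P =
      ∫ ω, F (jointState μ v t ω) (s, a, s') *
        (mixMu (W t) (fun j => μ t j ω) i s a * M.p s a s') ∂P := by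
    intro s a s'
    obtain ⟨C, hC⟩ := exists_bound_of_finite_range (h.finite_range hW hζ hζ0 t)
      fun y => F y (s, a, s')
    exact integral_indicator_mul (ℱ.le t) (ℱ.le (t + 1) _ (h.adapted_sample t i (s, a, s')))
      (measurable_comp_of_finite_range (m := ℱ t) (h.measurable_jointState t)
        (h.finite_range hW hζ hζ0 t) fun y => F y (s, a, s')).stronglyMeasurable hC
      (h.sample_law t i s a s')
  -- Split by the value of the sample, so that the conditional law applies to each indicator
  -- separately.
  have hsplit : (fun ω => F (jointState μ v t ω) (X t i ω)) = fun ω =>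
      ∑ s, ∑ a, ∑ s', F (jointState μ v t ω) (s, a, s') *
        Set.indicator {ω | X t i ω = (s, a, s')} (fun _ => (1 : ℝ)) ω := by
    funext ω
    have : ∀ x, F (jointState μ v t ω) x * Set.indicator {ω | X t i ω = x} (fun _ => (1 : ℝ)) ω =
        if x = X t i ω then F (jointState μ v t ω) x else 0 := fun x => by
      by_cases hxx : X t i ω = x
      · simp [Set.indicator, hxx]
      · simp [Set.indicator, hxx, Ne.symm hxx]
    rw [← Fintype.sum_ite_eq' (X t i ω) (F (jointState μ v t ω))]
    simp only [this, Fintype.sum_prod_type]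
  have hint2 : ∀ s a s', Integrable (fun ω => F (jointState μ v t ω) (s, a, s') *
      (mixMu (W t) (fun j => μ t j ω) i s a * M.p s a s')) P := fun s a s' =>
    h.integrable_state hW hζ hζ0 t fun y => F y (s, a, s') * (mixMu (W t) y.1 i s a * M.p s a s')
  constructor
  · rw [hsplit]
    exact integrable_finsetSum _ fun s _ => integrable_finsetSum _ fun a _ =>
      integrable_finsetSum _ fun s' _ => (hx s a s').1
  · rw [hsplit]
    have hR : ∀ ω, M.expect (mixMu (W t) (jointState μ v t ω).1 i) (F (jointState μ v t ω)) =
        ∑ s, ∑ a, ∑ s', F (jointState μ v t ω) (s, a, s') *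
          (mixMu (W t) (fun j => μ t j ω) i s a * M.p s a s') := fun ω => by
      unfold MAMDP.expect
      exact Finset.sum_congr rfl fun s _ => Finset.sum_congr rfl fun a _ =>
        Finset.sum_congr rfl fun s' _ => mul_comm _ _
    simp only [hR]
    rw [integral_finsetSum _ fun s _ => integrable_finsetSum _ fun a _ =>
        integrable_finsetSum _ fun s' _ => (hx s a s').1,
      integral_finsetSum _ fun s _ => integrable_finsetSum _ fun a _ =>
        integrable_finsetSum _ fun s' _ => hint2 s a s']
    refine Finset.sum_congr rfl fun s _ => ?_
    rw [integral_finsetSum _ fun a _ => integrable_finsetSum _ fun s' _ => (hx s a s').1,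
      integral_finsetSum _ fun a _ => integrable_finsetSum _ fun s' _ => hint2 s a s']
    refine Finset.sum_congr rfl fun a _ => ?_
    rw [integral_finsetSum _ fun s' _ => (hx s a s').1,
      integral_finsetSum _ fun s' _ => hint2 s a s']
    exact Finset.sum_congr rfl fun s' _ => (hx s a s').2

/-- Expected decrease of the potential along a run. -/
lemma IsRun.integral_potential_le [Nonempty S] [Nonempty A]
    (h : IsRun M W τ tmix α β ζ P ℱ μ v X) (hW : ∀ t, IsWeight η (W t))
    (hζ : ζ ∈ occupancySet S A τ) (hζ0 : ∀ s a, 0 < ζ s a) (hη : 0 < η)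
    (hn : 0 < n) (ht : 1 ≤ tmix) (hβ : 0 ≤ β) (hα : α = (Fintype.card S : ℝ) * tmix ^ 2 * β)
    {vstar : S → ℝ} {mustar : S → A → ℝ} (hopt : M.IsOptimal lam vstar mustar)
    (hmu : mustar ∈ occupancySet S A τ) (hvs : vstar ∈ valueSet S tmix) (t : ℕ) :
    ∫ ω, potential tmix vstar mustar (fun i => μ (t + 1) i ω) (fun i => v (t + 1) i ω) ∂P ≤
      ∫ ω, potential tmix vstar mustar (fun i => μ t i ω) (fun i => v t i ω) ∂P -
      β * ∫ ω, M.gap lam vstar (meanMu fun i => μ t i ω) ∂P +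
      β * (√(n : ℝ) / n * ∫ ω, disagreement (fun i => μ t i ω) ∂P) +
      β ^ 2 * (2 * (Fintype.card S * Fintype.card A) * (4 * tmix + 1) ^ 2 +
        Fintype.card S * tmix ^ 2 / η) := by
  set c := 1 / (2 * (Fintype.card S : ℝ) * tmix ^ 2) with hc
  have hc0 : 0 ≤ c := by positivity
  let G : Fin n → (Fin n → S → A → ℝ) × (Fin n → S → ℝ) → S × A × S → ℝ := fun i y x =>
    M.dualBound tmix β i mustar (mixMu (W t) y.1 i) (y.2 i) x +
      c * primalBound α (y.1 i) (mixMu (W t) y.1 i) (mixV (W t) y.2 i) vstar x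
  have hG := fun i => h.integral_sample hW hζ hζ0 t i (G i)
  have hI := h.integrable_state (P := P) hW hζ hζ0
  have hstep : ∀ ω, potential tmix vstar mustar (fun i => μ (t + 1) i ω) (fun i => v (t + 1) i ω) ≤
      (1 / (n : ℝ)) * ∑ i, G i (jointState μ v t ω) (X t i ω) := by
    intro ω
    refine mul_le_mul_of_nonneg_left (Finset.sum_le_sum fun i _ => add_le_add ?_ ?_) (by positivity)
    · exact klDiv_dual_step hβ
        (mixMu_pos (hW t).nonneg (hW t).row_sum (h.mu_pos hW hζ hζ0 t ω) i)
        (mixMu_mem (hW t).nonneg (hW t).row_sum (fun j => h.mu_mem hζ t j ω) i).2.1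
        (h.v_mem (by linarith) t i ω) (h.mu_step t i ω) (h.mu_pos hW hζ hζ0 (t + 1) ω i) hmu
    · exact mul_le_mul_of_nonneg_left ((h.v_step t i ω).sum_sq_le hvs) hc0
  have hexp : ∀ (m : S → A → ℝ) (g g' : S × A × S → ℝ),
      M.expect m (fun x => g x + c * g' x) = M.expect m g + c * M.expect m g' := by
    intro m g g'
    simp only [MAMDP.expect, Finset.mul_sum, ← Finset.sum_add_distrib]
    exact Finset.sum_congr rfl fun s _ => Finset.sum_congr rfl fun a _ =>
      Finset.sum_congr rfl fun s' _ => by ring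
  calc _ ≤ ∫ ω, (1 / (n : ℝ)) * ∑ i, G i (jointState μ v t ω) (X t i ω) ∂P :=
        integral_mono (hI (t + 1) fun y => potential tmix vstar mustar y.1 y.2)
          ((integrable_finsetSum _ fun i _ => (hG i).1).const_mul _) hstep
    _ = ∫ ω, (1 / (n : ℝ)) * ∑ i, M.expect (mixMu (W t) (jointState μ v t ω).1 i)
          (G i (jointState μ v t ω)) ∂P := by
        rw [integral_const_mul, integral_const_mul, integral_finsetSum _ fun i _ => (hG i).1,
          integral_finsetSum _ fun i _ => hI t fun y => M.expect (mixMu (W t) y.1 i) (G i y)]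
        simp only [(hG _).2]
    _ ≤ ∫ ω, (potential tmix vstar mustar (fun i => μ t i ω) (fun i => v t i ω) -
          β * M.gap lam vstar (meanMu fun i => μ t i ω) +
          β * (√(n : ℝ) / n * disagreement fun i => μ t i ω) +
          β ^ 2 * (2 * (Fintype.card S * Fintype.card A) * (4 * tmix + 1) ^ 2 +
            Fintype.card S * tmix ^ 2 / η)) ∂P := by
        refine integral_mono (hI t fun y => (1 / (n : ℝ)) * ∑ i, M.expect (mixMu (W t) y.1 i) (G i y))
          (hI t fun y => potential tmix vstar mustar y.1 y.2 - β * M.gap lam vstar (meanMu y.1) +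
            β * (√(n : ℝ) / n * disagreement y.1) +
            β ^ 2 * (2 * (Fintype.card S * Fintype.card A) * (4 * tmix + 1) ^ 2 +
              Fintype.card S * tmix ^ 2 / η)) fun ω => ?_
        simp only [G, hexp]
        exact expected_potential_le (hW t) hη hn ht hβ hα hopt (h.mu_pos hW hζ hζ0 t ω)
          (fun i => h.mu_mem hζ t i ω) (fun i => h.v_mem (by linarith) t i ω)
    _ = _ := integral_sub_add_add (hI t fun y => potential tmix vstar mustar y.1 y.2)
        (hI t fun y => M.gap lam vstar (meanMu y.1)) (hI t fun y => disagreement y.1) _ _ _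

/-- Total disagreement after a window of the network. -/
lemma disagreement_le {m e : ℕ → Fin n → S → A → ℝ} {c : ℝ} {k : ℕ}
    (hd : ∀ s a, disp (fun i => m k i s a) ≤
      c * disp (fun i => m 0 i s a) + ∑ l ∈ Finset.range k, disp fun i => e l i s a) (hn : 0 < n) :
    disagreement (m k) ≤ c * disagreement (m 0) +
      ∑ l ∈ Finset.range k, ∑ i, ∑ s, ∑ a, |e l i s a| := by
  have h1 : ∀ s a, disp (fun i => m k i s a) ≤
      c * disp (fun i => m 0 i s a) + ∑ l ∈ Finset.range k, ∑ i, |e l i s a| := fun s a =>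
    (hd s a).trans (add_le_add le_rfl (Finset.sum_le_sum fun l _ => disp_le_sum_abs hn _))
  refine (Finset.sum_le_sum fun s _ => Finset.sum_le_sum fun a _ => h1 s a).trans (le_of_eq ?_)
  simp only [Finset.sum_add_distrib, ← Finset.mul_sum]
  congr 1
  have h2 : ∀ l, ∑ i, ∑ s, ∑ a, |e l i s a| = ∑ s, ∑ a, ∑ i, |e l i s a| := fun l => by
    rw [Finset.sum_comm]
    exact Finset.sum_congr rfl fun s _ => Finset.sum_comm
  simp only [h2]
  rw [Finset.sum_comm (s := Finset.range k)]
  exact Finset.sum_congr rfl fun s _ => Finset.sum_comm.symm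

/-- Expected disagreement along a run. -/
lemma IsRun.integral_disagreement_le [Nonempty S] [Nonempty A] {G : ℕ → SimpleGraph (Fin n)} {B : ℕ}
    (h : IsRun M W τ tmix α β ζ P ℱ μ v X) (hnet : IsMixingNetwork G W η B)
    (hζ : ζ ∈ occupancySet S A τ) (hζ0 : ∀ s a, 0 < ζ s a)
    (hn : 0 < n) (ht : 1 ≤ tmix) (hβ : 0 ≤ β) (t : ℕ) :
    ∫ ω, disagreement (fun i => μ t i ω) ∂P ≤
      B * (n * (4 * β * (4 * tmix + 1) * (Fintype.card S * Fintype.card A))) *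
        (2 * (n : ℝ) ^ 2 / η) := by
  have hW := hnet.isWeight
  have hη := hnet.η_pos
  set q : ℝ := n * (4 * β * (4 * tmix + 1) * (Fintype.card S * Fintype.card A)) with hq
  set y := η / (2 * (n : ℝ) ^ 2) with hy
  have hn1 : (1 : ℝ) ≤ (n : ℝ) ^ 2 := one_le_pow₀ (by exact_mod_cast hn)
  have hy0 : 0 < y := by positivity
  have hy1 : y ≤ 1 := by
    rw [hy, div_le_one (by positivity)]
    linarith [hnet.η_lt_one]
  have hq0 : 0 ≤ q := by positivity
  have hinv : 2 * (n : ℝ) ^ 2 / η = y⁻¹ := by rw [hy, inv_div]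
  -- Twice the largest possible exponent, summed over agents: this bounds the ℓ¹ perturbation at
  -- time l. Its mean q does not depend on how small μ̃ is.
  let Q : ℕ → Ω → ℝ := fun l ω => ∑ i, 4 * β * (4 * tmix + 1) /
    mixMu (W l) (fun j => μ l j ω) i (X l i ω).1 (X l i ω).2.1
  have hQ : ∀ l, Integrable (Q l) P ∧ ∫ ω, Q l ω ∂P = q := by
    intro l
    have h1 := fun i => h.integral_sample hW hζ hζ0 l i fun y x =>
      4 * β * (4 * tmix + 1) / mixMu (W l) y.1 i x.1 x.2.1
    refine ⟨integrable_finsetSum _ fun i _ => (h1 i).1, ?_⟩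
    have h2 : ∀ i, ∫ ω, 4 * β * (4 * tmix + 1) /
        mixMu (W l) (fun j => μ l j ω) i (X l i ω).1 (X l i ω).2.1 ∂P =
        4 * β * (4 * tmix + 1) * (Fintype.card S * Fintype.card A) := by
      intro i
      refine (h1 i).2.trans ?_
      have h3 : ∀ ω, M.expect (mixMu (W l) (jointState μ v l ω).1 i) (fun x =>
          4 * β * (4 * tmix + 1) / mixMu (W l) (jointState μ v l ω).1 i x.1 x.2.1) =
          4 * β * (4 * tmix + 1) * (Fintype.card S * Fintype.card A) := fun ω =>
        M.expect_inv (mixMu_pos (hW l).nonneg (hW l).row_sum (h.mu_pos hW hζ hζ0 l ω) i) _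
      simp only [h3]
      simp
    refine (integral_finsetSum _ fun i _ => (h1 i).1).trans ?_
    refine (Finset.sum_congr rfl fun i _ => h2 i).trans ?_
    simp [hq]
  let e : Ω → ℕ → Fin n → S → A → ℝ := fun ω l i s a =>
    μ (l + 1) i ω s a - mixMu (W l) (fun j => μ l j ω) i s a
  have he : ∀ ω l, ∑ i, ∑ s, ∑ a, |e ω l i s a| ≤ Q l ω := by
    intro ω l
    refine Finset.sum_le_sum fun i _ => ?_
    have hmt := mixMu_pos (hW l).nonneg (hW l).row_sum (h.mu_pos hW hζ hζ0 l ω) i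
    refine (l1_step_le hmt (mixMu_mem (hW l).nonneg (hW l).row_sum (fun j => h.mu_mem hζ l j ω) i)
      (fun s a => M.abs_dualGrad_le hβ hmt (h.v_mem (by linarith) l i ω) i (X l i ω) s a)
      (h.mu_step l i ω) (h.mu_pos hW hζ hζ0 (l + 1) ω i)).trans (le_of_eq ?_)
    ring
  have hrec : ∀ ω t s a, (fun i => μ (t + 1) i ω s a) =
      (W t).mulVec (fun i => μ t i ω s a) + fun i => e ω t i s a := by
    intro ω t s a
    funext i
    have : (W t).mulVec (fun i => μ t i ω s a) i = mixMu (W t) (fun j => μ t j ω) i s a := rfl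
    simp only [Pi.add_apply, this, e]
    ring
  have hI := h.integrable_state (P := P) hW hζ hζ0
  have hN : ∀ t, Integrable (fun ω => disagreement fun i => μ t i ω) P := fun t =>
    hI t fun y => disagreement y.1
  -- Before a full window is available: the agents start in agreement, so the disagreement is at
  -- most the accumulated perturbation.
  have hstart : ∀ k, ∫ ω, disagreement (fun i => μ k i ω) ∂P ≤ k * q := by
    intro k
    have h1 : ∀ ω, disagreement (fun i => μ k i ω) ≤ ∑ l ∈ Finset.range k, Q l ω := by
      intro ω
      have h0 : disagreement (fun i => μ 0 i ω) = 0 := by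
        refine Finset.sum_eq_zero fun s _ => Finset.sum_eq_zero fun a _ => ?_
        have hn' : (n : ℝ) ≠ 0 := by positivity
        have h1 : mean (fun _ : Fin n => ζ s a) = ζ s a := by simp [mean, hn']
        simp only [h.init_mu, disp, h1, sub_self]
        exact norm_zero
      have h2 := disagreement_le (m := fun k i => μ k i ω) (e := e ω) (c := 1) (k := k)
        (fun s a => by
          let z : ℕ → Fin n → ℝ := fun k => Nat.rec (fun i => μ 0 i ω s a)
            (fun l y => (W l).mulVec y) k
          have h3 := disp_perturbed_le hn hW (x := fun t i => μ t i ω s a)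
            (e := fun t i => e ω t i s a) (z := z) (fun t => hrec ω t s a) rfl (fun _ => rfl) k
          have h4 : ∀ k, disp (z k) ≤ disp fun i => μ 0 i ω s a := fun k => by
            induction k with
            | zero => exact le_rfl
            | succ k ih => exact ((hW k).disp_mulVec_le hn _).trans ih
          have h5 := disp_add_le (z k) ((fun i => μ k i ω s a) - z k)
          rw [add_sub_cancel] at h5
          linarith [h4 k]) hn
      simp only [h0, mul_zero, zero_add] at h2
      exact h2.trans (Finset.sum_le_sum fun l _ => he ω l)
    calc _ ≤ ∫ ω, ∑ l ∈ Finset.range k, Q l ω ∂P :=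
          integral_mono (hN k) (integrable_finsetSum _ fun l _ => (hQ l).1) h1
      _ = k * q := by
          rw [integral_finsetSum _ fun l _ => (hQ l).1]
          simp [(hQ _).2]
  have hwindow : ∀ t, ∫ ω, disagreement (fun i => μ (t + B) i ω) ∂P ≤
      (1 - y) * ∫ ω, disagreement (fun i => μ t i ω) ∂P + B * q := by
    intro t
    have h1 : ∀ ω, disagreement (fun i => μ (t + B) i ω) ≤
        (1 - y) * disagreement (fun i => μ t i ω) + ∑ l ∈ Finset.range B, Q (t + l) ω := by
      intro ω
      have h2 := disagreement_le (m := fun k i => μ (t + k) i ω) (e := fun l => e ω (t + l))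
        (c := 1 - y) (k := B) (fun s a =>
          disp_perturbed_window_le hn hη hnet.η_lt_one.le (W := fun l => W (t + l))
            (fun l => hW (t + l)) (hnet.exists_crossing t) (x := fun k i => μ (t + k) i ω s a)
            (e := fun k i => e ω (t + k) i s a) (fun k => hrec ω (t + k) s a)) hn
      exact h2.trans (add_le_add le_rfl (Finset.sum_le_sum fun l _ => he ω (t + l)))
    calc _ ≤ ∫ ω, ((1 - y) * disagreement (fun i => μ t i ω) +
            ∑ l ∈ Finset.range B, Q (t + l) ω) ∂P :=
          integral_mono (hN (t + B)) (((hN t).const_mul _).add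
            (integrable_finsetSum _ fun l _ => (hQ (t + l)).1)) h1
      _ = _ := by
          rw [integral_add ((hN t).const_mul _)
              (integrable_finsetSum _ fun l _ => (hQ (t + l)).1), integral_const_mul,
            integral_finsetSum _ fun l _ => (hQ (t + l)).1]
          simp [(hQ _).2]
  rw [hinv]
  -- The claimed bound is the fixed point of x ↦ (1 − y)x + Bq, so it propagates in steps of B.
  have hBq : (B : ℝ) * q * y⁻¹ = (1 - y) * (B * q * y⁻¹) + B * q := by
    field_simp
    ring
  induction t using Nat.strong_induction_on with
  | _ t ih =>
    rcases lt_or_ge t B with hlt | hge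
    · refine (hstart t).trans ?_
      have h1 : (t : ℝ) ≤ B := by exact_mod_cast hlt.le
      have h2 : 1 ≤ y⁻¹ := (one_le_inv₀ hy0).2 hy1
      calc (t : ℝ) * q ≤ B * q := mul_le_mul_of_nonneg_right h1 hq0
        _ ≤ _ := le_mul_of_one_le_right (by positivity) h2
    · obtain ⟨k, rfl⟩ := Nat.exists_eq_add_of_le' hge
      have hB := hnet.B_pos
      rw [hBq]
      exact (hwindow k).trans (add_le_add
        (mul_le_mul_of_nonneg_left (ih k (by omega)) (by linarith)) le_rfl)

end Run

/-! ### The convergence rate -/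

section Rate

variable {n : ℕ} {S A : Type*} [Fintype S] [Fintype A] {M : MAMDP n S A} {η τ tmix α β lam : ℝ}
  {W : ℕ → Matrix (Fin n) (Fin n) ℝ} {ζ : S → A → ℝ} {Ω : Type*} [mΩ : MeasurableSpace Ω]
  {P : Measure Ω} {ℱ : Filtration ℕ mΩ} {μ : ℕ → Fin n → Ω → S → A → ℝ}
  {v : ℕ → Fin n → Ω → S → ℝ} {X : ℕ → Fin n → Ω → S × A × S} {vstar : S → ℝ}
  {mustar : S → A → ℝ}

/-- The Lyapunov function averages the value vectors before measuring, the potential afterwards; at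
a common starting point they agree. -/
lemma lyapunov_eq_potential {S A : Type*} [Fintype S] [Fintype A] (hn : 0 < n) (tmix : ℝ)
    (vstar : S → ℝ) (mustar ζ : S → A → ℝ) :
    lyapunov (n := n) tmix vstar mustar (fun _ => ζ) (fun _ => 0) =
      potential (n := n) tmix vstar mustar (fun _ => ζ) (fun _ => 0) := by
  have : (n : ℝ) ≠ 0 := by positivity
  simp only [lyapunov, potential, Pi.zero_apply, Finset.sum_const, Finset.card_univ,
    Fintype.card_fin, nsmul_eq_mul, mul_zero]
  field_simp

lemma potential_const (hn : 0 < n) (tmix : ℝ) (vstar : S → ℝ) (mustar ζ : S → A → ℝ) :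
    potential (n := n) tmix vstar mustar (fun _ => ζ) (fun _ => 0) =
      klDiv mustar ζ + 1 / (2 * (Fintype.card S : ℝ) * tmix ^ 2) * ∑ s, vstar s ^ 2 := by
  have : (n : ℝ) ≠ 0 := by positivity
  simp only [potential, Pi.zero_apply, zero_sub, neg_sq, Finset.sum_const, Finset.card_univ,
    Fintype.card_fin, nsmul_eq_mul]
  rw [one_div, inv_mul_cancel_left₀ this]

lemma potential_nonneg {m : Fin n → S → A → ℝ} (hm : ∀ i s a, 0 < m i s a)
    (hm1 : ∀ i, ∑ s, ∑ a, m i s a = 1) (hu : ∀ s a, 0 ≤ mustar s a)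
    (hu1 : ∑ s, ∑ a, mustar s a = 1) (v : Fin n → S → ℝ) :
    0 ≤ potential tmix vstar mustar m v :=
  mul_nonneg (by positivity) (Finset.sum_nonneg fun i _ => add_nonneg
    (klDiv_nonneg hu (hm i) (hu1.trans (hm1 i).symm))
    (mul_nonneg (by positivity) (Finset.sum_nonneg fun s _ => sq_nonneg _)))

lemma MAMDP.gap_muHat {Ω : Type*} {μ : ℕ → Fin n → Ω → S → A → ℝ} (M : MAMDP n S A) (lam : ℝ)
    (x : S → ℝ) {T : ℕ} (hT : 0 < T) (ω : Ω) :
    M.gap lam x (muHat T μ ω) =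
      (1 / (T : ℝ)) * ∑ t ∈ Finset.range T, M.gap lam x (meanMu fun i => μ t i ω) := by
  have hT' : (T : ℝ) ≠ 0 := by positivity
  have h1 : ∀ s a, muHat T μ ω s a =
      (1 / (T : ℝ)) * ∑ t ∈ Finset.range T, meanMu (fun i => μ t i ω) s a := fun s a => rfl
  simp only [MAMDP.gap, h1, Finset.sum_add_distrib, mul_add, Finset.sum_const, Finset.card_range,
    nsmul_eq_mul]
  congr 1
  · field_simp
  · rw [Finset.sum_comm (s := Finset.range T), Finset.mul_sum]
    refine Finset.sum_congr rfl fun a _ => ?_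
    rw [Finset.sum_comm (s := Finset.range T), Finset.mul_sum]
    refine Finset.sum_congr rfl fun s _ => ?_
    rw [← Finset.mul_sum]
    ring

lemma MAMDP.IsOptimal.gap_mustar [Nonempty S] (h : M.IsOptimal lam vstar mustar) :
    M.gap lam vstar mustar = 0 := by
  rw [M.gap_eq, h.value_eq, MAMDP.drift, h.occupancy.feasible.sum_drift]
  ring

/-- With zero step size a run that starts at the optimum stays there. -/
lemma IsRun.eq_of_step_zero [Nonempty S] [Nonempty A]
    (h : IsRun M W τ tmix α 0 mustar P ℱ μ v X) (hW : ∀ t, IsWeight η (W t)) (ht : 0 ≤ tmix)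
    (hζ : mustar ∈ occupancySet S A τ) (hζ0 : ∀ s a, 0 < mustar s a) (t : ℕ) (i : Fin n) (ω : Ω) :
    μ t i ω = mustar := by
  induction t generalizing i with
  | zero => exact h.init_mu i ω
  | succ t ih =>
    have hpos := h.mu_pos hW hζ hζ0
    refine (eq_of_klDiv_nonpos hζ.1 (hpos (t + 1) ω i)
      (hζ.2.1.trans (h.mu_mem hζ (t + 1) i ω).2.1.symm) ?_).symm
    have hmt : mixMu (W t) (fun j => μ t j ω) i = mustar := by
      funext s a
      simp only [mixMu, ih, ← Finset.sum_mul, (hW t).row_sum, one_mul]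
    have h1 := klDiv_dual_step le_rfl (mixMu_pos (hW t).nonneg (hW t).row_sum (hpos t ω) i)
      (mixMu_mem (hW t).nonneg (hW t).row_sum (fun j => h.mu_mem hζ t j ω) i).2.1
      (h.v_mem ht t i ω) (h.mu_step t i ω) (hpos (t + 1) ω i) hζ
    rw [hmt] at h1
    simpa [MAMDP.dualBound, klDiv_self] using h1

variable [IsProbabilityMeasure P]

lemma IsRun.integrable_gap [Nonempty S] [Nonempty A] (h : IsRun M W τ tmix α β ζ P ℱ μ v X)
    (hW : ∀ t, IsWeight η (W t)) (hζ : ζ ∈ occupancySet S A τ) (hζ0 : ∀ s a, 0 < ζ s a)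
    {T : ℕ} (hT : 0 < T) :
    Integrable (fun ω => M.gap lam vstar (muHat T μ ω)) P ∧
      ∫ ω, M.gap lam vstar (muHat T μ ω) ∂P =
        (1 / (T : ℝ)) * ∑ t ∈ Finset.range T, ∫ ω, M.gap lam vstar (meanMu fun i => μ t i ω) ∂P := by
  have hI : ∀ t, Integrable (fun ω => M.gap lam vstar (meanMu fun i => μ t i ω)) P := fun t =>
    h.integrable_state hW hζ hζ0 t fun y => M.gap lam vstar (meanMu y.1)
  simp only [M.gap_muHat lam vstar hT]
  refine ⟨(integrable_finsetSum _ fun t _ => hI t).const_mul _, ?_⟩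
  rw [integral_const_mul, integral_finsetSum _ fun t _ => hI t]

/-- Telescope the potential and discard its nonnegative final value. Of the constant 3, disagreement
accounts for 2 and the second moments for 1. -/
lemma IsRun.sum_integral_gap_le [Nonempty S] [Nonempty A] {G : ℕ → SimpleGraph (Fin n)} {B : ℕ}
    (h : IsRun M W τ tmix α β ζ P ℱ μ v X) (hnet : IsMixingNetwork G W η B)
    (hζ : ζ ∈ occupancySet S A τ) (hζ0 : ∀ s a, 0 < ζ s a)
    (hn : 0 < n) (ht : 1 ≤ tmix) (hβ : 0 ≤ β) (hα : α = (Fintype.card S : ℝ) * tmix ^ 2 * β)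
    (hopt : M.IsOptimal lam vstar mustar)
    (hmu : mustar ∈ occupancySet S A τ) (hvs : vstar ∈ valueSet S tmix) (T : ℕ) :
    β * ∑ t ∈ Finset.range T, ∫ ω, M.gap lam vstar (meanMu fun i => μ t i ω) ∂P ≤
      lyapunov (n := n) tmix vstar mustar (fun _ => ζ) (fun _ => 0) +
      T * (β ^ 2 * (3 * (√(n : ℝ) * (Fintype.card S : ℝ) * (Fintype.card A : ℝ) *
        (1 + 4 * tmix) ^ 2 * netD n η B))) := by
  have hW := hnet.isWeight
  have hη := hnet.η_pos
  set L := (Fintype.card S : ℝ) * (Fintype.card A : ℝ) with hL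
  set D := netD n η B with hD
  set R := √(n : ℝ) with hR
  have hcS : (1 : ℝ) ≤ Fintype.card S := by exact_mod_cast Fintype.card_pos
  have hcA : (1 : ℝ) ≤ Fintype.card A := by exact_mod_cast Fintype.card_pos
  have hSL : (Fintype.card S : ℝ) ≤ L := le_mul_of_one_le_right (by linarith) hcA
  have hL1 : 1 ≤ L := hcS.trans hSL
  have hn1 : (1 : ℝ) ≤ n := by exact_mod_cast hn
  have hR1 : 1 ≤ R := Real.one_le_sqrt.2 hn1
  have hB1 : (1 : ℝ) ≤ B := by exact_mod_cast hnet.B_pos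
  have hDge : 4 * ((n : ℝ) ^ 2 * B / η) ≤ D := by
    have := netD_ge hn hη hnet.η_lt_one hnet.B_pos
    calc _ = 4 * (n : ℝ) ^ 2 * B / η := by ring
      _ ≤ _ := this
  have hηD : 4 * (1 / η) ≤ D := by
    refine le_trans (mul_le_mul_of_nonneg_left (div_le_div_of_nonneg_right ?_ hη.le)
      (by norm_num)) hDge
    exact one_le_mul_of_one_le_of_one_le (one_le_pow₀ hn1) hB1
  have hD4 : 4 ≤ D := by
    have : 1 ≤ 1 / η := (one_le_div hη).2 hnet.η_lt_one.le
    linarith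
  set Y := R * L * (1 + 4 * tmix) ^ 2 * D with hY
  have hgoal : √(n : ℝ) * (Fintype.card S : ℝ) * (Fintype.card A : ℝ) * (1 + 4 * tmix) ^ 2 * D = Y := by
    rw [hY, hL]
    ring
  rw [hgoal]
  have hM5 : 1 ≤ 1 + 4 * tmix := by linarith
  have hMM : 1 + 4 * tmix ≤ (1 + 4 * tmix) ^ 2 := by nlinarith
  -- The disagreement is itself O(β), hence a second-order error. The factor 4n²B/η is absorbed by
  -- D, and one power of 1 + 4tmix is given away.
  have hdis : ∀ t, β * (R / n * ∫ ω, disagreement (fun i => μ t i ω) ∂P) ≤ β ^ 2 * (2 * Y) := by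
    intro t
    have h1 := h.integral_disagreement_le hnet hζ hζ0 hn ht hβ t
    calc β * (R / n * ∫ ω, disagreement (fun i => μ t i ω) ∂P)
        ≤ β * (R / n * (B * (n * (4 * β * (4 * tmix + 1) * L)) * (2 * (n : ℝ) ^ 2 / η))) := by
          gcongr
      _ = β ^ 2 * (2 * (R * L * (1 + 4 * tmix) * (4 * ((n : ℝ) ^ 2 * B / η)))) := by
          field_simp
          ring
      _ ≤ β ^ 2 * (2 * (R * L * (1 + 4 * tmix) ^ 2 * D)) := by gcongr
  have hvar : 2 * L * (4 * tmix + 1) ^ 2 + Fintype.card S * tmix ^ 2 / η ≤ Y := by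
    have h1 : 2 * L * (4 * tmix + 1) ^ 2 ≤ 1 / 2 * Y := by
      calc 2 * L * (4 * tmix + 1) ^ 2 = 1 / 2 * (1 * L * (1 + 4 * tmix) ^ 2 * 4) := by ring
        _ ≤ 1 / 2 * (R * L * (1 + 4 * tmix) ^ 2 * D) := by gcongr
    have h2 : Fintype.card S * tmix ^ 2 / η ≤ 1 / 2 * Y := by
      calc Fintype.card S * tmix ^ 2 / η = 1 / 4 * (1 * Fintype.card S * tmix ^ 2 * (4 * (1 / η))) := by
            field_simp
        _ ≤ 1 / 2 * (R * L * (1 + 4 * tmix) ^ 2 * D) := by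
            gcongr
            · norm_num
            · linarith
    linarith
  have htel : ∀ k : ℕ, ∫ ω, potential tmix vstar mustar (fun i => μ k i ω) (fun i => v k i ω) ∂P +
      β * ∑ t ∈ Finset.range k, ∫ ω, M.gap lam vstar (meanMu fun i => μ t i ω) ∂P ≤
      lyapunov (n := n) tmix vstar mustar (fun _ => ζ) (fun _ => 0) + k * (β ^ 2 * (3 * Y)) := by
    intro k
    induction k with
    | zero =>
      simp only [h.init_mu, h.init_v, lyapunov_eq_potential hn]
      simp
    | succ k ih =>
      have h1 := h.integral_potential_le hW hζ hζ0 hη hn ht hβ hα hopt hmu hvs k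
      have h2 := hdis k
      have h3 := mul_le_mul_of_nonneg_left hvar (sq_nonneg β)
      rw [Finset.sum_range_succ, mul_add]
      push_cast
      linarith
  have hpos : 0 ≤ ∫ ω, potential tmix vstar mustar (fun i => μ T i ω) (fun i => v T i ω) ∂P :=
    integral_nonneg fun ω => potential_nonneg (h.mu_pos hW hζ hζ0 T ω)
      (fun i => (h.mu_mem hζ T i ω).2.1) hmu.1 hmu.2.1 _
  linarith [htel T]

/-- With b = √(E/(QT)) one has E = b²QT, and the left side becomes (κ⁻¹ + 3κ)Qb. -/
lemma step_size_balance {E Q T κ β : ℝ} (hE : 0 < E) (hQ : 0 < Q) (hT : 0 < T) (hκ : 0 < κ)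
    (hβ : β = κ * √(E / (Q * T))) :
    (E + T * (β ^ 2 * (3 * Q))) / (β * T) ≤ 4 * max κ κ⁻¹ * √(E * Q / T) := by
  have hb : 0 < √(E / (Q * T)) := Real.sqrt_pos.2 (by positivity)
  have hb2 : √(E / (Q * T)) ^ 2 = E / (Q * T) := Real.sq_sqrt (by positivity)
  set b := √(E / (Q * T)) with hbdef
  have hr : √(E * Q / T) = Q * b := by
    rw [← Real.sqrt_sq (show 0 ≤ Q * b by positivity), mul_pow, hb2]
    congr 1
    field_simp
  have hE' : E = b ^ 2 * (Q * T) := by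
    rw [hb2]
    field_simp
  rw [hr, hβ]
  have h1 : (E + T * ((κ * b) ^ 2 * (3 * Q))) / (κ * b * T) = (κ⁻¹ + 3 * κ) * (Q * b) := by
    rw [hE']
    field_simp
  rw [h1]
  refine mul_le_mul_of_nonneg_right ?_ (by positivity)
  linarith [le_max_left κ κ⁻¹, le_max_right κ κ⁻¹]

theorem IsRun.integral_gap_le [Nonempty S] [Nonempty A] {G : ℕ → SimpleGraph (Fin n)} {B : ℕ}
    (h : IsRun M W τ tmix α β ζ P ℱ μ v X) (hτ : M.IsTauStationary τ) (hmix : M.IsMixing tmix)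
    (hopt : M.IsOptimal lam vstar mustar) (hnet : IsMixingNetwork G W η B)
    (hζ : ζ ∈ occupancySet S A τ) (hζ0 : ∀ s a, 0 < ζ s a)
    (hn : 0 < n) {T : ℕ} (hT : 0 < T) {E κ : ℝ}
    (hE : E = lyapunov (n := n) tmix vstar mustar (fun _ => ζ) (fun _ => 0)) (hκ : 0 < κ)
    (hβ : β = κ * √(E / (√(n : ℝ) * (Fintype.card S : ℝ) * (Fintype.card A : ℝ) *
      (1 + 4 * tmix) ^ 2 * netD n η B * (T : ℝ))))
    (hα : α = (Fintype.card S : ℝ) * tmix ^ 2 * β) :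
    Integrable (fun ω => M.gap lam vstar (muHat T μ ω)) P ∧
      ∫ ω, M.gap lam vstar (muHat T μ ω) ∂P ≤
        4 * max κ κ⁻¹ * ((1 + 4 * tmix) *
          √(√(n : ℝ) * E * (Fintype.card S : ℝ) * (Fintype.card A : ℝ) * netD n η B / (T : ℝ))) := by
  have hW := hnet.isWeight
  obtain ⟨ht, hvs⟩ := hopt.vstar_mem hτ hmix
  have hmu := hτ.mem_occupancySet hopt.occupancy.feasible
  obtain ⟨hint, heq⟩ := h.integrable_gap (P := P) (lam := lam) (vstar := vstar) hW hζ hζ0 hT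
  refine ⟨hint, ?_⟩
  rw [heq]
  have hkl := klDiv_nonneg hmu.1 hζ0 (hmu.2.1.trans hζ.2.1.symm)
  have hE2 : E = klDiv mustar ζ +
      1 / (2 * (Fintype.card S : ℝ) * tmix ^ 2) * ∑ s, vstar s ^ 2 := by
    rw [hE, lyapunov_eq_potential hn, potential_const hn]
  have hq : 0 ≤ 1 / (2 * (Fintype.card S : ℝ) * tmix ^ 2) * ∑ s, vstar s ^ 2 :=
    mul_nonneg (by positivity) (Finset.sum_nonneg fun s _ => sq_nonneg _)
  have hE0 : 0 ≤ E := by linarith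
  have hT' : (0 : ℝ) < T := by exact_mod_cast hT
  -- If E = 0 then β = 0 and one cannot divide by it; but then ζ = μ*, the measures never move, and
  -- the gap at μ* is zero.
  rcases hE0.eq_or_lt with hz | hpos
  · have hβ0 : β = 0 := by rw [hβ, ← hz]; simp
    have hζ' : mustar = ζ :=
      eq_of_klDiv_nonpos hmu.1 hζ0 (hmu.2.1.trans hζ.2.1.symm) (by linarith)
    subst hζ' hβ0
    have hn' : (n : ℝ) ≠ 0 := by positivity
    have hmean : ∀ t ω, meanMu (fun i => μ t i ω) = mustar := fun t ω => by
      funext s a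
      simp [meanMu, mean, h.eq_of_step_zero hW (by linarith) hζ hζ0, hn']
    simp [hmean, hopt.gap_mustar, ← hz]
  · set D := netD n η B with hD
    have hD0 : 0 < D := lt_of_lt_of_le (by
      have := hnet.η_pos
      have : (0 : ℝ) < B := by exact_mod_cast hnet.B_pos
      have : (0 : ℝ) < n := by exact_mod_cast hn
      positivity) (netD_ge hn hnet.η_pos hnet.η_lt_one hnet.B_pos)
    have hM : 0 < 1 + 4 * tmix := by linarith
    have hn' : (0 : ℝ) < n := by exact_mod_cast hn
    have hS : (0 : ℝ) < Fintype.card S := by exact_mod_cast Fintype.card_pos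
    have hA : (0 : ℝ) < Fintype.card A := by exact_mod_cast Fintype.card_pos
    set Q := √(n : ℝ) * (Fintype.card S : ℝ) * (Fintype.card A : ℝ) * (1 + 4 * tmix) ^ 2 * D with hQ
    have hQ0 : 0 < Q := by
      have := Real.sqrt_pos.2 hn'
      positivity
    have hβ0 : 0 < β := by
      rw [hβ]
      exact mul_pos hκ (Real.sqrt_pos.2 (by positivity))
    have hsum := h.sum_integral_gap_le hnet hζ hζ0 hn ht hβ0.le hα hopt hmu hvs T
    rw [← hE] at hsum
    have hroot : (1 + 4 * tmix) *
        √(√(n : ℝ) * E * (Fintype.card S : ℝ) * (Fintype.card A : ℝ) * D / (T : ℝ)) =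
        √(E * Q / T) := by
      rw [hQ, ← Real.sqrt_sq hM.le, ← Real.sqrt_mul (sq_nonneg _), Real.sqrt_sq hM.le]
      congr 1
      ring
    rw [hroot]
    refine le_trans ?_ (step_size_balance hpos hQ0 hT' hκ hβ)
    rw [le_div_iff₀ (by positivity)]
    refine le_trans (le_of_eq ?_) hsum
    field_simp

end Rate

end RMAPD

end

theorem theorem1 :
    ∃ C : ℝ, 0 < C ∧
      ∀ (n : ℕ) (_ : 0 < n)
        (S : Type*) [Fintype S] [Nonempty S]
        (Act : Fin n → Type*) [∀ i, Fintype (Act i)] [∀ i, Nonempty (Act i)]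
        (M : RMAPD.MAMDP n S (∀ i, Act i))
        (τ tmix : ℝ) (_ : M.IsTauStationary τ) (_ : M.IsMixing tmix)
        (lam : ℝ) (vstar : S → ℝ) (mustar : S → (∀ i, Act i) → ℝ)
        (_ : M.IsOptimal lam vstar mustar)
        (G : ℕ → SimpleGraph (Fin n)) (W : ℕ → Matrix (Fin n) (Fin n) ℝ) (η : ℝ) (B : ℕ)
        (_ : RMAPD.IsMixingNetwork G W η B)
        (ζ : S → (∀ i, Act i) → ℝ) (_ : ζ ∈ RMAPD.occupancySet S (∀ i, Act i) τ)
        (_ : ∀ s a, 0 < ζ s a)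
        (T : ℕ) (_ : 0 < T)
        (E₀ : ℝ) (_ : E₀ = RMAPD.lyapunov (n := n) tmix vstar mustar (fun _ => ζ) (fun _ => 0))
        (κ : ℝ) (_ : 0 < κ)
        (α β : ℝ)
        (_ : β = κ * √(E₀ / (√(n : ℝ) * (Fintype.card S : ℝ) * (Fintype.card (∀ i, Act i) : ℝ) *
          (1 + 4 * tmix) ^ 2 * RMAPD.netD n η B * (T : ℝ))))
        (_ : α = (Fintype.card S : ℝ) * tmix ^ 2 * β)
        (Ω : Type*) [mΩ : MeasurableSpace Ω] (ℙ : MeasureTheory.Measure Ω)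
        [MeasureTheory.IsProbabilityMeasure ℙ] (ℱ : MeasureTheory.Filtration ℕ mΩ)
        (μ : ℕ → Fin n → Ω → S → (∀ i, Act i) → ℝ) (v : ℕ → Fin n → Ω → S → ℝ)
        (X : ℕ → Fin n → Ω → S × (∀ i, Act i) × S)
        (_ : RMAPD.IsRun M W τ tmix α β ζ ℙ ℱ μ v X),
        MeasureTheory.Integrable (fun ω => M.gap lam vstar (RMAPD.muHat T μ ω)) ℙ ∧
        ∫ ω, M.gap lam vstar (RMAPD.muHat T μ ω) ∂ℙ ≤
          C * max κ κ⁻¹ * ((1 + 4 * tmix) *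
            √(√(n : ℝ) * E₀ * (Fintype.card S : ℝ) * (Fintype.card (∀ i, Act i) : ℝ) *
              RMAPD.netD n η B / (T : ℝ))) := by
  -- The constant 4 = 1 + 3 comes from κ⁻¹ + 3κ ≤ 4 max(κ, κ⁻¹).
  refine ⟨4, by norm_num, ?_⟩
  intro n hn S _ _ Act _ _ M τ tmix hτ hmix lam vstar mustar hopt G W η B hnet ζ hζ hζ0 T hT E₀ hE κ hκ
    α β hβ hα Ω mΩ ℙ _ ℱ μ v X hrun
  exact hrun.integral_gap_le hτ hmix hopt hnet hζ hζ0 hn hT hE hκ hβ hα
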